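/- Let $(a,b)$, $-\infty\le a<b\le\infty$, be an interval and let $\varrho,\varsigma,\chi$ be locally finite Borel measures on $(a,b)$ such that $\varrho$ is real-valued, $\varsigma\ge 0$ has support $(a,b)$, $\chi\ge0$ is not identically zero, and $\varsigma(\{x\})\chi(\{x\})=\varsigma(\{x\})\varrho(\{x\})=0$ for all $x\in(a,b)$. *The expression $\tau$.* Write $\int_c^x=\int_{[c,x)}$ for $x\ge c$ and $\int_c^x=-\int_{[x,c)}$ for $x<c$, and let $AC_{\rm loc}(\mu)$ be the set of functions $f(x)=f(c)+\int_c^x h\,d\mu$ with $h=df/d\mu\in L^1_{\rm loc}((a,b);\mu)$. The domain $\mathfrak D_\tau$ consists of all $f\in AC_{\rm loc}(\varsigma)$ for which $-\frac{df}{d\varsigma}+\int_c^{x} f\,d\chi$ has a (necessarily unique) representative in $AC_{\rm loc}(\varrho)$; its derivative with respect to $\varrho$ is $\tau f\in L^1_{\rm loc}((a,b);\varrho)$, and $f^{[1]}$ is the corresponding representative of $df/d\varsigma$. For other $f\in AC_{\rm loc}(\varsigma)$, $f^{[1]}=df/d\varsigma$. Let $T_{\rm loc}$ be the set of all pairs $(f,f_\tau)\in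 AC_{\rm loc}(\varsigma)^2$ with $f\in\mathfrak D_\tau$ and $\tau f=f_\tau$ in $L^1_{\rm loc}((a,b);\varrho)$. A solution $u$ of $(\tau-z)u=0$ is identified with the pair $(u,zu)\in T_{\rm loc}$. For pairs $f,g\in T_{\rm loc}$ put $$V(f,g)(x)=f_\tau(x)g^{[1]}(x)-f^{[1]}(x)g_\tau(x),$$ and let $V(f,g)(a)$, $V(f,g)(b)$ be the limits at the endpoints; $*$ denotes complex conjugation. *The space $H^1(a,b)$.* It consists of all $f\in AC_{\rm loc}(\varsigma)$ with $f\in L^2(\chi)$, $f^{[1]}\in L^2(\varsigma)$, and has the inner product $\langle f,g\rangle=\int_a^b f g^*\,d\chi+\int_a^b f^{[1]}g^{[1]*}\,d\varsigma$. A function $f\in AC_{\rm loc}(\varsigma)$ lies in $H^1(a,b)$ near an endpoint if these square integrability conditions hold near that endpoint. Put $T_{\max}=T_{\rm loc}\cap (H^1(a,b)\times H^1(a,b))$. Let $w_a,w_b$ be the (up to scalar multiples unique) non-trivial real solutions of $\tau u=0$ which lie in $H^1(a,b)$ near $a$, $b$, respectively, and satisfy $\lim_{x\to a}g(x)w_a^{[1]}(x)=\lim_{x\to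 b}g(x)w_b^{[1]}(x)=0$ for all $g\in H^1(a,b)$. The point evaluation at $x$ is represented by $$\delta_x(y)=\frac{1}{W(w_b,w_a)}\begin{cases}w_a(y)w_b(x),&y\le x,\\ w_a(x)w_b(y),&y>x,\end{cases}\qquad W(w_b,w_a)=w_bw_a^{[1]}-w_b^{[1]}w_a .$$ *Boundary conditions.* An endpoint is in the limit-circle (l.c.) case if for every $z\in\mathbb C\setminus\{0\}$ all solutions of $(\tau-z)u=0$ lie in $H^1(a,b)$ near it, and in the limit-point (l.p.) case if for every $z\in\mathbb C\setminus\{0\}$ some solution does not. Let $v_a,v_b\in T_{\max}$ be such that, if $\tau$ is in the l.c. case at $a$, then $V(v_a,v_a^*)(a)=0$ and $V(f,v_a^*)(a)\ne0$ for some $f\in T_{\max}$, and likewise for $v_b$ if $\tau$ is in the l.c. case at $b$. Let $$S=\{f\in T_{\max}\mid V(f,v_a^*)(a)=V(f,v_b^*)(b)=0\}$$ be the corresponding (self-adjoint) restriction of $T_{\max}$ with separated boundary conditions. Its resolvent set $\rho(S)$ is the set of $z\in\mathbb C$ for which $R_z=(S-z)^{-1}$ is an everywhere defined bounded operator on $H^1(a,b)$.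 **Theorem.** Let $z\in\rho(S)$, $z\neq0$, and let $u_a$, $u_b$ be non-trivial solutions of $(\tau-z)u=0$ such that $u_a$ satisfies $V(u_a,v_a^*)(a)=0$ if $\tau$ is in the l.c. case at $a$ and lies in $H^1(a,b)$ near $a$ if $\tau$ is in the l.p. case at $a$, and such that $u_b$ satisfies $V(u_b,v_b^*)(b)=0$ if $\tau$ is in the l.c. case at $b$ and lies in $H^1(a,b)$ near $b$ if $\tau$ is in the l.p. case at $b$. Then $V(u_b,u_a)$ is a non-zero constant and, with $G_z$ given by $$G_z(x,y)+\frac{\delta_x(y)}{z}=\frac{1}{V(u_b,u_a)}\begin{cases}u_a(y)u_b(x),&y\le x,\\ u_a(x)u_b(y),&y>x,\end{cases}\qquad x,y\in(a,b),$$ one has $G_z(x,\cdot)^*\in H^1(a,b)$ for every $x\in(a,b)$ and $$R_zg(x)=\langle g,G_z(x,\cdot)^*\rangle,\qquad x\in(a,b),\ g\in H^1(a,b).$$ -/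

import Mathlib

open Set Filter Topology MeasureTheory

noncomputable section

namespace LeftDefinite

/-- The open interval `(a, b)`, with possibly infinite endpoints, as a type.  The endpoints
`a` and `b` are approached along the filters `atBot` and `atTop` of this type. -/
abbrev Interval (a b : EReal) : Type := {x : ℝ // a < (x : EReal) ∧ (x : EReal) < b}

/-- A (locally finite) real-valued Borel measure, given by its Jordan decomposition. -/
structure RealMeasure (X : Type) [TopologicalSpace X] [MeasurableSpace X] where
  pos : Measure X
  neg : Measure X
  locallyFinite_pos : IsLocallyFiniteMeasure pos
  locallyFinite_neg : IsLocallyFiniteMeasure neg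
  mutuallySingular : pos ⟂ₘ neg

/-- The total variation `|ϱ|`. -/
def RealMeasure.variation {X : Type} [TopologicalSpace X] [MeasurableSpace X]
    (ϱ : RealMeasure X) : Measure X := ϱ.pos + ϱ.neg

variable {a b : EReal}

/-- `∫_c^x h dμ`: the integral over `[c, x)` if `c ≤ x`, minus the integral over `[x, c)`
otherwise. -/
def orientedInt (μ : Measure (Interval a b)) (h : Interval a b → ℂ) (c x : Interval a b) : ℂ :=
  if c ≤ x then ∫ s in Ico c x, h s ∂μ else -∫ s in Ico x c, h s ∂μ

/-- `∫_c^x h dϱ` for a real-valued measure `ϱ`. -/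
def orientedIntReal (ϱ : RealMeasure (Interval a b)) (h : Interval a b → ℂ)
    (c x : Interval a b) : ℂ :=
  orientedInt ϱ.pos h c x - orientedInt ϱ.neg h c x

/-- `f ∈ AC_loc((a,b); μ)` with `h` a representative of `df/dμ ∈ L¹_loc((a,b); μ)`. -/
def HasRNDeriv (μ : Measure (Interval a b)) (f h : Interval a b → ℂ) : Prop :=
  LocallyIntegrable h μ ∧ ∀ c x, f x = f c + orientedInt μ h c x

/-- `f ∈ AC_loc((a,b); ϱ)` with `h` a representative of `df/dϱ ∈ L¹_loc((a,b); ϱ)`. -/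
def HasRNDerivReal (ϱ : RealMeasure (Interval a b)) (f h : Interval a b → ℂ) : Prop :=
  LocallyIntegrable h ϱ.variation ∧ ∀ c x, f x = f c + orientedIntReal ϱ h c x

/-- The coefficients `ϱ, ς, χ` of a left-definite measure Sturm--Liouville expression
`τ f = d/dϱ (-df/dς + ∫ f dχ)` on `(a, b)`. -/
structure Coeff (a b : EReal) where
  ϱ : RealMeasure (Interval a b)
  ς : Measure (Interval a b)
  χ : Measure (Interval a b)
  locallyFinite_ς : IsLocallyFiniteMeasure ς
  locallyFinite_χ : IsLocallyFiniteMeasure χ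
  /-- The topological support of `ς` is the whole interval. -/
  support_ς : ς.IsOpenPosMeasure
  χ_ne_zero : χ ≠ 0
  atoms_ς_χ : ∀ x, ς {x} * χ {x} = 0
  atoms_ς_ϱ : ∀ x, ς {x} * ϱ.variation {x} = 0

namespace Coeff

variable (D : Coeff a b)

/-- `AC_loc((a,b); ς)`. -/
def ACLoc (f : Interval a b → ℂ) : Prop := ∃ h, HasRNDeriv D.ς f h

/-- `f₁` is a representative of `df/dς` for which `-f₁ + ∫_c f dχ` lies in
`AC_loc((a,b); ϱ)`. -/
def IsQuasiDeriv (f f₁ : Interval a b → ℂ) : Prop :=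
  HasRNDeriv D.ς f f₁ ∧
    ∀ c, ∃ h, HasRNDerivReal D.ϱ (fun x => -f₁ x + orientedInt D.χ f c x) h

/-- The maximal domain `𝔇_τ` of the differential expression `τ`. -/
def MemDomain (f : Interval a b → ℂ) : Prop := ∃ f₁, D.IsQuasiDeriv f f₁

open Classical in
/-- The quasi-derivative `f^[1]`: for `f ∈ 𝔇_τ` the representative of `df/dς` singled out by
`IsQuasiDeriv` (it is unique since `ς` is supported on the whole interval), and for other
`f ∈ AC_loc((a,b); ς)` some representative of `df/dς`, which is unique `ς`-almost everywhere. -/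
def qd (f : Interval a b → ℂ) : Interval a b → ℂ :=
  if h : ∃ f₁, D.IsQuasiDeriv f f₁ then h.choose
  else if h : ∃ f₁, HasRNDeriv D.ς f f₁ then h.choose
  else 0

/-- The linear relation `T_loc` of all pairs `(f, f_τ)` in `AC_loc((a,b); ς)` such that
`f ∈ 𝔇_τ` and `τ f = f_τ` in `L¹_loc((a,b); ϱ)`. -/
def TLoc : Set ((Interval a b → ℂ) × (Interval a b → ℂ)) :=
  {p | D.ACLoc p.1 ∧ D.ACLoc p.2 ∧ D.MemDomain p.1 ∧
    ∀ c, HasRNDerivReal D.ϱ (fun x => -D.qd p.1 x + orientedInt D.χ p.1 c x) p.2}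

/-- `u` is a solution of `(τ - z) u = 0`. -/
def IsSolution (z : ℂ) (u : Interval a b → ℂ) : Prop := (u, z • u) ∈ D.TLoc

/-- The modified Wronskian `V(f, g)(x) = f_τ(x) g^[1](x) - f^[1](x) g_τ(x)` of two pairs. -/
def V (f g : (Interval a b → ℂ) × (Interval a b → ℂ)) (x : Interval a b) : ℂ :=
  f.2 x * D.qd g.1 x - D.qd f.1 x * g.2 x

/-- The modified Sobolev space `H¹(a,b)`. -/
def H1 : Set (Interval a b → ℂ) :=
  {f | D.ACLoc f ∧ MemLp f 2 D.χ ∧ MemLp (D.qd f) 2 D.ς}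

/-- The inner product of `H¹(a,b)`, linear in the first argument. -/
def innerH1 (f g : Interval a b → ℂ) : ℂ :=
  (∫ x, f x * star (g x) ∂D.χ) + ∫ x, D.qd f x * star (D.qd g x) ∂D.ς

/-- The norm of `H¹(a,b)`. -/
def normH1 (f : Interval a b → ℂ) : ℝ := Real.sqrt (D.innerH1 f f).re

/-- `f` lies in `H¹(a,b)` near the endpoint `e`; here and below `e` is `atBot` for the
endpoint `a` and `atTop` for the endpoint `b`. -/
def MemH1Near (e : Filter (Interval a b)) (f : Interval a b → ℂ) : Prop :=
  D.ACLoc f ∧ ∃ s ∈ e, MemLp f 2 (D.χ.restrict s) ∧ MemLp (D.qd f) 2 (D.ς.restrict s)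

/-- The maximal relation `T_max` in `H¹(a,b)`. -/
def TMax : Set ((Interval a b → ℂ) × (Interval a b → ℂ)) :=
  {p | p ∈ D.TLoc ∧ p.1 ∈ D.H1 ∧ p.2 ∈ D.H1}

/-- The limit-circle case at the endpoint `e`. -/
def LimitCircle (e : Filter (Interval a b)) : Prop :=
  ∀ z : ℂ, z ≠ 0 → ∀ u, D.IsSolution z u → D.MemH1Near e u

/-- The limit-point case at the endpoint `e`. -/
def LimitPoint (e : Filter (Interval a b)) : Prop :=
  ∀ z : ℂ, z ≠ 0 → ∃ u, D.IsSolution z u ∧ ¬ D.MemH1Near e u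

/-- The pair `f` satisfies the boundary condition `V(f, v*)(e) = 0` at the endpoint `e`. -/
def SatisfiesBC (e : Filter (Interval a b)) (v f : (Interval a b → ℂ) × (Interval a b → ℂ)) :
    Prop :=
  Tendsto (D.V f (star v)) e (𝓝 0)

/-- `v` gives rise to a proper boundary condition at `e`: `V(v, v*)(e) = 0`, and
`V(f, v*)(e) ≠ 0` for some `f ∈ T_max`. -/
def IsBoundaryPair (e : Filter (Interval a b)) (v : (Interval a b → ℂ) × (Interval a b → ℂ)) :
    Prop :=
  D.SatisfiesBC e v v ∧ ∃ f ∈ D.TMax, ∃ L : ℂ, L ≠ 0 ∧ Tendsto (D.V f (star v)) e (𝓝 L)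

/-- The restriction `S` of `T_max` with the separated boundary conditions
`V(f, v_a*)(a) = V(f, v_b*)(b) = 0`. -/
def sepRestriction (va vb : (Interval a b → ℂ) × (Interval a b → ℂ)) :
    Set ((Interval a b → ℂ) × (Interval a b → ℂ)) :=
  {f | f ∈ D.TMax ∧ D.SatisfiesBC atBot va f ∧ D.SatisfiesBC atTop vb f}

/-- The resolvent set of a linear relation `S` in `H¹(a,b)`: all `z` for which `(S - z)⁻¹`
is (the graph of) an everywhere defined bounded operator on `H¹(a,b)`. -/
def resolventSet (S : Set ((Interval a b → ℂ) × (Interval a b → ℂ))) : Set ℂ :=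
  {z | (∀ g ∈ D.H1, ∃! f, f ∈ D.H1 ∧ (f, g + z • f) ∈ S) ∧
    ∃ C : ℝ, ∀ g ∈ D.H1, ∀ f ∈ D.H1, (f, g + z • f) ∈ S → D.normH1 f ≤ C * D.normH1 g}

open Classical in
/-- The resolvent `R_z g = (S - z)⁻¹ g`. -/
def resolvent (S : Set ((Interval a b → ℂ) × (Interval a b → ℂ))) (z : ℂ)
    (g : Interval a b → ℂ) : Interval a b → ℂ :=
  if h : ∃ f, f ∈ D.H1 ∧ (f, g + z • f) ∈ S then h.choose else 0

/-- `w` is a non-trivial real solution of `τ w = 0` which lies in `H¹(a,b)` near the endpoint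
`e` and for which `g w^[1]` vanishes at `e` for every `g ∈ H¹(a,b)`. -/
def IsPrincipal (e : Filter (Interval a b)) (w : Interval a b → ℂ) : Prop :=
  D.IsSolution 0 w ∧ w ≠ 0 ∧ (∀ x, (w x).im = 0) ∧ D.MemH1Near e w ∧
    ∀ g ∈ D.H1, Tendsto (fun x => g x * D.qd w x) e (𝓝 0)

open Classical in
/-- The solution `w_a` (for `e = atBot`) or `w_b` (for `e = atTop`), which is unique up to
scalar multiples. -/
def principal (e : Filter (Interval a b)) : Interval a b → ℂ :=
  if h : ∃ w, D.IsPrincipal e w then h.choose else 0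

/-- The usual Wronskian `W(f, g)(x) = f(x) g^[1](x) - f^[1](x) g(x)`. -/
def wronskian (f g : Interval a b → ℂ) (x : Interval a b) : ℂ :=
  f x * D.qd g x - D.qd f x * g x

/-- The function `δ_c`, which represents the point evaluation at `c` in `H¹(a,b)`; the
Wronskian of `w_b` and `w_a` does not depend on the point. -/
def delta (c x : Interval a b) : ℂ :=
  (if x ≤ c then D.principal atBot x * D.principal atTop c
    else D.principal atBot c * D.principal atTop x) /
    D.wronskian (D.principal atTop) (D.principal atBot) c

end Coeff

end LeftDefinite

end

set_option linter.unusedSectionVars false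

/-! Everything is carried over to a single σ-finite measure. Relative to `m = ς + χ + |ϱ|` the
coefficients become bounded densities `p`, `q`, `r`, and `(τ - z) u = 0` becomes the first order
system `du = p u₁ dm`, `du₁ = (q - z r) u dm`. The hypotheses on atoms say that `p q` and `p r`
vanish at every atom of `m`. This removes the jump terms from the product rule, so Wronskians are
constant and initial value problems are uniquely solvable in both directions.

For pairs `(f, f_τ)` the Lagrange identity `dV = L dm` (`Elt.prim_V`) has as `L` a difference of two
`H¹` densities, from which `ϱ` has dropped out. If `f = R_z g`, then for `P = (f, g + z f)` and a
solution `u` the density `L` is that of the `H¹` product of `g` with `u`. Since `V(P, u_a)` vanishes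
at `a` and `V(P, u_b)` at `b`, integration from each endpoint to `x` expresses `V(P, u_a)(x)` and
`V(P, u_b)(x)` by `g`; elimination of `f^[1](x)` gives `(g + z f)(x) V(u_b, u_a) = z ∫ ...` against
the kernel of `u_a`, `u_b` (`resolvent_eq`). The same integration with `w_a`, `w_b` shows that `δ_x`
reproduces `g(x)` (`integral_bil_principal_ker`), which turns `g(x) / z` into the term `δ_x / z`. If
`V(u_b, u_a)` vanished, `u_a` would be an eigenfunction of `S`, contrary to `z ∈ ρ(S)`
(`V_ne_zero`).

The analytic core is the vanishing of `V` at the endpoints. Pointwise, `V` is the determinant of the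
vectors `(f_τ, f^[1])` in a plane, so two pairs annihilated by the same non-degenerate condition
have vanishing Wronskian (`Elt.tendsto_V_of_tendsto`); this settles the l.c. case. In the l.p. case
`V` must vanish for all pairs of finite energy, which is part of `weyl_alternative`. Its source is
Weyl's limiting argument: solutions `θ + M φ` obeying a condition at a point `x_n` have energy up to
`x_n` at most linear in `|M|`, whereas the energy of `M φ` is quadratic, so `M` stays bounded as
`x_n` tends to the endpoint and a limit solution of finite energy exists (`Sol.exists_limit`). The
same compactness also produces `w_a` and `w_b` (`Sol.exists_principal`). -/

namespace MeasureSL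

/-! ### Linear Volterra equations with respect to a measure that may have atoms. -/

section Volterra

open scoped ENNReal

variable {X : Type*} [LinearOrder X] [TopologicalSpace X] [OrderTopology X]
  [SecondCountableTopology X] [MeasurableSpace X] [BorelSpace X]

/-- The iterated integrals of the constant function `1` over simplices. -/
noncomputable def iterInt (M : Measure X) : ℕ → X → ℝ≥0∞
  | 0 => fun _ => 1
  | n + 1 => fun x => ∫⁻ s in Iio x, iterInt M n s ∂M

theorem iterInt_mono (M : Measure X) (n : ℕ) : Monotone (iterInt M n) := by
  cases n with
  | zero => exact monotone_const
  | succ n => exact fun x y h => lintegral_mono_set (Iio_subset_Iio h)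

theorem measurable_iterInt (M : Measure X) (n : ℕ) : Measurable (iterInt M n) :=
  (iterInt_mono M n).measurable

/-- The square `{s < x} × {t < x}` contains the disjoint triangles `t < s` and `s < t`. Integrating
`iterInt M n t` over the first gives `iterInt M (n + 2) x`, over the second, after Fubini, a bound
for `n + 1` copies of it. Only the diagonal is lost; it is charged by atoms, which is why this is an
inequality. -/
theorem succ_mul_iterInt_le (M : Measure X) [SFinite M] (n : ℕ) (x : X) :
    (n + 1 : ℝ≥0∞) * iterInt M (n + 1) x ≤ M (Iio x) * iterInt M n x := by
  induction n generalizing x with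
  | zero => simp [iterInt]
  | succ n ih =>
    have hg := measurable_iterInt M n
    have e1 : ∀ s ∈ Iio x, ∫⁻ t in Iio x, (Iio s).indicator (iterInt M n) t ∂M
        = iterInt M (n + 1) s := by
      intro s hs
      rw [lintegral_indicator measurableSet_Iio, Measure.restrict_restrict measurableSet_Iio,
        inter_eq_self_of_subset_left (Iio_subset_Iio (le_of_lt hs))]
      rfl
    have e2 : ∀ t ∈ Iio x, ∫⁻ s in Iio x, (Ioi s).indicator (iterInt M n) t ∂M
        = M (Iio t) * iterInt M n t := by
      intro t ht
      have : ∀ s, (Ioi s).indicator (iterInt M n) t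
          = (Iio t).indicator (fun _ => iterInt M n t) s := by
        intro s; simp [indicator]
      simp only [this]
      rw [lintegral_indicator measurableSet_Iio, Measure.restrict_restrict measurableSet_Iio,
        inter_eq_self_of_subset_left (Iio_subset_Iio (le_of_lt ht)), lintegral_const]
      simp [mul_comm]
    have mlt : MeasurableSet {z : X × X | z.2 < z.1} := measurableSet_lt measurable_snd measurable_fst
    have mlt' : MeasurableSet {z : X × X | z.1 < z.2} := measurableSet_lt measurable_fst measurable_snd
    have m1 : Measurable (fun z : X × X => (Iio z.1).indicator (iterInt M n) z.2) := by
      have : (fun z : X × X => (Iio z.1).indicator (iterInt M n) z.2)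
          = {z : X × X | z.2 < z.1}.indicator (fun z => iterInt M n z.2) := by
        ext z; simp [indicator]
      rw [this]; exact (hg.comp measurable_snd).indicator mlt
    have m2 : Measurable (fun z : X × X => (Ioi z.1).indicator (iterInt M n) z.2) := by
      have : (fun z : X × X => (Ioi z.1).indicator (iterInt M n) z.2)
          = {z : X × X | z.1 < z.2}.indicator (fun z => iterInt M n z.2) := by
        ext z; simp [indicator]
      rw [this]; exact (hg.comp measurable_snd).indicator mlt'
    have hsum : ∀ s t, (Iio s).indicator (iterInt M n) t + (Ioi s).indicator (iterInt M n) t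
        ≤ iterInt M n t := by
      intro s t
      rcases lt_trichotomy t s with h | h | h
      · simp [indicator, h, not_lt.2 h.le]
      · simp [h]
      · simp [indicator, h, not_lt.2 h.le]
    calc ((n + 1 : ℕ) + 1 : ℝ≥0∞) * iterInt M (n + 1 + 1) x
        = iterInt M (n + 1 + 1) x + (n + 1 : ℝ≥0∞) * iterInt M (n + 1 + 1) x := by
          push_cast; ring
      _ ≤ (∫⁻ s in Iio x, iterInt M (n + 1) s ∂M)
          + ∫⁻ t in Iio x, M (Iio t) * iterInt M n t ∂M := by
          refine add_le_add le_rfl ?_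
          change (n + 1 : ℝ≥0∞) * ∫⁻ s in Iio x, iterInt M (n + 1) s ∂M ≤ _
          rw [← lintegral_const_mul _ (measurable_iterInt M (n + 1))]
          exact lintegral_mono fun t => ih t
      _ = (∫⁻ s in Iio x, ∫⁻ t in Iio x, (Iio s).indicator (iterInt M n) t ∂M ∂M)
          + ∫⁻ s in Iio x, ∫⁻ t in Iio x, (Ioi s).indicator (iterInt M n) t ∂M ∂M := by
          congr 1
          · exact (setLIntegral_congr_fun measurableSet_Iio e1).symm
          · rw [lintegral_lintegral_swap m2.aemeasurable]
            exact (setLIntegral_congr_fun measurableSet_Iio e2).symm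
      _ = ∫⁻ s in Iio x, ((∫⁻ t in Iio x, (Iio s).indicator (iterInt M n) t ∂M)
          + ∫⁻ t in Iio x, (Ioi s).indicator (iterInt M n) t ∂M) ∂M := by
          rw [lintegral_add_left]
          exact m1.lintegral_prod_right'
      _ ≤ ∫⁻ s in Iio x, ∫⁻ t in Iio x, iterInt M n t ∂M ∂M := by
          refine lintegral_mono fun s => ?_
          rw [← lintegral_add_left (hg.indicator measurableSet_Iio)]
          exact lintegral_mono fun t => hsum s t
      _ = M (Iio x) * iterInt M (n + 1) x := by
          rw [lintegral_const, Measure.restrict_apply_univ, mul_comm]; rfl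

theorem iterInt_le (M : Measure X) [SFinite M] (n : ℕ) (x : X) :
    (n.factorial : ℝ≥0∞) * iterInt M n x ≤ M (Iio x) ^ n := by
  induction n with
  | zero => simp [iterInt]
  | succ n ih =>
    calc ((n + 1).factorial : ℝ≥0∞) * iterInt M (n + 1) x
        = n.factorial * ((n + 1 : ℝ≥0∞) * iterInt M (n + 1) x) := by
          rw [Nat.factorial_succ]; push_cast; ring
      _ ≤ n.factorial * (M (Iio x) * iterInt M n x) :=
          mul_le_mul_right (succ_mul_iterInt_le M n x) _
      _ = M (Iio x) * (n.factorial * iterInt M n x) := by ring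
      _ ≤ M (Iio x) * M (Iio x) ^ n := by gcongr
      _ = _ := by ring

theorem iterInt_toReal_le (M : Measure X) [SFinite M] (hM : ∀ x, M (Iio x) < ∞) (n : ℕ) (x : X) :
    (iterInt M n x).toReal ≤ (M (Iio x)).toReal ^ n / n.factorial := by
  rw [le_div_iff₀ (by positivity), mul_comm]
  have := ENNReal.toReal_mono (ENNReal.pow_lt_top (hM x)).ne (iterInt_le M n x)
  simpa using this

theorem iterInt_lt_top (M : Measure X) [SFinite M] (hM : ∀ x, M (Iio x) < ∞) (n : ℕ) (x : X) :
    iterInt M n x < ∞ := by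
  by_contra h
  have h1 := iterInt_le M n x
  rw [not_lt_top_iff.1 h, ENNReal.mul_top (by positivity)] at h1
  exact absurd (ENNReal.pow_lt_top (hM x)) (by simpa using h1)

theorem integrableOn_iterInt (M : Measure X) [SFinite M] (hM : ∀ x, M (Iio x) < ∞) (n : ℕ)
    (x : X) : IntegrableOn (fun s => (iterInt M n s).toReal) (Iio x) M :=
  integrable_toReal_of_lintegral_ne_top (measurable_iterInt M n).aemeasurable
    (iterInt_lt_top M hM (n + 1) x).ne

theorem integral_iterInt (M : Measure X) [SFinite M] (hM : ∀ x, M (Iio x) < ∞) (n : ℕ) (x : X) :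
    ∫ s in Iio x, (iterInt M n s).toReal ∂M = (iterInt M (n + 1) x).toReal := by
  rw [integral_toReal (measurable_iterInt M n).aemeasurable
    (Eventually.of_forall fun s => iterInt_lt_top M hM n s)]
  rfl

variable {E : Type*} [NormedAddCommGroup E] [NormedSpace ℂ E]

theorem stronglyMeasurable_integral_Iio (M : Measure X) [SFinite M] {f : X → E}
    (hf : StronglyMeasurable f) : StronglyMeasurable fun x => ∫ s in Iio x, f s ∂M := by
  have mlt : MeasurableSet {z : X × X | z.2 < z.1} :=
    measurableSet_lt measurable_snd measurable_fst
  have h : StronglyMeasurable fun z : X × X => (Iio z.1).indicator f z.2 := by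
    have : (fun z : X × X => (Iio z.1).indicator f z.2)
        = {z : X × X | z.2 < z.1}.indicator (fun z => f z.2) := by
      ext z; simp [indicator]
    rw [this]; exact (hf.comp_measurable measurable_snd).indicator mlt
  have := h.integral_prod_right' (ν := M)
  simpa only [integral_indicator measurableSet_Iio] using this

theorem stronglyMeasurable_clm_apply {A : X → E →L[ℂ] E} (hA : StronglyMeasurable A) {f : X → E}
    (hf : StronglyMeasurable f) : StronglyMeasurable fun s => A s (f s) :=
  (isBoundedBilinearMap_apply.continuous).comp_stronglyMeasurable (hA.prodMk hf)

/-- Picard iteration: the `n`-th term is at most `K ^ n * ‖U₀‖ * iterInt M n`, hence at most `‖U₀‖ *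
(K * M (Iio x)) ^ n / n!`. The series converges like the exponential series, even in the presence of
atoms, because the integral runs over the open half-line `Iio x`. -/
theorem exists_volterra [CompleteSpace E] (M : Measure X) [SFinite M] (hM : ∀ x, M (Iio x) < ∞)
    {A : X → E →L[ℂ] E} (hA : StronglyMeasurable A) {K : ℝ} (hK : ∀ x, ‖A x‖ ≤ K) (U₀ : E) :
    ∃ U : X → E, (∀ x, IntegrableOn (fun s => A s (U s)) (Iio x) M) ∧
      ∀ x, U x = U₀ + ∫ s in Iio x, A s (U s) ∂M := by
  classical
  let t : ℕ → X → E := fun n => Nat.rec (fun _ => U₀) (fun _ f x => ∫ s in Iio x, A s (f s) ∂M) n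
  have t0 : ∀ x, t 0 x = U₀ := fun _ => rfl
  have ts : ∀ n x, t (n + 1) x = ∫ s in Iio x, A s (t n s) ∂M := fun _ _ => rfl
  have tm : ∀ n, StronglyMeasurable (t n) := by
    intro n
    induction n with
    | zero => exact stronglyMeasurable_const
    | succ n ih => exact stronglyMeasurable_integral_Iio M (stronglyMeasurable_clm_apply hA ih)
  rcases isEmpty_or_nonempty X with hX | ⟨⟨x₀⟩⟩
  · exact ⟨fun _ => U₀, fun x => (hX.false x).elim, fun x => (hX.false x).elim⟩
  have hK0 : 0 ≤ K := (norm_nonneg _).trans (hK x₀)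
  have tb : ∀ n x, ‖t n x‖ ≤ K ^ n * ‖U₀‖ * (iterInt M n x).toReal := by
    intro n
    induction n with
    | zero => intro x; simp [t0, iterInt]
    | succ n ih =>
      intro x
      rw [ts, ← integral_iterInt M hM, ← integral_const_mul]
      refine norm_integral_le_of_norm_le ((integrableOn_iterInt M hM n x).const_mul _)
        (Eventually.of_forall fun s => ?_)
      calc ‖A s (t n s)‖ ≤ K * (K ^ n * ‖U₀‖ * (iterInt M n s).toReal) :=
            (A s).le_of_opNorm_le_of_le (hK s) (ih s)
        _ = _ := by ring
  have tab : ∀ n s, ‖A s (t n s)‖ ≤ K ^ (n + 1) * ‖U₀‖ * (iterInt M n s).toReal := by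
    intro n s
    calc ‖A s (t n s)‖ ≤ K * (K ^ n * ‖U₀‖ * (iterInt M n s).toReal) :=
          (A s).le_of_opNorm_le_of_le (hK s) (tb n s)
      _ = _ := by ring
  have ti : ∀ n x, IntegrableOn (fun s => A s (t n s)) (Iio x) M := fun n x =>
    Integrable.mono' ((integrableOn_iterInt M hM n x).const_mul _)
      (stronglyMeasurable_clm_apply hA (tm n)).aestronglyMeasurable
      (Eventually.of_forall (tab n))
  have sb : ∀ n x, K ^ n * ‖U₀‖ * (iterInt M n x).toReal
      ≤ ‖U₀‖ * ((K * (M (Iio x)).toReal) ^ n / n.factorial) := by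
    intro n x
    calc K ^ n * ‖U₀‖ * (iterInt M n x).toReal
        ≤ K ^ n * ‖U₀‖ * ((M (Iio x)).toReal ^ n / n.factorial) := by
          gcongr; exact iterInt_toReal_le M hM n x
      _ = _ := by rw [mul_pow]; ring
  have hs : ∀ x, Summable fun n => K ^ n * ‖U₀‖ * (iterInt M n x).toReal := fun x =>
    Summable.of_nonneg_of_le (fun n => by positivity) (sb · x)
      ((Real.summable_pow_div_factorial _).mul_left _)
  have hts : ∀ x, Summable fun n => t n x := fun x =>
    Summable.of_norm_bounded (hs x) (tb · x)
  have hsi : ∀ x, Summable fun n => ∫ s in Iio x, ‖A s (t n s)‖ ∂M := by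
    intro x
    refine Summable.of_nonneg_of_le (fun n => integral_nonneg fun _ => norm_nonneg _) (fun n => ?_)
      ((summable_nat_add_iff 1).2 (hs x))
    rw [← integral_iterInt M hM, ← integral_const_mul]
    exact integral_mono (ti n x).norm ((integrableOn_iterInt M hM n x).const_mul _) (tab n)
  have hApp : ∀ s, A s (∑' n, t n s) = ∑' n, A s (t n s) := fun s => (A s).map_tsum (hts s)
  refine ⟨fun x => ∑' n, t n x, fun x => ?_, fun x => ?_⟩
  · have hm : StronglyMeasurable fun s => ∑' n, t n s :=
      stronglyMeasurable_of_tendsto atTop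
        (f := fun N s => ∑ n ∈ Finset.range N, t n s)
        (fun N => Finset.stronglyMeasurable_fun_sum _ fun n _ => tm n)
        (tendsto_pi_nhds.2 fun s => (hts s).hasSum.tendsto_sum_nat)
    have hC := (Real.summable_pow_div_factorial (K * (M (Iio x)).toReal)).mul_left ‖U₀‖
    refine Measure.integrableOn_of_bounded
      (M := K * ∑' n : ℕ, ‖U₀‖ * ((K * (M (Iio x)).toReal) ^ n / n.factorial)) (hM x).ne
      (stronglyMeasurable_clm_apply hA hm).aestronglyMeasurable ?_
    filter_upwards [ae_restrict_mem measurableSet_Iio] with s hs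
    refine (A s).le_of_opNorm_le_of_le (hK s) (tsum_of_norm_bounded hC.hasSum fun n => ?_)
    refine ((tb n s).trans (sb n s)).trans ?_
    have := ENNReal.toReal_mono (hM x).ne (measure_mono (μ := M) (Iio_subset_Iio (le_of_lt hs)))
    gcongr
  · have h := hasSum_integral_of_summable_integral_norm (fun n => ti n x) (hsi x)
    simp only [hApp]
    rw [← h.tsum_eq, (hts x).tsum_eq_zero_add, t0]

/-- The equation bounds `U` by the constant `B` to the left of `x`; reinserting this bound `n` times
gains the factor `K ^ n * iterInt M n`, which tends to zero. -/
theorem volterra_unique (M : Measure X) [SFinite M] (hM : ∀ x, M (Iio x) < ∞)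
    {A : X → E →L[ℂ] E} {K : ℝ} (hK : ∀ x, ‖A x‖ ≤ K) {U : X → E}
    (hi : ∀ x, IntegrableOn (fun s => A s (U s)) (Iio x) M)
    (hU : ∀ x, U x = ∫ s in Iio x, A s (U s) ∂M) (x : X) : U x = 0 := by
  have hK0 : 0 ≤ K := (norm_nonneg _).trans (hK x)
  set B := ∫ s in Iio x, ‖A s (U s)‖ ∂M with hB
  have hb : ∀ n, ∀ y ≤ x, ‖U y‖ ≤ K ^ n * B * (iterInt M n y).toReal := by
    intro n
    induction n with
    | zero =>
      intro y hy
      simp only [pow_zero, one_mul, iterInt, ENNReal.toReal_one, mul_one]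
      rw [hU y]
      refine (norm_integral_le_integral_norm _).trans ?_
      exact setIntegral_mono_set (hi x).norm (Eventually.of_forall fun _ => norm_nonneg _)
        (Iio_subset_Iio hy).eventuallyLE
    | succ n ih =>
      intro y hy
      rw [hU y, ← integral_iterInt M hM, ← integral_const_mul]
      refine norm_integral_le_of_norm_le ((integrableOn_iterInt M hM n y).const_mul _) ?_
      filter_upwards [ae_restrict_mem measurableSet_Iio] with s hs
      calc ‖A s (U s)‖ ≤ K * (K ^ n * B * (iterInt M n s).toReal) :=
            (A s).le_of_opNorm_le_of_le (hK s) (ih s (hs.le.trans hy))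
        _ = _ := by ring
  have hB0 : 0 ≤ B := integral_nonneg fun _ => norm_nonneg _
  have hlim : Tendsto (fun n : ℕ => B * ((K * (M (Iio x)).toReal) ^ n / n.factorial)) atTop
      (𝓝 (B * 0)) :=
    (FloorSemiring.tendsto_pow_div_factorial_atTop _).const_mul _
  rw [mul_zero] at hlim
  refine norm_le_zero_iff.1 (ge_of_tendsto' hlim fun n => (hb n x le_rfl).trans ?_)
  calc K ^ n * B * (iterInt M n x).toReal
      ≤ K ^ n * B * ((M (Iio x)).toReal ^ n / n.factorial) := by
        gcongr; exact iterInt_toReal_le M hM n x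
    _ = _ := by rw [mul_pow]; ring

end Volterra

end MeasureSL

namespace MeasureSL

/-! ### Left-continuous primitives, their product rule and the uniqueness of densities. -/

section Primitive

variable {X : Type*} [LinearOrder X] [TopologicalSpace X] [OrderTopology X]
  [SecondCountableTopology X] [MeasurableSpace X] [BorelSpace X]

/-- `F` is a left-continuous primitive of the locally integrable function `f`. -/
def Prim (m : Measure X) (F f : X → ℂ) : Prop :=
  (∀ x y, IntegrableOn f (Ico x y) m) ∧ ∀ x y, x ≤ y → F y - F x = ∫ s in Ico x y, f s ∂m

variable {m : Measure X} {F f G g : X → ℂ}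

theorem Prim.add (hF : Prim m F f) (hG : Prim m G g) :
    Prim m (fun x => F x + G x) (fun x => f x + g x) := by
  refine ⟨fun x y => (hF.1 x y).add (hG.1 x y), fun x y h => ?_⟩
  rw [integral_add (hF.1 x y) (hG.1 x y), ← hF.2 x y h, ← hG.2 x y h]; ring

theorem Prim.const_mul (c : ℂ) (hF : Prim m F f) :
    Prim m (fun x => c * F x) (fun x => c * f x) := by
  refine ⟨fun x y => (hF.1 x y).const_mul c, fun x y h => ?_⟩
  rw [integral_const_mul, ← hF.2 x y h]; ring

theorem Prim.sub (hF : Prim m F f) (hG : Prim m G g) :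
    Prim m (fun x => F x - G x) (fun x => f x - g x) := by
  refine ⟨fun x y => (hF.1 x y).sub (hG.1 x y), fun x y h => ?_⟩
  rw [integral_sub (hF.1 x y) (hG.1 x y), ← hF.2 x y h, ← hG.2 x y h]; ring

theorem Prim.conj (hF : Prim m F f) :
    Prim m (fun x => star (F x)) (fun x => star (f x)) := by
  refine ⟨fun x y => ?_, fun x y h => ?_⟩
  · exact (Complex.conjLIE.integrable_comp_iff (φ := f)).2 (hF.1 x y)
  · have := integral_conj (f := f) (μ := m.restrict (Ico x y))
    simp only [Complex.star_def]
    rw [this, ← hF.2 x y h, map_sub]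

theorem Prim.of_eq (hF : Prim m F f) (hFG : ∀ x, F x = G x) (hfg : ∀ x, f x = g x) :
    Prim m G g := by
  rwa [← funext hFG, ← funext hfg]

theorem Prim.norm_sub_le (h : Prim m F f) {x y : X} (hxy : x ≤ y) :
    ‖F y - F x‖ ≤ ∫ s in Ico x y, ‖f s‖ ∂m := by
  rw [h.2 x y hxy]; exact norm_integral_le_integral_norm _

theorem Prim.exists_bound (h : Prim m F f) (x y : X) :
    ∃ B, 0 ≤ B ∧ ∀ s ∈ Icc x y, ‖F s‖ ≤ B := by
  refine ⟨‖F x‖ + ∫ s in Ico x y, ‖f s‖ ∂m,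
    add_nonneg (norm_nonneg _) (integral_nonneg fun _ => norm_nonneg _), fun s hs => ?_⟩
  calc ‖F s‖ = ‖F x + (F s - F x)‖ := by ring_nf
    _ ≤ ‖F x‖ + ‖F s - F x‖ := norm_add_le _ _
    _ ≤ _ := by
      gcongr
      refine (h.norm_sub_le hs.1).trans ?_
      exact setIntegral_mono_set (h.1 x y).norm (Eventually.of_forall fun _ => norm_nonneg _)
        (Ico_subset_Ico_right hs.2).eventuallyLE

theorem aestronglyMeasurable_of_integrableOn_Ico [NoMaxOrder X] {E : Type*}
    [NormedAddCommGroup E] {f : X → E}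
    (h : ∀ x y, IntegrableOn f (Ico x y) m) : AEStronglyMeasurable f m := by
  rcases isEmpty_or_nonempty X with hX | hX
  · have : f = 0 := funext fun x => (hX.false x).elim
    rw [this]; exact aestronglyMeasurable_zero
  · have hc : AECover m ((atBot : Filter X) ×ˢ (atTop : Filter X))
        (fun p => Ico p.1 p.2) := aecover_Ico tendsto_fst tendsto_snd
    exact hc.aestronglyMeasurable fun p => (h p.1 p.2).aestronglyMeasurable

theorem stronglyMeasurable_integral_Ici {E : Type*} [NormedAddCommGroup E] [NormedSpace ℂ E]
    (M : Measure X) [SFinite M] {f : X → E}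
    (hf : StronglyMeasurable f) : StronglyMeasurable fun x => ∫ s in Ici x, f s ∂M := by
  have mlt : MeasurableSet {z : X × X | z.1 ≤ z.2} :=
    measurableSet_le measurable_fst measurable_snd
  have h : StronglyMeasurable fun z : X × X => (Ici z.1).indicator f z.2 := by
    have : (fun z : X × X => (Ici z.1).indicator f z.2)
        = {z : X × X | z.1 ≤ z.2}.indicator (fun z => f z.2) := by
      ext z; simp [indicator]
    rw [this]; exact (hf.comp_measurable measurable_snd).indicator mlt
  have := h.integral_prod_right' (ν := M)
  simpa only [integral_indicator measurableSet_Ici] using this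

/-- Around a base point `c`, the primitive is a difference of integrals over `Iio x` and `Ici x` of
a strongly measurable version of `f`; such integrals depend measurably on `x` as sections of a
product integral. -/
theorem Prim.stronglyMeasurable [NoMaxOrder X] [SFinite m] (h : Prim m F f) :
    StronglyMeasurable F := by
  rcases isEmpty_or_nonempty X with hX | ⟨⟨c⟩⟩
  · have : F = 0 := funext fun x => (hX.false x).elim
    rw [this]; exact stronglyMeasurable_zero
  have hm := aestronglyMeasurable_of_integrableOn_Ico h.1
  have key : F = fun x => F c + (∫ s in Iio x, (Ici c).indicator (hm.mk f) s ∂m)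
      - ∫ s in Ici x, (Iio c).indicator (hm.mk f) s ∂m := by
    funext x
    rw [setIntegral_indicator measurableSet_Ici, setIntegral_indicator measurableSet_Iio,
      inter_comm, Ici_inter_Iio, Ici_inter_Iio,
      integral_congr_ae (ae_restrict_of_ae hm.ae_eq_mk.symm),
      integral_congr_ae (ae_restrict_of_ae hm.ae_eq_mk.symm)]
    rcases le_total c x with hcx | hcx
    · rw [Ico_eq_empty (not_lt.2 hcx), setIntegral_empty, ← h.2 c x hcx]; ring
    · rw [Ico_eq_empty (not_lt.2 hcx), setIntegral_empty, ← h.2 x c hcx]; ring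
  rw [key]
  exact (stronglyMeasurable_const.add (stronglyMeasurable_integral_Iio m
    (hm.stronglyMeasurable_mk.indicator measurableSet_Ici))).sub
    (stronglyMeasurable_integral_Ici m (hm.stronglyMeasurable_mk.indicator measurableSet_Iio))

theorem Prim.integrableOn_mul [NoMaxOrder X] [SFinite m] (h : Prim m F f) {x y : X}
    (hg : IntegrableOn g (Ico x y) m) : IntegrableOn (fun s => F s * g s) (Ico x y) m := by
  obtain ⟨B, -, hB⟩ := h.exists_bound x y
  refine Integrable.bdd_mul (c := B) hg h.stronglyMeasurable.aestronglyMeasurable ?_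
  filter_upwards [ae_restrict_mem measurableSet_Ico] with s hs
  exact hB s ⟨hs.1, hs.2.le⟩

/-- Fubini on the square, split into `t < s` and `s ≤ t`. The diagonal goes entirely to the second
half, hence the closed interval `Icc x t` there. -/
theorem integral_mul_integral_Ico [SFinite m] {x y : X} (hf : IntegrableOn f (Ico x y) m)
    (hg : IntegrableOn g (Ico x y) m) :
    (∫ s in Ico x y, f s ∂m) * ∫ s in Ico x y, g s ∂m
      = (∫ s in Ico x y, f s * (∫ t in Ico x s, g t ∂m) ∂m)
        + ∫ t in Ico x y, (∫ s in Icc x t, f s ∂m) * g t ∂m := by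
  have hh : Integrable (fun z : X × X => f z.1 * g z.2)
      ((m.restrict (Ico x y)).prod (m.restrict (Ico x y))) := hf.mul_prod hg
  have hS : MeasurableSet {z : X × X | z.2 < z.1} :=
    measurableSet_lt measurable_snd measurable_fst
  rw [← integral_prod_mul, ← integral_add_compl hS hh, ← integral_indicator hS,
    ← integral_indicator hS.compl, integral_prod _ (hh.indicator hS),
    integral_prod_symm _ (hh.indicator hS.compl)]
  congr 1
  · refine setIntegral_congr_fun measurableSet_Ico fun s hs => ?_
    have : ∀ t, {z : X × X | z.2 < z.1}.indicator (fun z => f z.1 * g z.2) (s, t)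
        = (Iio s).indicator (fun t => f s * g t) t := by intro t; simp [indicator]
    simp only [this]
    rw [integral_indicator measurableSet_Iio, Measure.restrict_restrict measurableSet_Iio,
      integral_const_mul]
    congr 3
    ext t
    simp only [mem_inter_iff, mem_Iio, mem_Ico]
    exact ⟨fun h => ⟨h.2.1, h.1⟩, fun h => ⟨h.2, h.1, h.2.trans hs.2⟩⟩
  · refine setIntegral_congr_fun measurableSet_Ico fun t ht => ?_
    have : ∀ s, ({z : X × X | z.2 < z.1}ᶜ).indicator (fun z => f z.1 * g z.2) (s, t)
        = (Iic t).indicator (fun s => f s * g t) s := by intro s; simp [indicator]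
    simp only [this]
    rw [integral_indicator measurableSet_Iic, Measure.restrict_restrict measurableSet_Iic,
      integral_mul_const]
    congr 3
    ext s
    simp only [mem_inter_iff, mem_Iic, mem_Ico, mem_Icc]
    exact ⟨fun h => ⟨h.2.1, h.1⟩, fun h => ⟨h.2, h.1, lt_of_le_of_lt h.2 ht.2⟩⟩

/-- The product rule for two primitives whose densities have no common atoms. -/
theorem Prim.mul [NoMaxOrder X] [SFinite m] (hF : Prim m F f) (hG : Prim m G g)
    (hat : ∀ s, f s * g s * m.real {s} = 0) :
    Prim m (fun x => F x * G x) (fun x => f x * G x + F x * g x) := by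
  have i1 : ∀ x y, IntegrableOn (fun s => f s * G s) (Ico x y) m := fun x y => by
    simpa only [mul_comm] using hG.integrableOn_mul (hF.1 x y)
  have i2 : ∀ x y, IntegrableOn (fun s => F s * g s) (Ico x y) m := fun x y =>
    hF.integrableOn_mul (hG.1 x y)
  refine ⟨fun x y => (i1 x y).add (i2 x y), fun x y hxy => ?_⟩
  have e1 : ∫ s in Ico x y, f s * (∫ t in Ico x s, g t ∂m) ∂m
      = (∫ s in Ico x y, f s * G s ∂m) - (F y - F x) * G x := by
    rw [hF.2 x y hxy, ← integral_mul_const, ← integral_sub (i1 x y) ((hF.1 x y).mul_const _)]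
    refine setIntegral_congr_fun measurableSet_Ico fun s hs => ?_
    rw [← hG.2 x s hs.1]; ring
  have e2 : ∫ t in Ico x y, (∫ s in Icc x t, f s ∂m) * g t ∂m
      = (∫ s in Ico x y, F s * g s ∂m) - F x * (G y - G x) := by
    rw [hG.2 x y hxy, ← integral_const_mul, ← integral_sub (i2 x y) ((hG.1 x y).const_mul _)]
    refine setIntegral_congr_fun measurableSet_Ico fun t ht => ?_
    -- Compared with `Ico x t`, the closed interval contributes the mass `f t * m {t}` at its right
    -- end. Multiplied by `g t` this vanishes by `hat`.
    have hsing : IntegrableOn f {t} m := (hF.1 t y).mono_set (by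
      rintro _ rfl; exact ⟨le_rfl, ht.2⟩)
    rw [← Ico_insert_right ht.1, ← union_singleton, setIntegral_union (by simp)
      (measurableSet_singleton t) (hF.1 x t) hsing, ← hF.2 x t ht.1, integral_singleton,
      Complex.real_smul]
    linear_combination hat t
  have := integral_mul_integral_Ico (hF.1 x y) (hG.1 x y)
  rw [← hF.2 x y hxy, ← hG.2 x y hxy, e1, e2] at this
  rw [integral_add (i1 x y) (i2 x y)]
  linear_combination this

/-- The density of a primitive is determined almost everywhere. -/
theorem Prim.ae_eq [NoMaxOrder X] [NoMinOrder X] (hf : Prim m F f) (hg : Prim m F g) :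
    f =ᵐ[m] g := by
  rcases isEmpty_or_nonempty X with hX | hX
  · exact Eventually.of_forall fun x => (hX.false x).elim
  have key : ∀ x y, ∀ᵐ s ∂(m.restrict (Ico x y)), f s = g s := by
    intro x y
    refine Integrable.ae_eq_of_forall_setIntegral_eq f g (hf.1 x y) (hg.1 x y) ?_
    intro s hs _
    have hi : ∀ t, Integrable f ((m.restrict (Ico x y)).restrict t) := fun t =>
      (hf.1 x y).integrable.restrict
    have hj : ∀ t, Integrable g ((m.restrict (Ico x y)).restrict t) := fun t =>
      (hg.1 x y).integrable.restrict
    have hbase : ∀ l u, ∫ s in Ico l u, f s ∂(m.restrict (Ico x y))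
        = ∫ s in Ico l u, g s ∂(m.restrict (Ico x y)) := by
      intro l u
      rw [Measure.restrict_restrict measurableSet_Ico, Ico_inter_Ico]
      rcases le_total (l ⊔ x) (u ⊓ y) with h | h
      · rw [← hf.2 _ _ h, ← hg.2 _ _ h]
      · rw [Ico_eq_empty (not_lt.2 h)]; simp
    have huniv : ∫ s, f s ∂(m.restrict (Ico x y)) = ∫ s, g s ∂(m.restrict (Ico x y)) := by
      have := hbase x y
      rwa [Measure.restrict_restrict measurableSet_Ico, inter_self] at this
    -- Half-open intervals form a π-system generating the Borel sets, and on them both integrals are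
    -- increments of the same `F`.
    refine MeasurableSpace.induction_on_inter
      (C := fun s _ => ∫ t in s, f t ∂(m.restrict (Ico x y))
        = ∫ t in s, g t ∂(m.restrict (Ico x y)))
      ((BorelSpace.measurable_eq (α := X)).trans (borel_eq_generateFrom_Ico X))
      (isPiSystem_Ico (id : X → X) id) (by simp) ?_ ?_ ?_ s hs
    · rintro _ ⟨l, u, -, rfl⟩; exact hbase l u
    · intro t ht h
      rw [setIntegral_compl ht (hf.1 x y), setIntegral_compl ht (hg.1 x y), h, huniv]
    · intro t hd ht h
      rw [integral_iUnion ht hd (hi _), integral_iUnion ht hd (hj _)]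
      exact tsum_congr h
  obtain ⟨v, hv⟩ := exists_seq_tendsto (atBot : Filter X)
  obtain ⟨u, hu⟩ := exists_seq_tendsto (atTop : Filter X)
  have := ae_all_iff.2 fun n => (ae_restrict_iff' measurableSet_Ico).1 (key (v n) (u n))
  filter_upwards [this] with x hx
  obtain ⟨n, h1, h2⟩ := ((hv.eventually (eventually_le_atBot x)).and
    (hu.eventually (eventually_gt_atTop x))).exists
  exact hx n ⟨h1, h2⟩

end Primitive

end MeasureSL

/-! ### The first order system: constancy of Wronskians and the initial value problem. -/

namespace MeasureSL

variable {X : Type*} [LinearOrder X] [TopologicalSpace X] [OrderTopology X]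
  [SecondCountableTopology X] [MeasurableSpace X] [BorelSpace X]

/-- The coefficients `p m, q m, r m` of the system `du = u₁ p dm`, `du₁ = (q - z r) u dm`. -/
structure System (X : Type*) [LinearOrder X] [MeasurableSpace X] where
  m : Measure X
  p : X → ℝ
  q : X → ℝ
  r : X → ℝ
  sigmaFinite : SigmaFinite m
  finite_Ico : ∀ x y, m (Ico x y) < ⊤
  measurable_p : Measurable p
  measurable_q : Measurable q
  measurable_r : Measurable r
  p_nonneg : ∀ x, 0 ≤ p x
  p_le : ∀ x, p x ≤ 1
  q_nonneg : ∀ x, 0 ≤ q x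
  q_le : ∀ x, q x ≤ 1
  r_le : ∀ x, |r x| ≤ 1
  atom_pq : ∀ x, p x * q x * m.real {x} = 0
  atom_pr : ∀ x, p x * r x * m.real {x} = 0

attribute [instance] System.sigmaFinite

/-- A solution of `(τ - z) u = 0` with its quasi-derivative. -/
structure Sol (S : System X) (z : ℂ) where
  u : X → ℂ
  u₁ : X → ℂ
  prim : Prim S.m u fun s => S.p s * u₁ s
  prim₁ : Prim S.m u₁ fun s => (S.q s - z * S.r s) * u s

namespace Sol

variable {S : System X} {z : ℂ}

/-- Linear combinations of solutions. -/
@[simps] def lin (α β : ℂ) (a b : Sol S z) : Sol S z where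
  u x := α * a.u x + β * b.u x
  u₁ x := α * a.u₁ x + β * b.u₁ x
  prim := ((a.prim.const_mul α).add (b.prim.const_mul β)).of_eq (fun _ => rfl) fun _ => by ring
  prim₁ := ((a.prim₁.const_mul α).add (b.prim₁.const_mul β)).of_eq (fun _ => rfl)
    fun _ => by ring

/-- The complex conjugate of a solution. -/
@[simps] def conj (a : Sol S z) : Sol S (star z) where
  u x := star (a.u x)
  u₁ x := star (a.u₁ x)
  prim := a.prim.conj.of_eq (fun _ => rfl) fun _ => by simp
  prim₁ := a.prim₁.conj.of_eq (fun _ => rfl) fun _ => by simp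

theorem atom (z : ℂ) (x : X) (α β : ℂ) :
    (S.p x * α) * ((S.q x - z * S.r x) * β) * S.m.real {x} = 0 := by
  have h1 : (S.p x * S.q x * S.m.real {x} : ℂ) = 0 := by exact_mod_cast S.atom_pq x
  have h2 : (S.p x * S.r x * S.m.real {x} : ℂ) = 0 := by exact_mod_cast S.atom_pr x
  linear_combination (α * β) * h1 - (α * z * β) * h2

variable [NoMaxOrder X]

/-- The atom conditions (`Sol.atom`) make the product rule free of jump terms, and the remaining
densities cancel. -/
theorem wronskian_const (a b : Sol S z) (x y : X) :
    a.u x * b.u₁ x - a.u₁ x * b.u x = a.u y * b.u₁ y - a.u₁ y * b.u y := by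
  have h := (a.prim.mul b.prim₁ fun s => atom z s _ _).sub
    (b.prim.mul a.prim₁ fun s => atom z s _ _)
  have key : ∀ x y, x ≤ y →
      a.u x * b.u₁ x - a.u₁ x * b.u x = a.u y * b.u₁ y - a.u₁ y * b.u y := by
    intro x y hxy
    have h1 := h.2 x y hxy
    have h0 : ∀ s, S.p s * a.u₁ s * b.u₁ s + a.u s * ((S.q s - z * S.r s) * b.u s)
        - (S.p s * b.u₁ s * a.u₁ s + b.u s * ((S.q s - z * S.r s) * a.u s)) = 0 := by
      intro s; ring
    simp only [h0, integral_zero] at h1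
    linear_combination -h1
  rcases le_total x y with h | h
  · exact key x y h
  · exact (key y x h).symm

end Sol

theorem System.singleton_lt_top [NoMaxOrder X] (S : System X) (x : X) : S.m {x} < ⊤ := by
  obtain ⟨y, hy⟩ := exists_gt x
  exact (measure_mono (by rintro _ rfl; exact ⟨le_rfl, hy⟩)).trans_lt (S.finite_Ico x y)

variable [NoMaxOrder X]

/-- The system with all coefficients set to zero to the left of `w`. -/
@[simps] noncomputable def System.cut (S : System X) (w : X) : System X where
  m := S.m.restrict (Ici w)
  p := S.p
  q := S.q
  r := S.r
  sigmaFinite := inferInstance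
  finite_Ico x y := (Measure.restrict_apply_le _ _).trans_lt (S.finite_Ico x y)
  measurable_p := S.measurable_p
  measurable_q := S.measurable_q
  measurable_r := S.measurable_r
  p_nonneg := S.p_nonneg
  p_le := S.p_le
  q_nonneg := S.q_nonneg
  q_le := S.q_le
  r_le := S.r_le
  atom_pq x := by
    rcases mul_eq_zero.1 (S.atom_pq x) with h | h
    · rw [h, zero_mul]
    · rw [measureReal_restrict_apply (measurableSet_singleton x),
        measureReal_mono_null inter_subset_left h (S.singleton_lt_top x).ne, mul_zero]
  atom_pr x := by
    rcases mul_eq_zero.1 (S.atom_pr x) with h | h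
    · rw [h, zero_mul]
    · rw [measureReal_restrict_apply (measurableSet_singleton x),
        measureReal_mono_null inter_subset_left h (S.singleton_lt_top x).ne, mul_zero]

variable {S : System X} {z : ℂ}

theorem System.cut_Iio_lt_top (S : System X) (w x : X) : (S.cut w).m (Iio x) < ⊤ := by
  rw [System.cut_m, Measure.restrict_apply measurableSet_Iio, inter_comm, Ici_inter_Iio]
  exact S.finite_Ico w x

/-- The matrix of the system as an operator on `ℂ²`. -/
noncomputable def System.op (S : System X) (z : ℂ) (s : X) : ℂ × ℂ →L[ℂ] ℂ × ℂ :=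
  (S.p s : ℂ) • (ContinuousLinearMap.inl ℂ ℂ ℂ ∘L ContinuousLinearMap.snd ℂ ℂ ℂ)
    + (S.q s - z * S.r s : ℂ) • (ContinuousLinearMap.inr ℂ ℂ ℂ ∘L ContinuousLinearMap.fst ℂ ℂ ℂ)

theorem System.op_apply (S : System X) (z : ℂ) (s : X) (v : ℂ × ℂ) :
    S.op z s v = (S.p s * v.2, (S.q s - z * S.r s) * v.1) := by
  ext <;> simp [System.op]

theorem System.stronglyMeasurable_op (S : System X) (z : ℂ) : StronglyMeasurable (S.op z) := by
  have h1 : Measurable fun s => (S.p s : ℂ) := Complex.measurable_ofReal.comp S.measurable_p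
  have h2 : Measurable fun s => (S.q s - z * S.r s : ℂ) :=
    (Complex.measurable_ofReal.comp S.measurable_q).sub
      ((Complex.measurable_ofReal.comp S.measurable_r).const_mul z)
  exact (h1.stronglyMeasurable.smul_const _).add (h2.stronglyMeasurable.smul_const _)

theorem System.norm_coeff_le (S : System X) (z : ℂ) (s : X) :
    ‖(S.q s - z * S.r s : ℂ)‖ ≤ 1 + ‖z‖ := by
  refine (norm_sub_le _ _).trans (add_le_add ?_ ?_)
  · rw [Complex.norm_real, Real.norm_eq_abs, abs_of_nonneg (S.q_nonneg s)]; exact S.q_le s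
  · rw [norm_mul, Complex.norm_real, Real.norm_eq_abs]
    exact mul_le_of_le_one_right (norm_nonneg _) (S.r_le s)

theorem System.norm_op_le (S : System X) (z : ℂ) (s : X) : ‖S.op z s‖ ≤ 1 + ‖z‖ := by
  refine ContinuousLinearMap.opNorm_le_bound _ (by positivity) fun v => ?_
  rw [System.op_apply, Prod.norm_def]
  refine max_le ?_ ?_
  · rw [norm_mul, Complex.norm_real, Real.norm_eq_abs, abs_of_nonneg (S.p_nonneg s)]
    have := S.p_le s
    have := S.p_nonneg s
    have h1 := norm_snd_le v
    have h2 := norm_nonneg z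
    have h3 := norm_nonneg v.2
    nlinarith [mul_nonneg h2 (norm_nonneg v)]
  · rw [norm_mul]
    exact mul_le_mul (S.norm_coeff_le z s) (norm_fst_le v) (norm_nonneg _) (by positivity)

/-- After the cut every `Iio x` has finite measure, so the Volterra theorem applies from the left
end; no mass lies below `w`, so the constant term of the equation is the value at `w`. -/
theorem exists_sol_cut_initial (S : System X) (z : ℂ) (w : X) (α β : ℂ) :
    ∃ s : Sol (S.cut w) z, s.u w = α ∧ s.u₁ w = β := by
  obtain ⟨U, hi, hU⟩ := exists_volterra (S.cut w).m (S.cut_Iio_lt_top w)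
    ((S.cut w).stronglyMeasurable_op z) ((S.cut w).norm_op_le z) (α, β)
  have hI : ∀ x y, IntegrableOn (fun s => (S.cut w).op z s (U s)) (Ico x y) (S.cut w).m :=
    fun x y => (hi y).mono_set Ico_subset_Iio_self
  have hP : ∀ x y, x ≤ y → U y - U x = ∫ s in Ico x y, (S.cut w).op z s (U s) ∂(S.cut w).m := by
    intro x y h
    rw [hU y, hU x, ← Iio_union_Ico_eq_Iio h, setIntegral_union (by
      rw [Set.disjoint_left]; intro t ht ht'; exact absurd ht (not_lt.2 ht'.1)) measurableSet_Ico
      (hi x) (hI x y)]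
    abel
  have hw : U w = (α, β) := by
    have : ∫ s in Iio w, (S.cut w).op z s (U s) ∂(S.cut w).m = 0 := by
      rw [System.cut_m, Measure.restrict_restrict measurableSet_Iio, inter_comm, Ici_inter_Iio,
        Ico_self, Measure.restrict_empty, integral_zero_measure]
    rw [hU w, this, add_zero]
  refine ⟨⟨fun x => (U x).1, fun x => (U x).2, ⟨fun x y => ?_, fun x y h => ?_⟩,
    ⟨fun x y => ?_, fun x y h => ?_⟩⟩, by simp [hw], by simp [hw]⟩
  · have := (hI x y).fst
    simp only [System.op_apply] at this
    exact this
  · have := congrArg Prod.fst (hP x y h)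
    rw [fst_integral (hI x y)] at this
    simp only [System.op_apply] at this
    exact this
  · have := (hI x y).snd
    simp only [System.op_apply] at this
    exact this
  · have := congrArg Prod.snd (hP x y h)
    rw [snd_integral (hI x y)] at this
    simp only [System.op_apply] at this
    exact this

theorem Prim.cut_const {w : X} {m : Measure X} {F f : X → ℂ} (h : Prim (m.restrict (Ici w)) F f)
    {x : X} (hx : x ≤ w) : F x = F w := by
  have := h.2 x w hx
  rw [Measure.restrict_restrict measurableSet_Ico, Ico_inter_Ici, sup_eq_right.2 hx, Ico_self,
    Measure.restrict_empty, integral_zero_measure] at this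
  exact (sub_eq_zero.1 this).symm

theorem Prim.cut_eq {w x : X} {m : Measure X} {F f : X → ℂ} (h : Prim (m.restrict (Ici w)) F f)
    (h0 : F w = 0) : IntegrableOn f (Iio x) (m.restrict (Ici w)) ∧
      F x = ∫ s in Iio x, f s ∂m.restrict (Ici w) := by
  have e : (m.restrict (Ici w)).restrict (Iio x)
      = (m.restrict (Ici w)).restrict (Ico w x) := by
    rw [Measure.restrict_restrict measurableSet_Iio, Measure.restrict_restrict measurableSet_Ico]
    congr 1; ext; simp; tauto
  refine ⟨by rw [IntegrableOn, e]; exact h.1 w x, ?_⟩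
  rw [e]
  rcases le_total w x with hx | hx
  · rw [← h.2 w x hx, h0, sub_zero]
  · rw [h.cut_const hx, h0, Ico_eq_empty (not_lt.2 hx)]; simp

theorem sol_cut_initial_unique {w : X} (s : Sol (S.cut w) z) (h : s.u w = 0) (h₁ : s.u₁ w = 0)
    (x : X) : s.u x = 0 ∧ s.u₁ x = 0 := by
  have key := volterra_unique (S.cut w).m (S.cut_Iio_lt_top w) ((S.cut w).norm_op_le z)
    (U := fun x => (s.u x, s.u₁ x)) ?_ ?_ x
  · simpa using key
  · intro x
    simp only [System.op_apply]
    exact Integrable.prodMk (s.prim.cut_eq h).1 (s.prim₁.cut_eq h₁).1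
  · intro x
    simp only [System.op_apply]
    refine Eq.trans ?_ (integral_pair (s.prim.cut_eq h).1 (s.prim₁.cut_eq h₁).1).symm
    exact Prod.ext (s.prim.cut_eq h).2 (s.prim₁.cut_eq h₁).2

/-- The Volterra equation is only solved to the right. Data at another point `c` are attained by
Cramer's rule in the fundamental system normalized at `w`, because its Wronskian is still `1` at
`c`. -/
theorem exists_sol_cut (S : System X) (z : ℂ) (w c : X) (α β : ℂ) :
    ∃ s : Sol (S.cut w) z, s.u c = α ∧ s.u₁ c = β := by
  obtain ⟨a, ha, ha₁⟩ := exists_sol_cut_initial S z w 1 0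
  obtain ⟨b, hb, hb₁⟩ := exists_sol_cut_initial S z w 0 1
  have hW := a.wronskian_const b c w
  rw [ha, ha₁, hb, hb₁] at hW
  refine ⟨Sol.lin (α * b.u₁ c - β * b.u c) (β * a.u c - α * a.u₁ c) a b, ?_, ?_⟩
  · simp only [Sol.lin_u]; linear_combination α * hW
  · simp only [Sol.lin_u₁]; linear_combination β * hW

/-- Up to sign, the data of `s` at `w` are its Wronskians with the fundamental system normalized
there. These are constant and vanish at `c`, which reduces the claim to uniqueness from `w`. -/
theorem sol_cut_unique {w c : X} (s : Sol (S.cut w) z) (h : s.u c = 0) (h₁ : s.u₁ c = 0)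
    (x : X) : s.u x = 0 ∧ s.u₁ x = 0 := by
  obtain ⟨a, ha, ha₁⟩ := exists_sol_cut_initial S z w 1 0
  obtain ⟨b, hb, hb₁⟩ := exists_sol_cut_initial S z w 0 1
  have h1 := s.wronskian_const a c w
  have h2 := s.wronskian_const b c w
  rw [ha, ha₁, h, h₁] at h1
  rw [hb, hb₁, h, h₁] at h2
  exact sol_cut_initial_unique s (by linear_combination -h2) (by linear_combination h1) x

theorem Prim.cut {m : Measure X} {F f f' : X → ℂ} (h : Prim m F f) (w : X)
    (hf : ∀ s, w ≤ s → f' s = f s) :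
    Prim (m.restrict (Ici w)) (fun x => F (max x w)) f' := by
  have e : ∀ x y, (m.restrict (Ici w)).restrict (Ico x y) = m.restrict (Ico (max x w) y) := by
    intro x y
    rw [Measure.restrict_restrict measurableSet_Ico, Ico_inter_Ici]
  have hc : ∀ x y, EqOn f f' (Ico (max x w) y) := fun x y s hs =>
    (hf s ((le_max_right _ _).trans hs.1)).symm
  refine ⟨fun x y => ?_, fun x y hxy => ?_⟩
  · rw [IntegrableOn, e]
    exact (h.1 (max x w) y).congr_fun (hc x y) measurableSet_Ico
  · rw [e, ← setIntegral_congr_fun measurableSet_Ico (hc x y),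
      h.2 _ _ (max_le_max_right w hxy)]
    rcases le_total y w with hy | hy
    · rw [max_eq_right hy, max_eq_right (hxy.trans hy), Ico_self, Ico_eq_empty (not_lt.2 hy)]
    · rw [max_eq_left hy]

/-- The solution of the cut system obtained by freezing a solution to the left of `w`. -/
@[simps] def Sol.cut (s : Sol S z) (w : X) : Sol (S.cut w) z where
  u x := s.u (max x w)
  u₁ x := s.u₁ (max x w)
  prim := s.prim.cut w fun t ht => by simp [max_eq_left ht]
  prim₁ := s.prim₁.cut w fun t ht => by simp [max_eq_left ht]

/-- Freezing `s` to the left of `min x c` changes neither its data at `c` nor its values at `x`, and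
uniqueness for the cut system applies. -/
theorem Sol.eq_zero (s : Sol S z) {c : X} (h : s.u c = 0) (h₁ : s.u₁ c = 0) (x : X) :
    s.u x = 0 ∧ s.u₁ x = 0 := by
  have hc : max c (min x c) = c := max_eq_left (min_le_right _ _)
  have hx : max x (min x c) = x := max_eq_left (min_le_left _ _)
  simpa [hx] using sol_cut_unique (s.cut (min x c)) (c := c) (by simpa [hc]) (by simpa [hc]) x

theorem Sol.cut_eq_of_eq {w w' c : X} (hw : w' ≤ w) (hc : w ≤ c) (s : Sol (S.cut w) z)
    (t : Sol (S.cut w') z) (h : s.u c = t.u c) (h₁ : s.u₁ c = t.u₁ c) {x : X} (hx : w ≤ x) :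
    s.u x = t.u x ∧ s.u₁ x = t.u₁ x := by
  have e : S.m.restrict (Ici w) = (S.m.restrict (Ici w')).restrict (Ici w) := by
    rw [Measure.restrict_restrict measurableSet_Ici, inter_eq_self_of_subset_left
      (Ici_subset_Ici.2 hw)]
  let t' : Sol (S.cut w) z :=
    { u := fun x => t.u (max x w)
      u₁ := fun x => t.u₁ (max x w)
      prim := by
        rw [System.cut_m, e]; exact t.prim.cut w fun t ht => by simp [max_eq_left ht]
      prim₁ := by
        rw [System.cut_m, e]; exact t.prim₁.cut w fun t ht => by simp [max_eq_left ht] }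
  have h0 := sol_cut_unique (Sol.lin 1 (-1) s t') (c := c)
    (by simp [t', max_eq_left hc, h]) (by simp [t', max_eq_left hc, h₁]) x
  simp only [Sol.lin_u, Sol.lin_u₁, t', max_eq_left hx] at h0
  exact ⟨by linear_combination h0.1, by linear_combination h0.2⟩

theorem Prim.of_cut {m : Measure X} {F f : X → ℂ}
    (h : ∀ x : X, ∃ w ≤ x, ∃ G g, Prim (m.restrict (Ici w)) G g ∧
      (∀ y, x ≤ y → G y = F y) ∧ ∀ y, x ≤ y → g y = f y) : Prim m F f := by
  have e : ∀ w x y, w ≤ x → (m.restrict (Ici w)).restrict (Ico x y) = m.restrict (Ico x y) := by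
    intro w x y hw
    rw [Measure.restrict_restrict measurableSet_Ico, Ico_inter_Ici, sup_eq_left.2 hw]
  refine ⟨fun x y => ?_, fun x y hxy => ?_⟩
  · obtain ⟨w, hw, G, g, hG, h1, h2⟩ := h x
    have := hG.1 x y
    rw [IntegrableOn, e w x y hw] at this
    exact IntegrableOn.congr_fun (s := Ico x y) this (fun s hs => h2 s hs.1) measurableSet_Ico
  · obtain ⟨w, hw, G, g, hG, h1, h2⟩ := h x
    have := hG.2 x y hxy
    rw [e w x y hw, h1 x le_rfl, h1 y hxy] at this
    rw [this]
    exact setIntegral_congr_fun measurableSet_Ico fun s hs => h2 s hs.1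

/-- Solutions of different cut systems with the same data at `c` agree wherever neither system is
cut. The value at `x` is therefore read off the solution cut at `min x c`, and these values fit
together. -/
theorem exists_sol (S : System X) (z : ℂ) (c : X) (α β : ℂ) :
    ∃ s : Sol S z, s.u c = α ∧ s.u₁ c = β := by
  choose s hs hs₁ using fun w => exists_sol_cut S z w c α β
  have hc : ∀ w x, w ≤ x → (s (min w c)).u x = (s (min x c)).u x ∧
      (s (min w c)).u₁ x = (s (min x c)).u₁ x := fun w x hwx =>
    (Sol.cut_eq_of_eq (min_le_min_right c hwx) (min_le_right _ _) (s (min x c)) (s (min w c))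
      ((hs _).trans (hs _).symm) ((hs₁ _).trans (hs₁ _).symm) (min_le_left _ _)).imp
        Eq.symm Eq.symm
  refine ⟨⟨fun x => (s (min x c)).u x, fun x => (s (min x c)).u₁ x, ?_, ?_⟩, hs _, hs₁ _⟩
  · exact Prim.of_cut fun x => ⟨min x c, min_le_left _ _, _, _, (s (min x c)).prim,
      fun y hy => (hc x y hy).1, fun y hy => by simp [(hc x y hy).2]⟩
  · exact Prim.of_cut fun x => ⟨min x c, min_le_left _ _, _, _, (s (min x c)).prim₁,
      fun y hy => (hc x y hy).2, fun y hy => by simp [(hc x y hy).1]⟩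

end MeasureSL

namespace MeasureSL

variable {X : Type*} [LinearOrder X] [TopologicalSpace X] [OrderTopology X]
  [SecondCountableTopology X] [MeasurableSpace X] [BorelSpace X]

/-! ### Both endpoints at once: `true` is the right one, `false` the left one, with orientation
`sg`. -/

section Ends

/-- The part of the interval between `x` and the right (`true`) or left (`false`) endpoint. -/
def tail (d : Bool) (x : X) : Set X := if d then Ici x else Iio x

/-- The filter of the right (`true`) or left (`false`) endpoint. -/
def endF (d : Bool) : Filter X := if d then atTop else atBot

/-- The orientation of an endpoint. -/
def sg (d : Bool) : ℂ := if d then 1 else -1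

/-- `x` is at least as close to the endpoint as `c`. -/
def Beyond (d : Bool) (c x : X) : Prop := if d then c ≤ x else x ≤ c

/-- The part of the interval between `c` and a point `x` closer to the endpoint. -/
def seg (d : Bool) (c x : X) : Set X := if d then Ico c x else Ico x c

variable {d : Bool} {c x y : X} {m : Measure X} {F f : X → ℂ}

theorem measurableSet_tail (d : Bool) (x : X) : MeasurableSet (tail d x) := by
  cases d
  · exact measurableSet_Iio
  · exact measurableSet_Ici

theorem measurableSet_seg (d : Bool) (c x : X) : MeasurableSet (seg d c x) := by
  cases d
  · exact measurableSet_Ico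
  · exact measurableSet_Ico

theorem sg_mul_sg (d : Bool) : sg d * sg d = 1 := by cases d <;> simp [sg]

theorem norm_sg (d : Bool) : ‖sg d‖ = 1 := by cases d <;> simp [sg]

theorem Beyond.trans (h : Beyond d c x) (h' : Beyond d x y) : Beyond d c y := by
  cases d
  · exact le_trans h' h
  · exact le_trans h h'

theorem Beyond.total (d : Bool) (c x : X) : Beyond d c x ∨ Beyond d x c := by
  cases d
  · exact le_total x c
  · exact le_total c x

theorem seg_subset_tail (d : Bool) (c x : X) : seg d c x ⊆ tail d c := by
  cases d
  · exact Ico_subset_Iio_self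
  · exact Ico_subset_Ici_self

theorem Beyond.tail_subset (h : Beyond d c x) : tail d x ⊆ tail d c := by
  cases d
  · exact Iio_subset_Iio h
  · exact Ici_subset_Ici.2 h

theorem Beyond.seg_union_tail (h : Beyond d c x) : seg d c x ∪ tail d x = tail d c := by
  cases d
  · exact (union_comm _ _).trans (Iio_union_Ico_eq_Iio h)
  · exact Ico_union_Ici_eq_Ici h

theorem disjoint_seg_tail (d : Bool) (c x : X) : Disjoint (seg d c x) (tail d x) := by
  rw [Set.disjoint_left]
  cases d
  · exact fun t ht ht' => absurd ht.1 (not_le.2 ht')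
  · exact fun t ht ht' => absurd ht.2 (not_lt.2 ht')

theorem Beyond.seg_union_seg (h : Beyond d c x) (h' : Beyond d x y) :
    seg d c x ∪ seg d x y = seg d c y := by
  cases d
  · exact (union_comm _ _).trans (Ico_union_Ico_eq_Ico h' h)
  · exact Ico_union_Ico_eq_Ico h h'

theorem disjoint_seg_seg (d : Bool) (c x y : X) : Disjoint (seg d c x) (seg d x y) :=
  (disjoint_seg_tail d c x).mono_right (seg_subset_tail d x y)

theorem eventually_beyond (d : Bool) (c : X) : ∀ᶠ x in endF d, Beyond d c x := by
  cases d
  · exact eventually_le_atBot c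
  · exact eventually_ge_atTop c

instance endF_neBot [Nonempty X] (d : Bool) : (endF d : Filter X).NeBot := by
  cases d
  · exact atBot_neBot
  · exact atTop_neBot

instance endF_isCountablyGenerated (d : Bool) : (endF d : Filter X).IsCountablyGenerated := by
  cases d
  · exact inferInstanceAs (atBot : Filter X).IsCountablyGenerated
  · exact inferInstanceAs (atTop : Filter X).IsCountablyGenerated

theorem tail_mem_endF [NoMinOrder X] (d : Bool) (c : X) : tail d c ∈ (endF d : Filter X) := by
  cases d
  · exact Iio_mem_atBot c
  · exact Ici_mem_atTop c

theorem exists_tail_subset [Nonempty X] {s : Set X} (hs : s ∈ (endF d : Filter X)) :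
    ∃ c, tail d c ⊆ s := by
  cases d
  · obtain ⟨c, hc⟩ := mem_atBot_sets.1 hs
    exact ⟨c, fun x hx => hc x (le_of_lt hx)⟩
  · obtain ⟨c, hc⟩ := mem_atTop_sets.1 hs
    exact ⟨c, fun x hx => hc x hx⟩

theorem Prim.seg_eq (h : Prim m F f) (hx : Beyond d c x) :
    F x = F c + sg d * ∫ s in seg d c x, f s ∂m := by
  cases d
  · have := h.2 x c hx
    simp only [sg, seg, Bool.false_eq_true, if_false]
    linear_combination -this
  · have := h.2 c x hx
    simp only [sg, seg, if_true]
    linear_combination this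

theorem integrableOn_seg {E : Type*} [NormedAddCommGroup E] {f : X → E}
    (h : ∀ x y, IntegrableOn f (Ico x y) m) (d : Bool) (c x : X) :
    IntegrableOn f (seg d c x) m := by
  cases d
  · exact h x c
  · exact h c x

theorem Beyond.integral_tail {E : Type*} [NormedAddCommGroup E] [NormedSpace ℝ E] {f : X → E}
    (hx : Beyond d c x) (h : IntegrableOn f (tail d c) m) :
    ∫ s in tail d c, f s ∂m = (∫ s in seg d c x, f s ∂m) + ∫ s in tail d x, f s ∂m := by
  rw [← setIntegral_union (disjoint_seg_tail d c x) (measurableSet_tail d x)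
    (h.mono_set (seg_subset_tail d c x)) (h.mono_set hx.tail_subset), hx.seg_union_tail]

theorem integrableOn_tail_of_integrableOn_tail {E : Type*} [NormedAddCommGroup E] {f : X → E}
    (h : ∀ x y, IntegrableOn f (Ico x y) m) (hc : IntegrableOn f (tail d c) m) (x : X) :
    IntegrableOn f (tail d x) m := by
  rcases Beyond.total d c x with h' | h'
  · exact hc.mono_set h'.tail_subset
  · rw [← h'.seg_union_tail]; exact (integrableOn_seg h d x c).union hc

theorem aecover_seg [NoMaxOrder X] (m : Measure X) (d : Bool) (c : X) :
    AECover (m.restrict (tail d c)) (endF d) (seg d c) where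
  ae_eventually_mem := by
    filter_upwards [ae_restrict_mem (measurableSet_tail d c)] with s hs
    cases d
    · filter_upwards [eventually_le_atBot s] with x hx using ⟨hx, hs⟩
    · filter_upwards [eventually_gt_atTop s] with x hx using ⟨hs, hx⟩
  measurableSet := measurableSet_seg d c

theorem restrict_tail_seg (m : Measure X) (d : Bool) (c x : X) :
    (m.restrict (tail d c)).restrict (seg d c x) = m.restrict (seg d c x) := by
  rw [Measure.restrict_restrict (measurableSet_seg d c x),
    inter_eq_self_of_subset_left (seg_subset_tail d c x)]

theorem tendsto_integral_seg [NoMaxOrder X] {E : Type*} [NormedAddCommGroup E] [NormedSpace ℝ E]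
    {f : X → E} (h : IntegrableOn f (tail d c) m) :
    Tendsto (fun x => ∫ s in seg d c x, f s ∂m) (endF d) (𝓝 (∫ s in tail d c, f s ∂m)) := by
  simpa only [restrict_tail_seg] using
    (aecover_seg m d c).integral_tendsto_of_countably_generated h

theorem tendsto_integral_tail [NoMaxOrder X] {E : Type*} [NormedAddCommGroup E] [NormedSpace ℝ E]
    {f : X → E} (h : IntegrableOn f (tail d c) m) :
    Tendsto (fun x => ∫ s in tail d x, f s ∂m) (endF d) (𝓝 0) := by
  have h1 := (tendsto_const_nhds (x := ∫ s in tail d c, f s ∂m)).sub (tendsto_integral_seg h)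
  rw [sub_self] at h1
  refine h1.congr' ?_
  filter_upwards [eventually_beyond d c] with x hx
  rw [hx.integral_tail h]; abel

theorem integrableOn_tail_of_bounded [NoMaxOrder X] [Nonempty X] {f : X → ℝ} (hf : ∀ x, 0 ≤ f x)
    (h : ∀ x y, IntegrableOn f (Ico x y) m) {B : ℝ}
    (hB : ∀ᶠ x in endF d, ∫ s in seg d c x, f s ∂m ≤ B) : IntegrableOn f (tail d c) m := by
  refine (aecover_seg m d c).integrable_of_integral_norm_bounded B (fun x => ?_) ?_
  · rw [IntegrableOn, restrict_tail_seg]; exact integrableOn_seg h d c x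
  · filter_upwards [hB] with x hx
    rw [restrict_tail_seg]
    simpa only [Real.norm_of_nonneg (hf _)] using hx

theorem Prim.tendsto [NoMaxOrder X] (h : Prim m F f) (hf : IntegrableOn f (tail d c) m) :
    Tendsto F (endF d) (𝓝 (F c + sg d * ∫ s in tail d c, f s ∂m)) := by
  refine (((tendsto_integral_seg hf).const_mul _).const_add _).congr' ?_
  filter_upwards [eventually_beyond d c] with x hx using (h.seg_eq hx).symm

theorem Prim.eq_of_tendsto [NoMaxOrder X] [Nonempty X] (h : Prim m F f)
    (hf : IntegrableOn f (tail d c) m) {L : ℂ} (hL : Tendsto F (endF d) (𝓝 L)) :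
    F c = L - sg d * ∫ s in tail d c, f s ∂m := by
  rw [← tendsto_nhds_unique (h.tendsto hf) hL]; ring

end Ends

variable {S : System X} {z : ℂ}

/-! ### The bilinear `H¹` form, the energy density and the Cauchy–Schwarz inequality. -/

section Energy

/-- The bilinear `H¹` density of `(f, f₁)` and `(g, g₁)`. -/
def System.bil (S : System X) (f f₁ g g₁ : X → ℂ) (x : X) : ℂ :=
  S.q x * (f x * g x) + S.p x * (f₁ x * g₁ x)

/-- The `H¹` energy density of `(f, f₁)`. -/
noncomputable def System.en (S : System X) (f f₁ : X → ℂ) (x : X) : ℝ :=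
  S.q x * ‖f x‖ ^ 2 + S.p x * ‖f₁ x‖ ^ 2

variable {f f₁ g g₁ : X → ℂ}

theorem System.en_nonneg (S : System X) (f f₁ : X → ℂ) (x : X) : 0 ≤ S.en f f₁ x :=
  add_nonneg (mul_nonneg (S.q_nonneg x) (by positivity)) (mul_nonneg (S.p_nonneg x) (by positivity))

/-- The weighted inequality `2 t a b ≤ t² a² + b²`. After integration the free parameter `t` gives a
non-negative quadratic polynomial, whose discriminant yields Cauchy–Schwarz. -/
theorem System.norm_bil_le (S : System X) (f f₁ g g₁ : X → ℂ) (x : X) (t : ℝ) (ht : 0 < t) :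
    2 * t * ‖S.bil f f₁ g g₁ x‖ ≤ t ^ 2 * S.en f f₁ x + S.en g g₁ x := by
  have hp := S.p_nonneg x
  have hq := S.q_nonneg x
  have h : ‖S.bil f f₁ g g₁ x‖ ≤ S.q x * (‖f x‖ * ‖g x‖) + S.p x * (‖f₁ x‖ * ‖g₁ x‖) := by
    refine (norm_add_le _ _).trans_eq ?_
    simp only [norm_mul, Complex.norm_real, Real.norm_of_nonneg hp, Real.norm_of_nonneg hq]
  unfold System.en
  nlinarith [mul_nonneg hq (sq_nonneg (t * ‖f x‖ - ‖g x‖)),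
    mul_nonneg hp (sq_nonneg (t * ‖f₁ x‖ - ‖g₁ x‖)), mul_le_mul_of_nonneg_left h ht.le]

/-- A density `h` relative to `ς` may be arbitrary where `p = 0`, so only `p * h` is measurable. On
that set the product vanishes too, and elsewhere one factor `p` can be divided out. -/
theorem System.aestronglyMeasurable_p_mul (S : System X) {h h' : X → ℂ}
    (hh : AEStronglyMeasurable (fun s => S.p s * h s) S.m)
    (hh' : AEStronglyMeasurable (fun s => S.p s * h' s) S.m) :
    AEStronglyMeasurable (fun s => S.p s * (h s * h' s)) S.m := by
  have hp : AEStronglyMeasurable (fun s => (S.p s : ℂ)⁻¹) S.m :=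
    (Complex.measurable_ofReal.comp S.measurable_p).inv.aestronglyMeasurable
  refine ((hh.mul hh').mul hp).congr (Eventually.of_forall fun s => ?_)
  simp only [Pi.mul_apply]
  by_cases h0 : (S.p s : ℂ) = 0
  · simp [h0]
  · field_simp

variable [NoMaxOrder X]

theorem System.aestronglyMeasurable_bil (hf : Prim S.m f fun s => S.p s * f₁ s)
    (hg : Prim S.m g fun s => S.p s * g₁ s) : AEStronglyMeasurable (S.bil f f₁ g g₁) S.m := by
  have hq : AEStronglyMeasurable (fun s => (S.q s : ℂ)) S.m :=
    (Complex.measurable_ofReal.comp S.measurable_q).aestronglyMeasurable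
  exact (hq.mul (hf.stronglyMeasurable.aestronglyMeasurable.mul
    hg.stronglyMeasurable.aestronglyMeasurable)).add
    (S.aestronglyMeasurable_p_mul (aestronglyMeasurable_of_integrableOn_Ico hf.1)
      (aestronglyMeasurable_of_integrableOn_Ico hg.1))

theorem System.integrableOn_bil (hf : Prim S.m f fun s => S.p s * f₁ s)
    (hg : Prim S.m g fun s => S.p s * g₁ s) {J : Set X} (hf' : IntegrableOn (S.en f f₁) J S.m)
    (hg' : IntegrableOn (S.en g g₁) J S.m) : IntegrableOn (S.bil f f₁ g g₁) J S.m := by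
  refine Integrable.mono' (hf'.add hg') (System.aestronglyMeasurable_bil hf hg).restrict
    (Eventually.of_forall fun x => ?_)
  have := S.norm_bil_le f f₁ g g₁ x 1 one_pos
  have h2 := norm_nonneg (S.bil f f₁ g g₁ x)
  simp only [Pi.add_apply]
  linarith

/-- The Cauchy--Schwarz inequality for the `H¹` form on a set. -/
theorem System.norm_integral_bil_sq_le (hf : Prim S.m f fun s => S.p s * f₁ s)
    (hg : Prim S.m g fun s => S.p s * g₁ s) {J : Set X} (hf' : IntegrableOn (S.en f f₁) J S.m)
    (hg' : IntegrableOn (S.en g g₁) J S.m) :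
    ‖∫ s in J, S.bil f f₁ g g₁ s ∂S.m‖ ^ 2
      ≤ (∫ s in J, S.en f f₁ s ∂S.m) * ∫ s in J, S.en g g₁ s ∂S.m := by
  set I := ‖∫ s in J, S.bil f f₁ g g₁ s ∂S.m‖
  set A := ∫ s in J, S.en f f₁ s ∂S.m
  set B := ∫ s in J, S.en g g₁ s ∂S.m
  have hA : 0 ≤ A := integral_nonneg (S.en_nonneg f f₁)
  have hB : 0 ≤ B := integral_nonneg (S.en_nonneg g g₁)
  have hI : 0 ≤ I := norm_nonneg _
  have key : ∀ t : ℝ, 0 ≤ A * (t * t) + (-2 * I) * t + B := by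
    intro t
    rcases le_or_gt t 0 with ht | ht
    · nlinarith [mul_nonneg hA (mul_self_nonneg t), mul_nonneg hI (neg_nonneg.2 ht)]
    · have h1 : I ≤ ∫ s in J, ‖S.bil f f₁ g g₁ s‖ ∂S.m := norm_integral_le_integral_norm _
      have h2 : 2 * t * ∫ s in J, ‖S.bil f f₁ g g₁ s‖ ∂S.m ≤ t ^ 2 * A + B := by
        rw [← integral_const_mul, ← integral_const_mul, ← integral_add (hf'.const_mul _) hg']
        exact integral_mono ((System.integrableOn_bil hf hg hf' hg').norm.const_mul _)
          ((hf'.const_mul _).add hg') fun s => S.norm_bil_le f f₁ g g₁ s t ht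
      nlinarith [mul_le_mul_of_nonneg_left h1 ht.le]
  have := discrim_le_zero key
  unfold discrim at this
  nlinarith

theorem System.norm_integral_bil_le (hf : Prim S.m f fun s => S.p s * f₁ s)
    (hg : Prim S.m g fun s => S.p s * g₁ s) {J : Set X} (hf' : IntegrableOn (S.en f f₁) J S.m)
    (hg' : IntegrableOn (S.en g g₁) J S.m) :
    ‖∫ s in J, S.bil f f₁ g g₁ s ∂S.m‖
      ≤ √(∫ s in J, S.en f f₁ s ∂S.m) * √(∫ s in J, S.en g g₁ s ∂S.m) := by
  rw [← Real.sqrt_mul (integral_nonneg (S.en_nonneg f f₁))]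
  exact Real.le_sqrt_of_sq_le (System.norm_integral_bil_sq_le hf hg hf' hg')

theorem System.integrableOn_en_Ico (S : System X) (hf : Prim S.m f fun s => S.p s * f₁ s)
    (hf₁ : Prim S.m f₁ g) (x y : X) : IntegrableOn (S.en f f₁) (Ico x y) S.m := by
  obtain ⟨A, hA0, hA⟩ := hf.exists_bound x y
  obtain ⟨B, hB0, hB⟩ := hf₁.exists_bound x y
  refine Measure.integrableOn_of_bounded (M := A ^ 2 + B ^ 2) (S.finite_Ico x y).ne ?_ ?_
  · have hp := S.measurable_p
    have hq := S.measurable_q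
    have h1 := hf.stronglyMeasurable.measurable.norm
    have h2 := hf₁.stronglyMeasurable.measurable.norm
    exact ((hq.mul (h1.pow_const 2)).add (hp.mul (h2.pow_const 2))).aestronglyMeasurable
  · filter_upwards [ae_restrict_mem measurableSet_Ico] with s hs
    rw [Real.norm_of_nonneg (S.en_nonneg f f₁ s)]
    have h1 := hA s ⟨hs.1, hs.2.le⟩
    have h2 := hB s ⟨hs.1, hs.2.le⟩
    have h3 : ‖f s‖ ^ 2 ≤ A ^ 2 := by gcongr
    have h4 : ‖f₁ s‖ ^ 2 ≤ B ^ 2 := by gcongr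
    refine add_le_add ?_ ?_
    · exact (mul_le_of_le_one_left (by positivity) (S.q_le s)).trans h3
    · exact (mul_le_of_le_one_left (by positivity) (S.p_le s)).trans h4

theorem System.en_const_mul (S : System X) (α : ℂ) (f f₁ : X → ℂ) (x : X) :
    S.en (fun s => α * f s) (fun s => α * f₁ s) x = ‖α‖ ^ 2 * S.en f f₁ x := by
  simp only [System.en, norm_mul]; ring

theorem System.en_add_le (S : System X) (f f₁ g g₁ : X → ℂ) (x : X) :
    S.en (fun s => f s + g s) (fun s => f₁ s + g₁ s) x ≤ 2 * (S.en f f₁ x + S.en g g₁ x) := by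
  have h : ∀ a b : ℂ, ‖a + b‖ ^ 2 ≤ 2 * (‖a‖ ^ 2 + ‖b‖ ^ 2) := fun a b => by
    have := norm_add_le a b
    nlinarith [norm_nonneg (a + b), sq_nonneg (‖a‖ - ‖b‖)]
  have h1 := mul_le_mul_of_nonneg_left (h (f x) (g x)) (S.q_nonneg x)
  have h2 := mul_le_mul_of_nonneg_left (h (f₁ x) (g₁ x)) (S.p_nonneg x)
  unfold System.en
  linarith

theorem System.aestronglyMeasurable_en (hf : Prim S.m f fun s => S.p s * f₁ s) :
    AEStronglyMeasurable (S.en f f₁) S.m := by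
  have hp : Measurable fun s => (S.p s)⁻¹ := S.measurable_p.inv
  have h1 := (aestronglyMeasurable_of_integrableOn_Ico hf.1).norm
  have h2 := hf.stronglyMeasurable.measurable.norm
  refine ((S.measurable_q.mul (h2.pow_const 2)).aestronglyMeasurable.add
    ((h1.mul h1).mul hp.aestronglyMeasurable)).congr (Eventually.of_forall fun s => ?_)
  simp only [Pi.add_apply, Pi.mul_apply, System.en, norm_mul, Complex.norm_real,
    Real.norm_of_nonneg (S.p_nonneg s)]
  by_cases h0 : S.p s = 0
  · simp [h0]
  · field_simp

theorem System.integrableOn_en_lin (hf : Prim S.m f fun s => S.p s * f₁ s)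
    (hg : Prim S.m g fun s => S.p s * g₁ s) {J : Set X} (hf' : IntegrableOn (S.en f f₁) J S.m)
    (hg' : IntegrableOn (S.en g g₁) J S.m) (α β : ℂ) :
    IntegrableOn (S.en (fun s => α * f s + β * g s) fun s => α * f₁ s + β * g₁ s) J S.m := by
  refine Integrable.mono' (((hf'.const_mul (‖α‖ ^ 2)).add (hg'.const_mul (‖β‖ ^ 2))).const_mul 2)
    (System.aestronglyMeasurable_en (((hf.const_mul α).add (hg.const_mul β)).of_eq
      (fun _ => rfl) fun _ => by ring)).restrict (Eventually.of_forall fun x => ?_)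
  rw [Real.norm_of_nonneg (S.en_nonneg _ _ x)]
  refine (S.en_add_le (fun s => α * f s) (fun s => α * f₁ s) (fun s => β * g s)
    (fun s => β * g₁ s) x).trans_eq ?_
  simp only [System.en_const_mul, Pi.add_apply]

theorem System.en_star (S : System X) (f f₁ : X → ℂ) :
    S.en (fun s => star (f s)) (fun s => star (f₁ s)) = S.en f f₁ := by
  ext x; simp [System.en]

end Energy

/-- A pair `(f, t)` with `τ f = t`, together with the derivatives of `f` and `t`. -/
structure Elt (S : System X) where
  f : X → ℂ
  f₁ : X → ℂ
  t : X → ℂ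
  t₁ : X → ℂ
  prim : Prim S.m f fun s => S.p s * f₁ s
  prim₁ : Prim S.m f₁ fun s => S.q s * f s - S.r s * t s
  primt : Prim S.m t fun s => S.p s * t₁ s

/-- A solution as an element of the maximal relation. -/
@[simps] def Sol.elt (s : Sol S z) : Elt S where
  f := s.u
  f₁ := s.u₁
  t x := z * s.u x
  t₁ x := z * s.u₁ x
  prim := s.prim
  prim₁ := s.prim₁.of_eq (fun _ => rfl) fun _ => by ring
  primt := (s.prim.const_mul z).of_eq (fun _ => rfl) fun _ => by ring

/-! ### Pairs in the maximal relation, the modified Wronskian and its boundary values. -/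

namespace Elt

/-- The complex conjugate of a pair. -/
@[simps] def conj (P : Elt S) : Elt S where
  f x := star (P.f x)
  f₁ x := star (P.f₁ x)
  t x := star (P.t x)
  t₁ x := star (P.t₁ x)
  prim := P.prim.conj.of_eq (fun _ => rfl) fun _ => by simp
  prim₁ := P.prim₁.conj.of_eq (fun _ => rfl) fun _ => by simp
  primt := P.primt.conj.of_eq (fun _ => rfl) fun _ => by simp

/-- Linear combinations of pairs. -/
@[simps] def lin (α β : ℂ) (P Q : Elt S) : Elt S where
  f x := α * P.f x + β * Q.f x
  f₁ x := α * P.f₁ x + β * Q.f₁ x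
  t x := α * P.t x + β * Q.t x
  t₁ x := α * P.t₁ x + β * Q.t₁ x
  prim := ((P.prim.const_mul α).add (Q.prim.const_mul β)).of_eq (fun _ => rfl) fun _ => by ring
  prim₁ := ((P.prim₁.const_mul α).add (Q.prim₁.const_mul β)).of_eq (fun _ => rfl)
    fun _ => by ring
  primt := ((P.primt.const_mul α).add (Q.primt.const_mul β)).of_eq (fun _ => rfl)
    fun _ => by ring

/-- The modified Wronskian. -/
def V (P Q : Elt S) (x : X) : ℂ := P.t x * Q.f₁ x - P.f₁ x * Q.t x

/-- The density of the modified Wronskian. -/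
def L (P Q : Elt S) (x : X) : ℂ :=
  S.bil P.t P.t₁ Q.f Q.f₁ x - S.bil P.f P.f₁ Q.t Q.t₁ x

/-- At each point `V` is the determinant of the vectors `(t, f₁)`; four vectors in a plane satisfy
the three-term Plücker relation. Through it, boundary conditions and limits are transferred from
some pairs to others. -/
theorem V_plucker (P₁ P₂ P₃ P₄ : Elt S) (x : X) :
    P₁.V P₂ x * P₃.V P₄ x - P₁.V P₃ x * P₂.V P₄ x + P₁.V P₄ x * P₂.V P₃ x = 0 := by
  unfold V; ring

theorem V_swap (P Q : Elt S) (x : X) : P.V Q x = -Q.V P x := by unfold V; ring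

variable [NoMaxOrder X]

/-- The Lagrange identity. -/
theorem prim_V (P Q : Elt S) : Prim S.m (P.V Q) (P.L Q) := by
  have hat : ∀ (P Q : Elt S) s, S.p s * P.t₁ s * (S.q s * Q.f s - S.r s * Q.t s) *
      S.m.real {s} = 0 := by
    intro P Q s
    have h1 : (S.p s * S.q s * S.m.real {s} : ℂ) = 0 := by exact_mod_cast S.atom_pq s
    have h2 : (S.p s * S.r s * S.m.real {s} : ℂ) = 0 := by exact_mod_cast S.atom_pr s
    linear_combination (P.t₁ s * Q.f s) * h1 - (P.t₁ s * Q.t s) * h2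
  refine ((P.primt.mul Q.prim₁ (hat P Q)).sub (Q.primt.mul P.prim₁ (hat Q P))).of_eq
    (fun x => ?_) fun x => ?_
  · unfold V; ring
  · unfold L System.bil; ring

/-- Both components of the pair have finite energy beyond `c`. -/
structure FinAt (P : Elt S) (d : Bool) (c : X) : Prop where
  f : IntegrableOn (S.en P.f P.f₁) (tail d c) S.m
  t : IntegrableOn (S.en P.t P.t₁) (tail d c) S.m

variable {P Q : Elt S} {d : Bool} {c x : X}

theorem FinAt.mono (h : P.FinAt d c) (hx : Beyond d c x) : P.FinAt d x :=
  ⟨h.f.mono_set hx.tail_subset, h.t.mono_set hx.tail_subset⟩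

theorem FinAt.conj (h : P.FinAt d c) : P.conj.FinAt d c := by
  constructor
  · simpa only [Elt.conj, System.en_star] using h.f
  · simpa only [Elt.conj, System.en_star] using h.t

theorem FinAt.lin (hP : P.FinAt d c) (hQ : Q.FinAt d c) (α β : ℂ) :
    (Elt.lin α β P Q).FinAt d c :=
  ⟨System.integrableOn_en_lin P.prim Q.prim hP.f hQ.f α β,
    System.integrableOn_en_lin P.primt Q.primt hP.t hQ.t α β⟩

theorem FinAt.integrableOn_L (hP : P.FinAt d c) (hQ : Q.FinAt d c) :
    IntegrableOn (P.L Q) (tail d c) S.m :=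
  (System.integrableOn_bil P.primt Q.prim hP.t hQ.f).sub
    (System.integrableOn_bil P.prim Q.primt hP.f hQ.t)

theorem FinAt.exists_tendsto_V (hP : P.FinAt d c) (hQ : Q.FinAt d c) :
    ∃ l, Tendsto (P.V Q) (endF d) (𝓝 l) :=
  ⟨_, (P.prim_V Q).tendsto (hP.integrableOn_L hQ)⟩

/-- If two pairs satisfy the same non-degenerate boundary condition, then their Wronskian
vanishes at the endpoint. -/
theorem tendsto_V_of_tendsto {R H : Elt S} (hP : P.FinAt d c) (hQ : Q.FinAt d c)
    (hH : H.FinAt d c) (hPR : Tendsto (P.V R) (endF d) (𝓝 0))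
    (hQR : Tendsto (Q.V R) (endF d) (𝓝 0)) {l : ℂ} (hl : l ≠ 0)
    (hHR : Tendsto (H.V R) (endF d) (𝓝 l)) : Tendsto (P.V Q) (endF d) (𝓝 0) := by
  obtain ⟨a, ha⟩ := hP.exists_tendsto_V hH
  obtain ⟨b, hb⟩ := hQ.exists_tendsto_V hH
  -- This quotient is `P.V Q x`, by the Plücker relation for `P`, `Q`, `H`, `R`, as soon as `H.V R x
  -- ≠ 0`.
  have h1 : Tendsto (fun x => (P.V H x * Q.V R x - P.V R x * Q.V H x) / H.V R x) (endF d)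
      (𝓝 ((a * 0 - 0 * b) / l)) := ((ha.mul hQR).sub (hPR.mul hb)).div hHR hl
  rw [mul_zero, zero_mul, sub_zero, zero_div] at h1
  refine h1.congr' ?_
  filter_upwards [hHR.eventually_ne hl] with x hx
  rw [div_eq_iff hx]
  linear_combination -V_plucker P Q H R x

end Elt

namespace Sol

variable [NoMaxOrder X] {d : Bool} {c : X}

theorem integrableOn_en_Ico (s : Sol S z) (x y : X) : IntegrableOn (S.en s.u s.u₁) (Ico x y) S.m :=
  S.integrableOn_en_Ico s.prim s.prim₁ x y

/-- The solution has finite energy near the endpoint. -/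
def FinAt (s : Sol S z) (d : Bool) : Prop := ∀ c, IntegrableOn (S.en s.u s.u₁) (tail d c) S.m

theorem finAt_of_integrableOn (s : Sol S z) (h : IntegrableOn (S.en s.u s.u₁) (tail d c) S.m) :
    s.FinAt d := fun x => integrableOn_tail_of_integrableOn_tail s.integrableOn_en_Ico h x

theorem FinAt.elt {s : Sol S z} (h : s.FinAt d) (c : X) : s.elt.FinAt d c := by
  refine ⟨h c, ?_⟩
  simp only [Sol.elt, IntegrableOn]
  rw [funext (S.en_const_mul z s.u s.u₁)]
  exact (h c).const_mul _

theorem FinAt.conj {s : Sol S z} (h : s.FinAt d) : s.conj.FinAt d := by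
  intro c
  simpa only [Sol.conj, System.en_star] using h c

theorem FinAt.lin {s t : Sol S z} (hs : s.FinAt d) (ht : t.FinAt d) (α β : ℂ) :
    (Sol.lin α β s t).FinAt d := fun c =>
  System.integrableOn_en_lin s.prim t.prim (hs c) (ht c) α β

end Sol

end MeasureSL

/-! ### Solutions of finite energy: independence of the spectral parameter, and compactness. -/

namespace MeasureSL

variable {X : Type*} [LinearOrder X] [TopologicalSpace X] [OrderTopology X]
  [SecondCountableTopology X] [MeasurableSpace X] [BorelSpace X] [NoMaxOrder X]

variable {S : System X} {z : ℂ} {d : Bool} {c : X}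

/-- The coefficient `p` does not vanish almost everywhere on any non-empty interval. -/
def System.PPos (S : System X) : Prop :=
  ∀ x y, x < y → ¬ S.p =ᵐ[S.m.restrict (Ico x y)] 0

theorem exists_seq_endF [NoMinOrder X] [Nonempty X] (d : Bool) {p : X → Prop}
    (hp : ∀ᶠ x in endF d, p x) : ∃ xs : ℕ → X, Tendsto xs atTop (endF d) ∧ ∀ n, p (xs n) := by
  obtain ⟨xs, hxs⟩ := exists_seq_tendsto (endF d : Filter X)
  obtain ⟨N, hN⟩ := eventually_atTop.1 (hxs.eventually hp)
  exact ⟨fun n => xs (n + N), hxs.comp (tendsto_add_atTop_nat N), fun n => hN _ (by omega)⟩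

theorem eventually_beyond_ne [NoMinOrder X] (d : Bool) (c : X) :
    ∀ᶠ x in endF d, Beyond d c x ∧ x ≠ c := by
  cases d
  · filter_upwards [show ∀ᶠ x in endF false, x < c from eventually_lt_atBot c] with x hx
      using ⟨hx.le, hx.ne⟩
  · filter_upwards [show ∀ᶠ x in endF true, c < x from eventually_gt_atTop c] with x hx
      using ⟨hx.le, hx.ne'⟩

namespace Sol

/-- Zero energy forces `p u₁ = 0` almost everywhere on the interval, so `u` is constant there and
equals `u e = 0`. Then `u₁` is constant as well, and a non-zero constant would force `p = 0` almost
everywhere, against `PPos`. -/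
theorem eq_zero_of_energy_Ico (hS : S.PPos) (s : Sol S z) {x y e : X} (hxy : x < y)
    (he : e ∈ Icc x y) (h0 : s.u e = 0) (h : ∫ t in Ico x y, S.en s.u s.u₁ t ∂S.m = 0) (t : X) :
    s.u t = 0 ∧ s.u₁ t = 0 := by
  have hae := (setIntegral_eq_zero_iff_of_nonneg_ae
    (Eventually.of_forall (S.en_nonneg s.u s.u₁)) (s.integrableOn_en_Ico x y)).1 h
  have hp : ∀ᵐ t ∂S.m.restrict (Ico x y), (S.p t : ℂ) * s.u₁ t = 0 := by
    filter_upwards [hae] with t ht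
    have h1 := mul_nonneg (S.q_nonneg t) (sq_nonneg ‖s.u t‖)
    have h2 := mul_nonneg (S.p_nonneg t) (sq_nonneg ‖s.u₁ t‖)
    have h3 : S.p t * ‖s.u₁ t‖ ^ 2 = 0 := by
      simp only [System.en, Pi.zero_apply] at ht; linarith
    rcases mul_eq_zero.1 h3 with h | h
    · simp [h]
    · simp [norm_eq_zero.1 (pow_eq_zero_iff two_ne_zero |>.1 h)]
  have hu : ∀ t ∈ Icc x y, s.u t = s.u x := by
    intro t ht
    have := s.prim.2 x t ht.1
    rw [integral_eq_zero_of_ae (ae_restrict_of_ae_restrict_of_subset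
      (Ico_subset_Ico_right ht.2) hp)] at this
    exact sub_eq_zero.1 this
  have hu0 : ∀ t ∈ Icc x y, s.u t = 0 := fun t ht => by rw [hu t ht, ← hu e he, h0]
  have hu₁ : ∀ t ∈ Icc x y, s.u₁ t = s.u₁ x := by
    intro t ht
    have := s.prim₁.2 x t ht.1
    rw [setIntegral_congr_fun measurableSet_Ico (g := fun _ => 0) (fun r hr => by
      simp only [hu0 r ⟨hr.1, hr.2.le.trans ht.2⟩, mul_zero]), integral_zero] at this
    exact sub_eq_zero.1 this
  refine s.eq_zero (c := x) (hu0 x ⟨le_rfl, hxy.le⟩) ?_ t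
  by_contra hne
  refine hS x y hxy ?_
  filter_upwards [hp, ae_restrict_mem measurableSet_Ico] with t ht htm
  rw [hu₁ t ⟨htm.1, htm.2.le⟩] at ht
  simpa [hne] using ht

theorem eq_zero_of_energy (hS : S.PPos) (s : Sol S z) {x : X} (hx : Beyond d c x) (hne : x ≠ c)
    (h0 : s.u c = 0) (h : ∫ t in seg d c x, S.en s.u s.u₁ t ∂S.m = 0) (t : X) :
    s.u t = 0 ∧ s.u₁ t = 0 := by
  cases d
  · exact s.eq_zero_of_energy_Ico hS (lt_of_le_of_ne hx hne) ⟨hx, le_rfl⟩ h0 h t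
  · exact s.eq_zero_of_energy_Ico hS (lt_of_le_of_ne hx hne.symm) ⟨le_rfl, hx⟩ h0 h t

theorem energy_seg_nonneg (s : Sol S z) (d : Bool) (c x : X) :
    0 ≤ ∫ t in seg d c x, S.en s.u s.u₁ t ∂S.m :=
  integral_nonneg (S.en_nonneg _ _)

theorem ext_of_eq (s t : Sol S z) (h : s.u c = t.u c) (h₁ : s.u₁ c = t.u₁ c) (x : X) :
    s.u x = t.u x ∧ s.u₁ x = t.u₁ x := by
  have h0 := (lin 1 (-1) s t).eq_zero (c := c) (by simp [h]) (by simp [h₁]) x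
  simp only [lin_u, lin_u₁] at h0
  exact ⟨by linear_combination h0.1, by linear_combination h0.2⟩

theorem FinAt.of_eq {s t : Sol S z} (hs : s.FinAt d) (h : ∀ x, s.u x = t.u x ∧ s.u₁ x = t.u₁ x) :
    t.FinAt d := by
  have h1 : s.u = t.u := funext fun x => (h x).1
  have h2 : s.u₁ = t.u₁ := funext fun x => (h x).2
  intro c
  rw [← h1, ← h2]; exact hs c

/-- If two linearly independent solutions have finite energy, so have all solutions. -/
theorem finAt_of_independent {a b : Sol S z} (ha : a.FinAt d) (hb : b.FinAt d)
    (hW : a.u c * b.u₁ c - a.u₁ c * b.u c ≠ 0) (s : Sol S z) : s.FinAt d := by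
  set W := a.u c * b.u₁ c - a.u₁ c * b.u c with hWdef
  refine FinAt.of_eq (ha.lin hb ((s.u c * b.u₁ c - s.u₁ c * b.u c) / W)
    ((s.u₁ c * a.u c - s.u c * a.u₁ c) / W)) (ext_of_eq (c := c) _ _ ?_ ?_)
  · simp only [lin_u]; field_simp; rw [hWdef]; ring
  · simp only [lin_u₁]; field_simp; rw [hWdef]; ring

theorem real_of_real (hz : star z = z) (s : Sol S z) (h : star (s.u c) = s.u c)
    (h₁ : star (s.u₁ c) = s.u₁ c) (x : X) : star (s.u x) = s.u x ∧ star (s.u₁ x) = s.u₁ x := by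
  let t : Sol S z :=
    { u := fun x => star (s.u x)
      u₁ := fun x => star (s.u₁ x)
      prim := s.conj.prim
      prim₁ := s.conj.prim₁.of_eq (fun _ => rfl) fun _ => by simp only [hz, Sol.conj] }
  exact ext_of_eq t s h h₁ x

/-- If all solutions have finite energy for one non-zero spectral parameter, then so they have
for every other one. -/
theorem finAt_of_forall [Nonempty X] {z₀ : ℂ} (hz₀ : z₀ ≠ 0) (hz : z ≠ 0)
    (h : ∀ s : Sol S z₀, s.FinAt d) (s : Sol S z) : s.FinAt d := by
  obtain ⟨x₀⟩ := ‹Nonempty X›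
  obtain ⟨θ, hθ, hθ₁⟩ := exists_sol S z₀ x₀ 1 0
  obtain ⟨φ, hφ, hφ₁⟩ := exists_sol S z₀ x₀ 0 1
  have hW : ∀ x, θ.u x * φ.u₁ x - θ.u₁ x * φ.u x = 1 := by
    intro x; rw [θ.wronskian_const φ x x₀, hθ, hθ₁, hφ, hφ₁]; ring
  set k : ℝ := min (‖z‖ ^ 2) (‖z₀‖ ^ 2) with hk
  have hk0 : 0 < k := lt_min (by positivity) (by positivity)
  set D : ℝ := ‖z - z₀‖ ^ 2 with hD
  have hD0 : 0 ≤ D := by positivity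
  let E : X → ℝ := fun c => (∫ t in tail d c, S.en θ.u θ.u₁ t ∂S.m)
    + ∫ t in tail d c, S.en φ.u φ.u₁ t ∂S.m
  -- This is the feedback coefficient of the final estimate of `N x` in terms of itself; the base
  -- point `c` is chosen so close to the endpoint that it is at most `1 / 2`.
  have hE : Tendsto (fun c => 4 * D / k * E c * E c) (endF d) (𝓝 0) := by
    have h0 := (tendsto_integral_tail (h θ x₀)).add (tendsto_integral_tail (h φ x₀))
    rw [add_zero] at h0
    simpa using (h0.const_mul (4 * D / k)).mul h0
  obtain ⟨c, hc⟩ := (hE.eventually (ge_mem_nhds (show (0 : ℝ) < 1 / 2 by norm_num))).exists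
  have hEθ : ∀ y, ∫ t in seg d c y, S.en θ.u θ.u₁ t ∂S.m ≤ ∫ t in tail d c, S.en θ.u θ.u₁ t ∂S.m :=
    fun y => setIntegral_mono_set (h θ c) (Eventually.of_forall (S.en_nonneg _ _))
      (seg_subset_tail d c y).eventuallyLE
  have hEφ : ∀ y, ∫ t in seg d c y, S.en φ.u φ.u₁ t ∂S.m ≤ ∫ t in tail d c, S.en φ.u φ.u₁ t ∂S.m :=
    fun y => setIntegral_mono_set (h φ c) (Eventually.of_forall (S.en_nonneg _ _))
      (seg_subset_tail d c y).eventuallyLE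
  have hE0 : 0 ≤ ∫ t in tail d c, S.en θ.u θ.u₁ t ∂S.m := integral_nonneg (S.en_nonneg _ _)
  have hE0' : 0 ≤ ∫ t in tail d c, S.en φ.u φ.u₁ t ∂S.m := integral_nonneg (S.en_nonneg _ _)
  set A : ℝ := ‖s.elt.V θ.elt c‖ ^ 2 + ‖s.elt.V φ.elt c‖ ^ 2 with hA
  let N : X → ℝ := fun x => ∫ t in seg d c x, S.en s.u s.u₁ t ∂S.m
  -- Between solutions for `z` and `z₀` the Lagrange density is `z - z₀` times the `H¹` density, so
  -- Cauchy–Schwarz bounds the growth of `V` by the energies.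
  have hVψ : ∀ ψ : Sol S z₀, (∀ y, ∫ t in seg d c y, S.en ψ.u ψ.u₁ t ∂S.m ≤ E c) →
      ∀ y, Beyond d c y →
      ‖s.elt.V ψ.elt y‖ ^ 2 ≤ 2 * (‖s.elt.V ψ.elt c‖ ^ 2 + D * (N y * E c)) := by
    intro ψ hψ y hy
    have h1 := (s.elt.prim_V ψ.elt).seg_eq hy
    have h2 : ∫ t in seg d c y, s.elt.L ψ.elt t ∂S.m
        = (z - z₀) * ∫ t in seg d c y, S.bil s.u s.u₁ ψ.u ψ.u₁ t ∂S.m := by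
      rw [← integral_const_mul]
      congr 1; ext t; simp only [Elt.L, System.bil, Sol.elt]; ring
    have h3 := System.norm_integral_bil_sq_le s.prim ψ.prim
      (integrableOn_seg s.integrableOn_en_Ico d c y) (integrableOn_seg ψ.integrableOn_en_Ico d c y)
    have h4 : ‖s.elt.V ψ.elt y‖ ≤ ‖s.elt.V ψ.elt c‖
        + ‖z - z₀‖ * ‖∫ t in seg d c y, S.bil s.u s.u₁ ψ.u ψ.u₁ t ∂S.m‖ := by
      rw [h1, h2]
      refine (norm_add_le _ _).trans_eq ?_
      rw [norm_mul, norm_sg, one_mul, norm_mul]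
    have h5 : ‖∫ t in seg d c y, S.bil s.u s.u₁ ψ.u ψ.u₁ t ∂S.m‖ ^ 2 ≤ N y * E c :=
      h3.trans (mul_le_mul_of_nonneg_left (hψ y) (s.energy_seg_nonneg d c y))
    calc ‖s.elt.V ψ.elt y‖ ^ 2 ≤ (‖s.elt.V ψ.elt c‖
          + ‖z - z₀‖ * ‖∫ t in seg d c y, S.bil s.u s.u₁ ψ.u ψ.u₁ t ∂S.m‖) ^ 2 := by gcongr
      _ ≤ 2 * (‖s.elt.V ψ.elt c‖ ^ 2
          + (‖z - z₀‖ * ‖∫ t in seg d c y, S.bil s.u s.u₁ ψ.u ψ.u₁ t ∂S.m‖) ^ 2) := add_sq_le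
      _ ≤ _ := by rw [mul_pow]; gcongr
  have hpt : ∀ y, k * S.en s.u s.u₁ y ≤ 2 * (S.en θ.u θ.u₁ y * ‖s.elt.V φ.elt y‖ ^ 2
      + S.en φ.u φ.u₁ y * ‖s.elt.V θ.elt y‖ ^ 2) := by
    intro y
    -- Variation of constants: `s` is recovered from its modified Wronskians with `θ` and `φ`, up to
    -- the factors `z` in `u` and `z₀` in `u₁`. Hence the constant `k` and the need for both
    -- parameters to be non-zero.
    have e1 : z * s.u y = θ.u y * s.elt.V φ.elt y - φ.u y * s.elt.V θ.elt y := by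
      simp only [Elt.V, Sol.elt]; linear_combination (-z * s.u y) * hW y
    have e2 : z₀ * s.u₁ y = θ.u₁ y * s.elt.V φ.elt y - φ.u₁ y * s.elt.V θ.elt y := by
      simp only [Elt.V, Sol.elt]; linear_combination (-z₀ * s.u₁ y) * hW y
    have hab : ∀ a b : ℂ, ‖a - b‖ ^ 2 ≤ 2 * (‖a‖ ^ 2 + ‖b‖ ^ 2) := fun a b =>
      (pow_le_pow_left₀ (norm_nonneg _) (norm_sub_le a b) 2).trans add_sq_le
    have f1 := hab (θ.u y * s.elt.V φ.elt y) (φ.u y * s.elt.V θ.elt y)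
    have f2 := hab (θ.u₁ y * s.elt.V φ.elt y) (φ.u₁ y * s.elt.V θ.elt y)
    rw [← e1] at f1
    rw [← e2] at f2
    simp only [norm_mul, mul_pow] at f1 f2
    have g1 : k * ‖s.u y‖ ^ 2 ≤ ‖z‖ ^ 2 * ‖s.u y‖ ^ 2 :=
      mul_le_mul_of_nonneg_right (min_le_left _ _) (by positivity)
    have g2 : k * ‖s.u₁ y‖ ^ 2 ≤ ‖z₀‖ ^ 2 * ‖s.u₁ y‖ ^ 2 :=
      mul_le_mul_of_nonneg_right (min_le_right _ _) (by positivity)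
    have i1 := mul_le_mul_of_nonneg_left (g1.trans f1) (S.q_nonneg y)
    have i2 := mul_le_mul_of_nonneg_left (g2.trans f2) (S.p_nonneg y)
    simp only [System.en]
    linarith
  refine s.finAt_of_integrableOn (c := c) (integrableOn_tail_of_bounded (S.en_nonneg _ _)
    s.integrableOn_en_Ico (B := 8 * A * E c / k) ?_)
  filter_upwards [eventually_beyond d c] with x hx
  change N x ≤ _
  have hN0 : 0 ≤ N x := s.energy_seg_nonneg d c x
  have hEc : 0 ≤ E c := add_nonneg hE0 hE0'
  set T : ℝ := 2 * (A + D * (N x * E c)) with hT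
  have hT0 : 0 ≤ T := by positivity
  have hVle : ∀ y ∈ seg d c x, ‖s.elt.V φ.elt y‖ ^ 2 ≤ T ∧ ‖s.elt.V θ.elt y‖ ^ 2 ≤ T := by
    intro y hy
    have hy1 : Beyond d c y := by
      cases d
      · exact hy.2.le
      · exact hy.1
    have hyx : seg d c y ⊆ seg d c x := by
      cases d
      · exact Ico_subset_Ico_left hy.1
      · exact Ico_subset_Ico_right hy.2.le
    have hNy : N y ≤ N x := setIntegral_mono_set (integrableOn_seg s.integrableOn_en_Ico d c x)
      (Eventually.of_forall (S.en_nonneg _ _)) hyx.eventuallyLE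
    have hm := mul_le_mul_of_nonneg_left (mul_le_mul_of_nonneg_right hNy hEc) hD0
    have a1 := sq_nonneg ‖s.elt.V θ.elt c‖
    have a2 := sq_nonneg ‖s.elt.V φ.elt c‖
    constructor
    · refine (hVψ φ (fun y => (hEφ y).trans (le_add_of_nonneg_left hE0)) y hy1).trans ?_
      linarith
    · refine (hVψ θ (fun y => (hEθ y).trans (le_add_of_nonneg_right hE0')) y hy1).trans ?_
      linarith
  have hint : k * N x ≤ 2 * T * E c := by
    have iθ := integrableOn_seg θ.integrableOn_en_Ico d c x
    have iφ := integrableOn_seg φ.integrableOn_en_Ico d c x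
    calc k * N x = ∫ t in seg d c x, k * S.en s.u s.u₁ t ∂S.m := (integral_const_mul _ _).symm
      _ ≤ ∫ t in seg d c x, 2 * T * (S.en θ.u θ.u₁ t + S.en φ.u φ.u₁ t) ∂S.m := by
        refine setIntegral_mono_on ((integrableOn_seg s.integrableOn_en_Ico d c x).const_mul k)
          ((iθ.add iφ).const_mul _) (measurableSet_seg d c x) fun y hy => (hpt y).trans ?_
        have b1 := mul_le_mul_of_nonneg_left (hVle y hy).1 (S.en_nonneg θ.u θ.u₁ y)
        have b2 := mul_le_mul_of_nonneg_left (hVle y hy).2 (S.en_nonneg φ.u φ.u₁ y)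
        linarith
      _ = 2 * T * ((∫ t in seg d c x, S.en θ.u θ.u₁ t ∂S.m)
          + ∫ t in seg d c x, S.en φ.u φ.u₁ t ∂S.m) := by
        rw [integral_const_mul, integral_add iθ iφ]
      _ ≤ _ := mul_le_mul_of_nonneg_left (add_le_add (hEθ x) (hEφ x)) (by positivity)
  have hfin : 4 * D / k * E c * E c * N x ≤ 1 / 2 * N x := mul_le_mul_of_nonneg_right hc hN0
  -- The last term is at most half of `N x` by the choice of `c` and is absorbed, which bounds `N x`
  -- uniformly in `x`.
  have : N x ≤ 4 * A * E c / k + 4 * D / k * E c * E c * N x := by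
    have : 4 * A * E c / k + 4 * D / k * E c * E c * N x = 2 * T * E c / k := by
      rw [hT]; field_simp; ring
    rw [this, le_div_iff₀ hk0]; linarith
  have h8 : 8 * A * E c / k = 2 * (4 * A * E c / k) := by ring
  rw [h8]
  linarith

/-- Compactness for solutions `θ + M φ` whose energies are controlled by `M`. -/
theorem exists_limit [Nonempty X] (θ φ : Sol S z) {xs : ℕ → X}
    (hxs : Tendsto xs atTop (endF d)) {M : ℕ → ℂ} {C : ℝ}
    (hC : ∀ n, ∫ t in seg d c (xs n), S.en (lin 1 (M n) θ φ).u (lin 1 (M n) θ φ).u₁ t ∂S.m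
      ≤ C * (1 + ‖M n‖))
    {x₀ : X} (hx₀ : Beyond d c x₀) (hφ : 0 < ∫ t in seg d c x₀, S.en φ.u φ.u₁ t ∂S.m) :
    ∃ (μ : ℂ) (σ : ℕ → ℕ), StrictMono σ ∧ Tendsto (fun n => M (σ n)) atTop (𝓝 μ) ∧
      (lin 1 μ θ φ).FinAt d ∧ ∀ g g₁ : X → ℂ, Prim S.m g (fun s => S.p s * g₁ s) →
        IntegrableOn (S.en g g₁) (tail d c) S.m →
        Tendsto (fun n => ∫ t in seg d c (xs (σ n)),
          S.bil g g₁ (lin 1 (M (σ n)) θ φ).u (lin 1 (M (σ n)) θ φ).u₁ t ∂S.m) atTop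
          (𝓝 (∫ t in tail d c, S.bil g g₁ (lin 1 μ θ φ).u (lin 1 μ θ φ).u₁ t ∂S.m)) := by
  set a := ∫ t in seg d c x₀, S.en φ.u φ.u₁ t ∂S.m with ha
  set b := ∫ t in seg d c x₀, S.en θ.u θ.u₁ t ∂S.m with hb'
  have hb0 : 0 ≤ b := θ.energy_seg_nonneg d c x₀
  have iθ := θ.integrableOn_en_Ico
  have iφ := φ.integrableOn_en_Ico
  have iu := fun μ => (lin 1 μ θ φ).integrableOn_en_Ico
  have hC0 : 0 ≤ C := by
    have h1 := (energy_seg_nonneg (lin 1 (M 0) θ φ) d c (xs 0)).trans (hC 0)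
    by_contra h
    have : 0 < 1 + ‖M 0‖ := by positivity
    nlinarith
  set R : ℝ := max 1 ((4 * C + 2 * b) / a) with hR
  -- On the fixed piece up to `x₀` the energy of `M n • φ` is quadratic in `‖M n‖` with coefficient
  -- `a > 0`, whereas the hypothesis allows only linear growth.
  have hbound : ∀ᶠ n in atTop, ‖M n‖ ≤ R := by
    filter_upwards [hxs.eventually (eventually_beyond d x₀)] with n hn
    have h1 : ‖M n‖ ^ 2 * a ≤ 2 * (C * (1 + ‖M n‖) + b) := by
      have hsub : seg d c x₀ ⊆ seg d c (xs n) := by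
        rw [← hx₀.seg_union_seg hn]; exact subset_union_left
      have hle : ∫ t in seg d c x₀, S.en (lin 1 (M n) θ φ).u (lin 1 (M n) θ φ).u₁ t ∂S.m
          ≤ C * (1 + ‖M n‖) := (setIntegral_mono_set (integrableOn_seg (iu _) d c (xs n))
            (Eventually.of_forall (S.en_nonneg _ _)) hsub.eventuallyLE).trans (hC n)
      calc ‖M n‖ ^ 2 * a = ∫ t in seg d c x₀, ‖M n‖ ^ 2 * S.en φ.u φ.u₁ t ∂S.m :=
            (integral_const_mul _ _).symm
        _ ≤ ∫ t in seg d c x₀, 2 * (S.en (lin 1 (M n) θ φ).u (lin 1 (M n) θ φ).u₁ t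
            + S.en θ.u θ.u₁ t) ∂S.m := by
          refine integral_mono ((integrableOn_seg iφ d c x₀).const_mul _)
            (((integrableOn_seg (iu _) d c x₀).add (integrableOn_seg iθ d c x₀)).const_mul 2)
            fun t => ?_
          have h3 := S.en_add_le (lin 1 (M n) θ φ).u (lin 1 (M n) θ φ).u₁
            (fun s => -1 * θ.u s) (fun s => -1 * θ.u₁ s) t
          rw [S.en_const_mul] at h3
          have h4 : S.en (fun s => (lin 1 (M n) θ φ).u s + -1 * θ.u s)
              (fun s => (lin 1 (M n) θ φ).u₁ s + -1 * θ.u₁ s) t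
              = S.en (fun s => M n * φ.u s) (fun s => M n * φ.u₁ s) t := by
            simp only [System.en, lin_u, lin_u₁]; ring_nf
          rw [h4, S.en_const_mul] at h3
          simpa using h3
        _ = 2 * ((∫ t in seg d c x₀, S.en (lin 1 (M n) θ φ).u (lin 1 (M n) θ φ).u₁ t ∂S.m) + b) := by
          rw [integral_const_mul, integral_add (integrableOn_seg (iu _) d c x₀)
            (integrableOn_seg iθ d c x₀)]
        _ ≤ _ := by linarith
    rcases le_total ‖M n‖ 1 with h | h
    · exact h.trans (le_max_left _ _)
    · refine le_trans ?_ (le_max_right _ _)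
      rw [le_div_iff₀ hφ]
      have : ‖M n‖ * (‖M n‖ * a) ≤ ‖M n‖ * (4 * C + 2 * b) := by nlinarith
      exact le_of_mul_le_mul_left this (by linarith)
  obtain ⟨μ, -, σ, hσ, hμ⟩ := tendsto_subseq_of_frequently_bounded
    (Metric.isBounded_closedBall (x := (0 : ℂ)) (r := R))
    (hbound.frequently.mono fun n hn => by simpa using hn)
  have hμ' : Tendsto (fun n => M (σ n)) atTop (𝓝 μ) := hμ
  set B : ℝ := C * (1 + R) with hB
  have hB0 : 0 ≤ B := by positivity
  have hEn : ∀ᶠ n in atTop, ∫ t in seg d c (xs (σ n)),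
      S.en (lin 1 (M (σ n)) θ φ).u (lin 1 (M (σ n)) θ φ).u₁ t ∂S.m ≤ B := by
    filter_upwards [hσ.tendsto_atTop.eventually hbound] with n hn
    exact (hC (σ n)).trans (by rw [hB]; gcongr)
  have hxσ : Tendsto (fun n => xs (σ n)) atTop (endF d) := hxs.comp hσ.tendsto_atTop
  -- On a fixed segment the limit solution differs from the approximating one by `(μ - M) φ`, whose
  -- energy there tends to zero; this gives a bound independent of the segment.
  have hfin : (lin 1 μ θ φ).FinAt d := by
    refine finAt_of_integrableOn (c := c) _ (integrableOn_tail_of_bounded (S.en_nonneg _ _)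
      (iu μ) (B := 2 * (B + 1)) ?_)
    filter_upwards [eventually_beyond d c] with y hy
    have hlim : Tendsto (fun n => ‖μ - M (σ n)‖ ^ 2 * ∫ t in seg d c y, S.en φ.u φ.u₁ t ∂S.m) atTop
        (𝓝 0) := by
      have : Tendsto (fun n => ‖μ - M (σ n)‖) atTop (𝓝 0) := by
        simpa using ((tendsto_const_nhds (x := μ)).sub hμ').norm
      simpa using (this.pow 2).mul_const (∫ t in seg d c y, S.en φ.u φ.u₁ t ∂S.m)
    obtain ⟨n, ⟨h1, h2⟩, h3⟩ := ((hEn.and (hlim.eventually (ge_mem_nhds one_pos))).and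
      (hxσ.eventually (eventually_beyond d y))).exists
    have hsub : seg d c y ⊆ seg d c (xs (σ n)) := by
      rw [← hy.seg_union_seg h3]; exact subset_union_left
    have hle := (setIntegral_mono_set (integrableOn_seg (iu (M (σ n))) d c (xs (σ n)))
      (Eventually.of_forall (S.en_nonneg _ _)) hsub.eventuallyLE).trans h1
    calc ∫ t in seg d c y, S.en (lin 1 μ θ φ).u (lin 1 μ θ φ).u₁ t ∂S.m
        ≤ ∫ t in seg d c y, 2 * (S.en (lin 1 (M (σ n)) θ φ).u (lin 1 (M (σ n)) θ φ).u₁ t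
          + ‖μ - M (σ n)‖ ^ 2 * S.en φ.u φ.u₁ t) ∂S.m := by
          refine integral_mono (integrableOn_seg (iu _) d c y)
            (((integrableOn_seg (iu _) d c y).add
              ((integrableOn_seg iφ d c y).const_mul _)).const_mul 2) fun t => ?_
          have h3 := S.en_add_le (lin 1 (M (σ n)) θ φ).u (lin 1 (M (σ n)) θ φ).u₁
            (fun s => (μ - M (σ n)) * φ.u s) (fun s => (μ - M (σ n)) * φ.u₁ s) t
          rw [S.en_const_mul] at h3
          refine le_trans (le_of_eq ?_) h3
          simp only [System.en, lin_u, lin_u₁]; ring_nf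
      _ = 2 * ((∫ t in seg d c y, S.en (lin 1 (M (σ n)) θ φ).u (lin 1 (M (σ n)) θ φ).u₁ t ∂S.m)
          + ‖μ - M (σ n)‖ ^ 2 * ∫ t in seg d c y, S.en φ.u φ.u₁ t ∂S.m) := by
          rw [integral_const_mul, integral_add (integrableOn_seg (iu _) d c y)
            ((integrableOn_seg iφ d c y).const_mul _), integral_const_mul]
      _ ≤ _ := by linarith
  refine ⟨μ, σ, hσ, hμ', hfin, fun g g₁ hg hgE => ?_⟩
  set U := ∫ t in tail d c, S.en (lin 1 μ θ φ).u (lin 1 μ θ φ).u₁ t ∂S.m with hU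
  -- Beyond a suitable `y` both pairings are small uniformly in `n`, by Cauchy–Schwarz and the
  -- common energy bounds; up to `y` the pairing is affine in `M`, so convergence of `M` suffices.
  have hG : Tendsto (fun y => √(∫ t in tail d y, S.en g g₁ t ∂S.m) * (√B + √U)) (endF d) (𝓝 0) := by
    have := (tendsto_integral_tail hgE).sqrt.mul_const (√B + √U)
    simpa using this
  rw [Metric.tendsto_nhds]
  intro ε hε
  obtain ⟨y, hy, hyc⟩ := ((hG.eventually (gt_mem_nhds (half_pos hε))).and
    (eventually_beyond d c)).exists
  set K := ∫ t in seg d c y, S.bil g g₁ φ.u φ.u₁ t ∂S.m with hK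
  have hlim : Tendsto (fun n => ‖(M (σ n) - μ) * K‖) atTop (𝓝 0) := by
    simpa using ((hμ'.sub_const μ).mul_const K).norm
  filter_upwards [hEn, hlim.eventually (gt_mem_nhds (half_pos hε)),
    hxσ.eventually (eventually_beyond d y)] with n h1 h2 h3
  have ig : IntegrableOn (S.en g g₁) (seg d c y) S.m := hgE.mono_set (seg_subset_tail d c y)
  have igx : IntegrableOn (S.en g g₁) (seg d y (xs (σ n))) S.m :=
    hgE.mono_set ((seg_subset_tail d y _).trans hyc.tail_subset)
  have igt : IntegrableOn (S.en g g₁) (tail d y) S.m := hgE.mono_set hyc.tail_subset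
  have hcx := hyc.trans h3
  set v := lin 1 (M (σ n)) θ φ with hv
  set u := lin 1 μ θ φ with hu
  have iv := v.integrableOn_en_Ico
  have bvx : IntegrableOn (S.bil g g₁ v.u v.u₁) (seg d c (xs (σ n))) S.m :=
    System.integrableOn_bil hg v.prim (hgE.mono_set (seg_subset_tail d c _)) (integrableOn_seg iv d c _)
  have e1 : ∫ t in seg d c (xs (σ n)), S.bil g g₁ v.u v.u₁ t ∂S.m
      = (∫ t in seg d c y, S.bil g g₁ v.u v.u₁ t ∂S.m)
        + ∫ t in seg d y (xs (σ n)), S.bil g g₁ v.u v.u₁ t ∂S.m := by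
    rw [← hyc.seg_union_seg h3] at bvx ⊢
    exact setIntegral_union (disjoint_seg_seg d c y _) (measurableSet_seg d y _)
      (bvx.mono_set subset_union_left) (bvx.mono_set subset_union_right)
  have e2 := hyc.integral_tail (System.integrableOn_bil hg u.prim hgE (hfin c))
  have bvy : IntegrableOn (S.bil g g₁ v.u v.u₁) (seg d c y) S.m :=
    System.integrableOn_bil hg v.prim ig (integrableOn_seg iv d c y)
  have buy : IntegrableOn (S.bil g g₁ u.u u.u₁) (seg d c y) S.m :=
    System.integrableOn_bil hg u.prim ig (integrableOn_seg u.integrableOn_en_Ico d c y)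
  have e3 : (∫ t in seg d c y, S.bil g g₁ v.u v.u₁ t ∂S.m)
      - ∫ t in seg d c y, S.bil g g₁ u.u u.u₁ t ∂S.m = (M (σ n) - μ) * K := by
    rw [← integral_sub bvy buy, hK, ← integral_const_mul]
    congr 1; ext t
    simp only [System.bil, hv, hu, lin_u, lin_u₁]; ring
  have f1 : ‖∫ t in seg d y (xs (σ n)), S.bil g g₁ v.u v.u₁ t ∂S.m‖
      ≤ √(∫ t in tail d y, S.en g g₁ t ∂S.m) * √B := by
    refine (System.norm_integral_bil_le hg v.prim igx (integrableOn_seg iv d y _)).trans ?_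
    have g1 := setIntegral_mono_set igt (Eventually.of_forall (S.en_nonneg _ _))
      (seg_subset_tail d y (xs (σ n))).eventuallyLE
    have g2 := (setIntegral_mono_set (integrableOn_seg iv d c (xs (σ n)))
      (Eventually.of_forall (S.en_nonneg _ _))
      (show seg d y (xs (σ n)) ⊆ seg d c (xs (σ n)) by
        rw [← hyc.seg_union_seg h3]; exact subset_union_right).eventuallyLE).trans h1
    gcongr
  have f2 : ‖∫ t in tail d y, S.bil g g₁ u.u u.u₁ t ∂S.m‖
      ≤ √(∫ t in tail d y, S.en g g₁ t ∂S.m) * √U := by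
    refine (System.norm_integral_bil_le hg u.prim igt (hfin y)).trans ?_
    have g2 := setIntegral_mono_set (hfin c) (Eventually.of_forall (S.en_nonneg _ _))
      hyc.tail_subset.eventuallyLE
    gcongr
  rw [dist_eq_norm, e1, e2]
  have e4 : (∫ t in seg d c y, S.bil g g₁ v.u v.u₁ t ∂S.m)
        + (∫ t in seg d y (xs (σ n)), S.bil g g₁ v.u v.u₁ t ∂S.m)
      - ((∫ t in seg d c y, S.bil g g₁ u.u u.u₁ t ∂S.m)
        + ∫ t in tail d y, S.bil g g₁ u.u u.u₁ t ∂S.m)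
      = (M (σ n) - μ) * K + (∫ t in seg d y (xs (σ n)), S.bil g g₁ v.u v.u₁ t ∂S.m)
        - ∫ t in tail d y, S.bil g g₁ u.u u.u₁ t ∂S.m := by rw [← e3]; ring
  rw [e4]
  calc _ ≤ ‖(M (σ n) - μ) * K‖ + ‖∫ t in seg d y (xs (σ n)), S.bil g g₁ v.u v.u₁ t ∂S.m‖
        + ‖∫ t in tail d y, S.bil g g₁ u.u u.u₁ t ∂S.m‖ :=
        (norm_sub_le _ _).trans (add_le_add (norm_add_le _ _) le_rfl)
    _ < ε := by linarith

end Sol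

end MeasureSL

/-! ### Weyl solutions, principal solutions and Weyl's alternative. -/

namespace MeasureSL

variable {X : Type*} [LinearOrder X] [TopologicalSpace X] [OrderTopology X]
  [SecondCountableTopology X] [MeasurableSpace X] [BorelSpace X] [NoMaxOrder X] [NoMinOrder X]

variable {S : System X} {z : ℂ} {d : Bool} {c : X}

namespace Sol

theorem energy_seg_pos (hS : S.PPos) (s : Sol S z) {x : X} (hx : Beyond d c x) (hne : x ≠ c)
    (h0 : s.u c = 0) (h₁ : s.u₁ c ≠ 0) : 0 < ∫ t in seg d c x, S.en s.u s.u₁ t ∂S.m :=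
  lt_of_le_of_ne (s.energy_seg_nonneg d c x) fun h =>
    h₁ (s.eq_zero_of_energy hS hx hne h0 h.symm c).2

/-- The Lagrange identity for a solution and its own conjugate. For non-real `z` it expresses the
energy on a segment by boundary values. -/
theorem prim_V_conj (s : Sol S z) :
    Prim S.m (s.elt.V s.conj.elt) fun x => (z - star z) * (S.en s.u s.u₁ x : ℂ) := by
  refine (s.elt.prim_V s.conj.elt).of_eq (fun _ => rfl) fun x => ?_
  have h : ∀ a : ℂ, (‖a‖ : ℂ) ^ 2 = a * star a := fun a => (Complex.mul_conj' a).symm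
  simp only [Elt.L, System.bil, System.en, elt, conj]
  push_cast
  rw [h, h]; ring

theorem V_conj_eq (s : Sol S z) {x : X} (hx : Beyond d c x) :
    s.elt.V s.conj.elt x = s.elt.V s.conj.elt c
      + sg d * ((z - star z) * (∫ t in seg d c x, S.en s.u s.u₁ t ∂S.m : ℝ)) := by
  rw [s.prim_V_conj.seg_eq hx, integral_const_mul, integral_complex_ofReal]

/-- The normalization of a solution at `c`. -/
theorem exists_normalized {θ φ : Sol S z} (hθ : θ.u c = 1) (hθ₁ : θ.u₁ c = 0) (hφ : φ.u c = 0)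
    (hφ₁ : φ.u₁ c = 1) (y : Sol S z) (hy : y.u c ≠ 0) :
    ∃ k : ℂ, ∀ x, (lin 1 (y.u₁ c / y.u c) θ φ).u x = k * y.u x ∧
      (lin 1 (y.u₁ c / y.u c) θ φ).u₁ x = k * y.u₁ x := by
  refine ⟨(y.u c)⁻¹, fun x => ?_⟩
  have := ext_of_eq (lin 1 (y.u₁ c / y.u c) θ φ) (lin (y.u c)⁻¹ 0 y y) (c := c)
    (by simp [hθ, hφ, hy]) (by simp [hθ₁, hφ₁]; field_simp) x
  simpa only [lin_u, lin_u₁, zero_mul, add_zero] using this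

/-- For non-real `z`, every real boundary condition is satisfied by a solution of finite energy. -/
theorem exists_finAt_of_real [Nonempty X] (hS : S.PPos) (hz : z - star z ≠ 0) {θ φ : Sol S z}
    (hθ : θ.u c = 1) (hθ₁ : θ.u₁ c = 0) (hφ : φ.u c = 0) (hφ₁ : φ.u₁ c = 1) (v : Elt S)
    (hv : v.FinAt d c) (hvt : ∀ x, star (v.t x) = v.t x) (hvf : ∀ x, star (v.f₁ x) = v.f₁ x)
    (hne : ∀ᶠ x in endF d, v.t x ≠ 0 ∨ v.f₁ x ≠ 0) :
    ∃ μ : ℂ, (lin 1 μ θ φ).FinAt d ∧ Tendsto ((lin 1 μ θ φ).elt.V v) (endF d) (𝓝 0) := by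
  have hz0 : z ≠ 0 := by rintro rfl; simp at hz
  obtain ⟨xs, hxs, hp⟩ := exists_seq_endF d ((eventually_beyond_ne d c).and hne)
  -- At `xs n` the boundary vector of `y n` is that of `v`. Since `v` is real, not only `V(y, v)`
  -- but also `V(y, y*)` vanishes there.
  choose y hy hy₁ using fun n => exists_sol S z (xs n) (v.t (xs n) / z) (v.f₁ (xs n))
  have hVv : ∀ n, (y n).elt.V v (xs n) = 0 := by
    intro n; simp only [Elt.V, elt, hy, hy₁]; field_simp; ring
  have hVy : ∀ n, (y n).elt.V (y n).conj.elt (xs n) = 0 := by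
    intro n
    have hz' : star z ≠ 0 := by simpa using hz0
    have : star (v.t (xs n) / z) = v.t (xs n) / star z := by rw [star_div₀, hvt]
    simp only [Elt.V, elt, conj, hy, hy₁, this, hvf]; field_simp; ring
  -- Otherwise both boundary terms of the energy identity on the segment vanish, so `y n` has zero
  -- energy and is trivial.
  have hyc : ∀ n, (y n).u c ≠ 0 := by
    intro n h0
    have h1 := (y n).V_conj_eq (hp n).1.1
    rw [hVy] at h1
    have h2 : (y n).elt.V (y n).conj.elt c = 0 := by simp [Elt.V, elt, conj, h0]
    rw [h2, zero_add] at h1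
    have hsg : sg d ≠ 0 := fun h => by simpa [h] using sg_mul_sg d
    have h3 : (∫ t in seg d c (xs n), S.en (y n).u (y n).u₁ t ∂S.m) = 0 := by
      exact_mod_cast ((mul_eq_zero.1 ((mul_eq_zero.1 h1.symm).resolve_left hsg)).resolve_left hz)
    have h4 := (y n).eq_zero_of_energy hS (hp n).1.1 (hp n).1.2 h0 h3 (xs n)
    rw [hy, hy₁] at h4
    rcases (hp n).2 with h | h
    · simp [hz0, h] at h4
    · exact h h4.2
  have hnorm := fun n => exists_normalized hθ hθ₁ hφ hφ₁ (y n) (hyc n)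
  set M : ℕ → ℂ := fun n => (y n).u₁ c / (y n).u c with hM
  have hVv' : ∀ n, (lin 1 (M n) θ φ).elt.V v (xs n) = 0 := by
    intro n
    obtain ⟨k, hk⟩ := hnorm n
    have : (lin 1 (M n) θ φ).elt.V v (xs n) = k * (y n).elt.V v (xs n) := by
      simp only [Elt.V, elt_t, elt_f₁]; rw [(hk _).1, (hk _).2]; ring
    rw [this, hVv, mul_zero]
  have hVy' : ∀ n, (lin 1 (M n) θ φ).elt.V (lin 1 (M n) θ φ).conj.elt (xs n) = 0 := by
    intro n
    obtain ⟨k, hk⟩ := hnorm n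
    have : (lin 1 (M n) θ φ).elt.V (lin 1 (M n) θ φ).conj.elt (xs n)
        = k * star k * (y n).elt.V (y n).conj.elt (xs n) := by
      simp only [Elt.V, elt_t, elt_f₁, conj_u, conj_u₁]
      rw [(hk _).1, (hk _).2, star_mul, star_mul]; ring
    rw [this, hVy, mul_zero]
  -- With the boundary term at `xs n` gone, the energy times `z - star z` is up to sign the boundary
  -- term at `c`, which is linear in `M n` and its conjugate.
  have hN : ∀ n, ∫ t in seg d c (xs n), S.en (lin 1 (M n) θ φ).u (lin 1 (M n) θ φ).u₁ t ∂S.m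
      ≤ 2 * ‖z‖ / ‖z - star z‖ * (1 + ‖M n‖) := by
    intro n
    set N := ∫ t in seg d c (xs n), S.en (lin 1 (M n) θ φ).u (lin 1 (M n) θ φ).u₁ t ∂S.m with hNdef
    have hN0 : 0 ≤ N := energy_seg_nonneg _ d c _
    have h1 := (lin 1 (M n) θ φ).V_conj_eq (hp n).1.1
    rw [hVy', ← hNdef] at h1
    have h2 : (lin 1 (M n) θ φ).elt.V (lin 1 (M n) θ φ).conj.elt c
        = z * star (M n) - M n * star z := by
      simp [Elt.V, hθ, hθ₁, hφ, hφ₁]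
    rw [h2] at h1
    have h3 : sg d * ((z - star z) * (N : ℂ)) = M n * star z - z * star (M n) := by
      linear_combination -h1
    have h4 := congrArg norm h3
    rw [norm_mul, norm_sg, one_mul, norm_mul, Complex.norm_real, Real.norm_of_nonneg hN0] at h4
    have h5 : ‖M n * star z - z * star (M n)‖ ≤ 2 * ‖z‖ * ‖M n‖ := by
      refine (norm_sub_le _ _).trans_eq ?_
      rw [norm_mul, norm_mul, norm_star, norm_star]; ring
    have hpos : 0 < ‖z - star z‖ := norm_pos_iff.2 hz
    rw [div_mul_eq_mul_div, le_div_iff₀ hpos]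
    nlinarith [norm_nonneg z]
  obtain ⟨x₀, hx₀, hx₀'⟩ := (eventually_beyond_ne d c).exists
  obtain ⟨μ, σ, hσ, hμ, hfin, hlim⟩ := exists_limit θ φ hxs hN hx₀
    (φ.energy_seg_pos hS hx₀ hx₀' hφ (by rw [hφ₁]; exact one_ne_zero))
  refine ⟨μ, hfin, ?_⟩
  have l1 := hlim v.f v.f₁ v.prim hv.f
  have l2 := hlim v.t v.t₁ v.primt hv.t
  have hLeq : ∀ (s : Sol S z) t, s.elt.L v t
      = z * S.bil v.f v.f₁ s.u s.u₁ t - S.bil v.t v.t₁ s.u s.u₁ t := by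
    intro s t; simp only [Elt.L, System.bil, elt]; ring
  have hgen : ∀ s : Sol S z, ∀ J, IntegrableOn (S.en s.u s.u₁) J S.m →
      IntegrableOn (S.en v.f v.f₁) J S.m → IntegrableOn (S.en v.t v.t₁) J S.m →
      ∫ t in J, s.elt.L v t ∂S.m = z * (∫ t in J, S.bil v.f v.f₁ s.u s.u₁ t ∂S.m)
        - ∫ t in J, S.bil v.t v.t₁ s.u s.u₁ t ∂S.m := by
    intro s J hs h1 h2
    rw [← integral_const_mul, ← integral_sub ((System.integrableOn_bil v.prim s.prim h1 hs).const_mul z)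
      (System.integrableOn_bil v.primt s.prim h2 hs)]
    congr 1; ext t; exact hLeq s t
  set u := lin 1 μ θ φ with hu
  have huV := (u.elt.prim_V v).tendsto ((hfin.elt c).integrableOn_L hv)
  rw [hgen u _ (hfin c) hv.f hv.t] at huV
  have hVc : ∀ m : ℂ, (lin 1 m θ φ).elt.V v c = z * v.f₁ c - m * v.t c := by
    intro m; simp [Elt.V, hθ, hθ₁, hφ, hφ₁]
  -- Each value, which is zero, is written as the value at `c` plus an integral of the Lagrange
  -- density. By compactness both parts converge, and the sum of their limits is the limit of `V(u,
  -- v)` at the endpoint.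
  have hseq : Tendsto (fun n => (lin 1 (M (σ n)) θ φ).elt.V v (xs (σ n))) atTop
      (𝓝 (u.elt.V v c + sg d * (z * (∫ t in tail d c, S.bil v.f v.f₁ u.u u.u₁ t ∂S.m)
        - ∫ t in tail d c, S.bil v.t v.t₁ u.u u.u₁ t ∂S.m))) := by
    have h0 : Tendsto (fun n => (lin 1 (M (σ n)) θ φ).elt.V v c) atTop (𝓝 (u.elt.V v c)) := by
      simp only [hu, hVc]
      exact tendsto_const_nhds.sub (hμ.mul_const _)
    refine (h0.add (((l1.const_mul z).sub l2).const_mul (sg d))).congr fun n => ?_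
    have hs : ∀ {f f₁ : X → ℂ}, IntegrableOn (S.en f f₁) (tail d c) S.m →
        IntegrableOn (S.en f f₁) (seg d c (xs (σ n))) S.m := fun h =>
      h.mono_set (seg_subset_tail d c _)
    rw [((lin 1 (M (σ n)) θ φ).elt.prim_V v).seg_eq (hp (σ n)).1.1,
      hgen _ _ (integrableOn_seg (integrableOn_en_Ico _) d c _) (hs hv.f) (hs hv.t)]
  simp only [hVv'] at hseq
  rwa [tendsto_nhds_unique tendsto_const_nhds hseq]

/-- The solutions of `τ u = 0` that are principal at an endpoint. -/
theorem exists_principal [Nonempty X] (hS : S.PPos) (d : Bool) :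
    ∃ w : Sol S 0, (∃ x, w.u x ≠ 0) ∧ (∀ x, (w.u x).im = 0) ∧ w.FinAt d ∧
      ∀ g g₁ : X → ℂ, Prim S.m g (fun s => S.p s * g₁ s) → Integrable (S.en g g₁) S.m →
        Tendsto (fun x => g x * w.u₁ x) (endF d) (𝓝 0) := by
  obtain ⟨c⟩ := ‹Nonempty X›
  have : Nonempty X := ⟨c⟩
  obtain ⟨θ, hθ, hθ₁⟩ := exists_sol S 0 c 1 0
  obtain ⟨φ, hφ, hφ₁⟩ := exists_sol S 0 c 0 1
  obtain ⟨xs, hxs, hp⟩ := exists_seq_endF d (eventually_beyond_ne d c)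
  -- The quasi-derivative of `y n` vanishes at `xs n`. This Neumann condition is what becomes `g
  -- w^[1] → 0` in the limit.
  choose y hy hy₁ using fun n => exists_sol S 0 (xs n) 1 0
  have hprim : ∀ (s : Sol S 0) {g g₁ : X → ℂ}, Prim S.m g (fun s => S.p s * g₁ s) →
      Prim S.m (fun x => g x * s.u₁ x) (S.bil g g₁ s.u s.u₁) := by
    intro s g g₁ hg
    refine (hg.mul s.prim₁ fun x => atom 0 x _ _).of_eq (fun _ => rfl) fun x => ?_
    simp only [System.bil]; ring
  have hen : ∀ (s : Sol S 0) x, Beyond d c x → star (s.u x) * s.u₁ x = star (s.u c) * s.u₁ c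
      + sg d * (∫ t in seg d c x, S.en s.u s.u₁ t ∂S.m : ℝ) := by
    intro s x hx
    have := (hprim s s.conj.prim).seg_eq hx
    rw [← integral_complex_ofReal]
    refine this.trans ?_
    congr 3; ext t
    have h : ∀ a : ℂ, (‖a‖ : ℂ) ^ 2 = a * star a := fun a => (Complex.mul_conj' a).symm
    simp only [System.bil, System.en, conj]
    push_cast
    rw [h, h]; ring
  have hsg : sg d ≠ 0 := fun h => by simpa [h] using sg_mul_sg d
  have hyc : ∀ n, (y n).u c ≠ 0 := by
    intro n h0
    have h1 := hen (y n) (xs n) (hp n).1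
    rw [hy₁, h0, mul_zero, star_zero, zero_mul, zero_add] at h1
    have h3 : (∫ t in seg d c (xs n), S.en (y n).u (y n).u₁ t ∂S.m) = 0 := by
      simpa [hsg] using h1.symm
    have h4 := (y n).eq_zero_of_energy hS (hp n).1 (hp n).2 h0 h3 (xs n)
    rw [hy] at h4
    exact one_ne_zero h4.1
  set M : ℕ → ℂ := fun n => (y n).u₁ c / (y n).u c with hM
  have hu₁ : ∀ n, (lin 1 (M n) θ φ).u₁ (xs n) = 0 := by
    intro n
    obtain ⟨k, hk⟩ := exists_normalized hθ hθ₁ hφ hφ₁ (y n) (hyc n)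
    rw [(hk _).2, hy₁, mul_zero]
  -- For the parameter `0` the increment of `star u * u₁` is the energy itself. Hence `M n` is real
  -- and its modulus equals the energy.
  have hMN : ∀ n, M n = -(sg d *
      (∫ t in seg d c (xs n), S.en (lin 1 (M n) θ φ).u (lin 1 (M n) θ φ).u₁ t ∂S.m : ℝ)) := by
    intro n
    have h1 := hen (lin 1 (M n) θ φ) (xs n) (hp n).1
    have h2 : star ((lin 1 (M n) θ φ).u c) * (lin 1 (M n) θ φ).u₁ c = M n := by
      simp [hθ, hθ₁, hφ, hφ₁]
    rw [hu₁, mul_zero, h2] at h1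
    linear_combination -h1
  have hN : ∀ n, ∫ t in seg d c (xs n), S.en (lin 1 (M n) θ φ).u (lin 1 (M n) θ φ).u₁ t ∂S.m
      ≤ 1 * (1 + ‖M n‖) := by
    intro n
    have h := congrArg norm (hMN n)
    rw [norm_neg, norm_mul, norm_sg, one_mul, Complex.norm_real,
      Real.norm_of_nonneg (energy_seg_nonneg _ d c _)] at h
    linarith
  have hMim : ∀ n, (M n).im = 0 := by
    intro n
    rw [hMN n]
    cases d <;> simp [sg]
  obtain ⟨x₀, hx₀, hx₀'⟩ := (eventually_beyond_ne d c).exists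
  obtain ⟨μ, σ, hσ, hμ, hfin, hlim⟩ := exists_limit θ φ hxs hN hx₀
    (φ.energy_seg_pos hS hx₀ hx₀' hφ (by rw [hφ₁]; exact one_ne_zero))
  have hμim : μ.im = 0 := by
    have h1 := (Complex.continuous_im.tendsto μ).comp hμ
    have h2 : (Complex.im ∘ fun n => M (σ n)) = fun _ => 0 := funext fun n => hMim _
    rw [h2] at h1
    exact (tendsto_nhds_unique tendsto_const_nhds h1).symm
  refine ⟨lin 1 μ θ φ, ⟨c, by simp [hθ, hφ]⟩, fun x => ?_, hfin, fun g g₁ hg hgi => ?_⟩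
  · have h := real_of_real (star_zero ℂ) (lin 1 μ θ φ) (c := c) (by simp [hθ, hφ])
      (by simpa [hθ₁, hφ₁] using Complex.conj_eq_iff_im.2 hμim) x
    exact Complex.conj_eq_iff_im.1 h.1
  · have l1 := hlim g g₁ hg hgi.integrableOn
    have l2 := (hprim (lin 1 μ θ φ) hg).tendsto
      (System.integrableOn_bil hg (lin 1 μ θ φ).prim hgi.integrableOn (hfin c))
    have hc : ∀ m : ℂ, (lin 1 m θ φ).u₁ c = m := by intro m; simp [hθ₁, hφ₁]
    have l3 : Tendsto (fun n => g (xs (σ n)) * (lin 1 (M (σ n)) θ φ).u₁ (xs (σ n))) atTop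
        (𝓝 (g c * (lin 1 μ θ φ).u₁ c + sg d *
          ∫ t in tail d c, S.bil g g₁ (lin 1 μ θ φ).u (lin 1 μ θ φ).u₁ t ∂S.m)) := by
      rw [hc]
      refine ((hμ.const_mul (g c)).add (l1.const_mul (sg d))).congr fun n => ?_
      rw [(hprim (lin 1 (M (σ n)) θ φ) hg).seg_eq (hp (σ n)).1, hc]
    simp only [hu₁, mul_zero] at l3
    rwa [tendsto_nhds_unique l3 tendsto_const_nhds] at l2

/-- The limit-point argument: if a solution for a non-real parameter has finite energy and trivial
boundary values, then all boundary values are trivial. -/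
theorem tendsto_V_of_trivial [Nonempty X] (hz : z - star z ≠ 0) {u : Sol S z}
    (hu : u.FinAt d) (hu0 : u.u c ≠ 0) (huu : Tendsto (u.elt.V u.conj.elt) (endF d) (𝓝 0))
    {P Q : Elt S} (hP : P.FinAt d c) (hQ : Q.FinAt d c)
    (hPu : Tendsto (P.V u.elt) (endF d) (𝓝 0)) (hQu : Tendsto (Q.V u.elt) (endF d) (𝓝 0)) :
    Tendsto (P.V Q) (endF d) (𝓝 0) := by
  have hz0 : z ≠ 0 := by rintro rfl; simp at hz
  obtain ⟨θ, hθ, hθ₁⟩ := exists_sol S z c 0 1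
  set κ : ℂ := z * u.u c with hκ
  have hκ0 : κ ≠ 0 := mul_ne_zero hz0 hu0
  have hVuθ : ∀ x, u.elt.V θ.elt x = κ := by
    intro x
    have h := u.wronskian_const θ x c
    rw [hθ, hθ₁] at h
    simp only [Elt.V, elt]
    linear_combination z * h
  set w := z - star z with hw
  let A : X → ℝ := fun x => ∫ t in tail d x, S.en u.u u.u₁ t ∂S.m
  let B : X → ℝ := fun x => ∫ t in seg d c x, S.en θ.u θ.u₁ t ∂S.m
  have hA0 : ∀ x, 0 ≤ A x := fun x => integral_nonneg (S.en_nonneg _ _)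
  have hB0 : ∀ x, 0 ≤ B x := fun x => θ.energy_seg_nonneg d c x
  have hwpos : 0 < ‖w‖ ^ 2 := by positivity
  -- The Plücker relation for `u`, `u*`, `θ`, `θ*`: there `V(u, u*)` is a multiple of the energy `A
  -- x` of `u` beyond `x`, since it vanishes at the endpoint, and `V(θ, θ*)` a multiple of the
  -- energy `B x` of `θ` up to `x`, since it vanishes at `c`. The growth of `θ` is thus compensated
  -- by the decay of `u`.
  have hAB : ∀ x, Beyond d c x → A x * B x ≤ ‖κ‖ ^ 2 / ‖w‖ ^ 2 := by
    intro x hx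
    have e1 : u.elt.V u.conj.elt x = -(sg d * (w * (A x : ℂ))) := by
      have hi : IntegrableOn (fun t => w * (S.en u.u u.u₁ t : ℂ)) (tail d x) S.m :=
        (hu x).ofReal.const_mul w
      rw [u.prim_V_conj.eq_of_tendsto hi huu, integral_const_mul, integral_complex_ofReal]; ring
    have e2 : θ.elt.V θ.conj.elt x = sg d * (w * (B x : ℂ)) := by
      have : θ.elt.V θ.conj.elt c = 0 := by simp [Elt.V, hθ]
      rw [θ.V_conj_eq hx, this, zero_add]
    have e3 := Elt.V_plucker u.elt u.conj.elt θ.elt θ.conj.elt x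
    have e4 : u.conj.elt.V θ.conj.elt x = star κ := by
      rw [← hVuθ x]; simp [Elt.V]
    have e5 : u.conj.elt.V θ.elt x = star (u.elt.V θ.conj.elt x) := by simp [Elt.V]
    rw [e1, e2, e4, e5, hVuθ] at e3
    have hww : star w = -w := by simp [hw]
    have h : ∀ a : ℂ, a * star a = (‖a‖ : ℂ) ^ 2 := fun a => Complex.mul_conj' a
    have h6 : (‖w‖ : ℂ) ^ 2 = -(w * w) := by rw [← h, hww]; ring
    have h7 : ((‖w‖ ^ 2 * (A x * B x) : ℝ) : ℂ)
        = ((‖κ‖ ^ 2 - ‖u.elt.V θ.conj.elt x‖ ^ 2 : ℝ) : ℂ) := by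
      push_cast
      rw [h6, ← h, ← h]
      linear_combination e3 + (w * w * A x * B x) * sg_mul_sg d
    have h8 : ‖w‖ ^ 2 * (A x * B x) = ‖κ‖ ^ 2 - ‖u.elt.V θ.conj.elt x‖ ^ 2 := by exact_mod_cast h7
    rw [le_div_iff₀ hwpos]
    nlinarith [sq_nonneg ‖u.elt.V θ.conj.elt x‖]
  -- `V(P, u)` is `o(√A)`, as it vanishes at the endpoint, while `V(Q, θ)` is `O(1 + √B)`; the bound
  -- on `A * B` makes the product small. The Lagrange densities involve only `P.t - z P.f` and `Q.t
  -- - z Q.f`.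
  have key : ∀ P Q : Elt S, P.FinAt d c → Q.FinAt d c → Tendsto (P.V u.elt) (endF d) (𝓝 0) →
      Tendsto (fun x => P.V u.elt x * Q.V θ.elt x) (endF d) (𝓝 0) := by
    intro P Q hP hQ hPu
    have hdiff : ∀ {P : Elt S}, P.FinAt d c → Prim S.m (fun x => 1 * P.t x + -z * P.f x)
        (fun s => S.p s * (1 * P.t₁ s + -z * P.f₁ s)) ∧
        IntegrableOn (S.en (fun x => 1 * P.t x + -z * P.f x)
          (fun x => 1 * P.t₁ x + -z * P.f₁ x)) (tail d c) S.m := fun {P} hP =>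
      ⟨((P.primt.const_mul 1).add (P.prim.const_mul (-z))).of_eq (fun _ => rfl) fun _ => by ring,
        System.integrableOn_en_lin P.primt P.prim hP.t hP.f 1 (-z)⟩
    have hL : ∀ (P : Elt S) (s : Sol S z) x, P.L s.elt x = S.bil (fun x => 1 * P.t x + -z * P.f x)
        (fun x => 1 * P.t₁ x + -z * P.f₁ x) s.u s.u₁ x := by
      intro P s x; simp only [Elt.L, System.bil, elt]; ring
    obtain ⟨p1, i1⟩ := hdiff hP
    obtain ⟨p2, i2⟩ := hdiff hQ
    set H := S.en (fun x => 1 * P.t x + -z * P.f x) (fun x => 1 * P.t₁ x + -z * P.f₁ x) with hH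
    set K := S.en (fun x => 1 * Q.t x + -z * Q.f x) (fun x => 1 * Q.t₁ x + -z * Q.f₁ x) with hK
    set KI := ∫ t in tail d c, K t ∂S.m
    have hlim : Tendsto (fun x => √(∫ t in tail d x, H t ∂S.m) *
        (√(A c) * ‖Q.V θ.elt c‖ + √KI * √(‖κ‖ ^ 2 / ‖w‖ ^ 2))) (endF d) (𝓝 0) := by
      have h := (tendsto_integral_tail i1).sqrt.mul_const
        (√(A c) * ‖Q.V θ.elt c‖ + √KI * √(‖κ‖ ^ 2 / ‖w‖ ^ 2))
      rwa [Real.sqrt_zero, zero_mul] at h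
    refine squeeze_zero_norm' ?_ hlim
    filter_upwards [eventually_beyond d c] with x hx
    have f1 : ‖P.V u.elt x‖ ≤ √(∫ t in tail d x, H t ∂S.m) * √(A x) := by
      rw [(P.prim_V u.elt).eq_of_tendsto ((hP.mono hx).integrableOn_L (hu.elt x)) hPu, zero_sub,
        norm_neg, norm_mul, norm_sg, one_mul, funext (hL P u)]
      exact System.norm_integral_bil_le p1 u.prim (i1.mono_set hx.tail_subset) (hu x)
    have f2 : ‖Q.V θ.elt x‖ ≤ ‖Q.V θ.elt c‖ + √KI * √(B x) := by
      rw [(Q.prim_V θ.elt).seg_eq hx, funext (hL Q θ)]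
      refine (norm_add_le _ _).trans ?_
      rw [norm_mul, norm_sg, one_mul]
      refine add_le_add le_rfl ((System.norm_integral_bil_le p2 θ.prim
        (i2.mono_set (seg_subset_tail d c x)) (integrableOn_seg θ.integrableOn_en_Ico d c x)).trans ?_)
      have := setIntegral_mono_set i2 (Eventually.of_forall (S.en_nonneg _ _))
        (seg_subset_tail d c x).eventuallyLE
      exact mul_le_mul_of_nonneg_right (Real.sqrt_le_sqrt this) (Real.sqrt_nonneg _)
    have f3 : √(A x) ≤ √(A c) := Real.sqrt_le_sqrt (setIntegral_mono_set (hu c)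
      (Eventually.of_forall (S.en_nonneg _ _)) hx.tail_subset.eventuallyLE)
    have f4 : √(A x) * √(B x) ≤ √(‖κ‖ ^ 2 / ‖w‖ ^ 2) := by
      rw [← Real.sqrt_mul (hA0 x)]; exact Real.sqrt_le_sqrt (hAB x hx)
    rw [norm_mul]
    calc ‖P.V u.elt x‖ * ‖Q.V θ.elt x‖ ≤ (√(∫ t in tail d x, H t ∂S.m) * √(A x)) *
          (‖Q.V θ.elt c‖ + √KI * √(B x)) := by gcongr
      _ = √(∫ t in tail d x, H t ∂S.m) * (√(A x) * ‖Q.V θ.elt c‖ + √KI * (√(A x) * √(B x))) := by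
        ring
      _ ≤ _ := by gcongr
  have h1 := ((key P Q hP hQ hPu).sub (key Q P hQ hP hQu)).div_const κ
  rw [sub_zero, zero_div] at h1
  refine h1.congr fun x => ?_
  have h2 := Elt.V_plucker P Q u.elt θ.elt x
  rw [hVuθ] at h2
  rw [div_eq_iff hκ0]
  linear_combination -h2

end Sol

/-- If not all solutions have finite energy near an endpoint, then the modified Wronskian vanishes
at this endpoint for real pairs. -/
theorem Elt.tendsto_V_of_real [Nonempty X] (hS : S.PPos) (hz : z - star z ≠ 0)
    (hnot : ¬ ∀ s : Sol S z, s.FinAt d) {P Q : Elt S} (hP : P.FinAt d c) (hQ : Q.FinAt d c)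
    (hPt : ∀ x, star (P.t x) = P.t x) (hPf : ∀ x, star (P.f₁ x) = P.f₁ x)
    (hQt : ∀ x, star (Q.t x) = Q.t x) (hQf : ∀ x, star (Q.f₁ x) = Q.f₁ x) :
    Tendsto (P.V Q) (endF d) (𝓝 0) := by
  obtain ⟨l, hl⟩ := hP.exists_tendsto_V hQ
  by_cases hl0 : l = 0
  · rwa [hl0] at hl
  exfalso
  obtain ⟨θ, hθ, hθ₁⟩ := exists_sol S z c 1 0
  obtain ⟨φ, hφ, hφ₁⟩ := exists_sol S z c 0 1
  have hne := hl.eventually_ne hl0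
  -- If `V(P, Q)` has a non-zero limit, `P` and `Q` both define real boundary conditions, each with
  -- a Weyl solution of finite energy.
  obtain ⟨μ, hμ, hμV⟩ := Sol.exists_finAt_of_real hS hz hθ hθ₁ hφ hφ₁ P hP hPt hPf (by
    filter_upwards [hne] with x hx
    by_contra! h
    exact hx (by simp [Elt.V, h.1, h.2]))
  obtain ⟨ν, hν, hνV⟩ := Sol.exists_finAt_of_real hS hz hθ hθ₁ hφ hφ₁ Q hQ hQt hQf (by
    filter_upwards [hne] with x hx
    by_contra! h
    exact hx (by simp [Elt.V, h.1, h.2]))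
  -- A common Weyl solution `u` satisfies both conditions, hence has trivial boundary form `V(u,
  -- u*)`, and `Sol.tendsto_V_of_trivial` gives `V(P, Q) → 0`. Two different ones are independent,
  -- so all solutions would have finite energy.
  by_cases hμν : μ = ν
  · rw [← hμν] at hνV
    set u := Sol.lin 1 μ θ φ with hu
    have swap : ∀ {P Q : Elt S} {l : ℂ}, Tendsto (P.V Q) (endF d) (𝓝 l) →
        Tendsto (Q.V P) (endF d) (𝓝 (-l)) := fun {P Q l} h => by
      refine h.neg.congr fun x => ?_
      rw [P.V_swap Q]; ring
    have hc : Tendsto (u.conj.elt.V P) (endF d) (𝓝 0) := by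
      have h := (continuous_star.tendsto (0 : ℂ)).comp hμV
      rw [star_zero] at h
      refine h.congr fun x => ?_
      simp only [Function.comp, Elt.V, Sol.elt, Sol.conj, star_sub, star_mul, hPt, hPf]; ring
    have huu := Elt.tendsto_V_of_tendsto (hμ.elt c) (hμ.conj.elt c) hQ hμV hc
      (neg_ne_zero.2 hl0) (swap hl)
    have := Sol.tendsto_V_of_trivial hz hμ (c := c) (by simp [hu, hθ, hφ]) huu hP hQ
      (by simpa using swap hμV) (by simpa using swap hνV)
    exact hl0 (tendsto_nhds_unique hl this)
  · refine hnot (Sol.finAt_of_independent (c := c) hμ hν ?_)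
    simp only [Sol.lin_u, Sol.lin_u₁, hθ, hθ₁, hφ, hφ₁]
    intro h
    exact hμν (by linear_combination -h)

/-- If not all solutions have finite energy near an endpoint, then the modified Wronskian vanishes
at this endpoint. -/
theorem Elt.tendsto_V [Nonempty X] (hS : S.PPos) (hz : z - star z ≠ 0)
    (hnot : ¬ ∀ s : Sol S z, s.FinAt d) {P Q : Elt S} (hP : P.FinAt d c) (hQ : Q.FinAt d c) :
    Tendsto (P.V Q) (endF d) (𝓝 0) := by
  -- With coefficients `1, 1` and `I, -I` these combinations are real: twice the real part and minus
  -- twice the imaginary part. `V` is bilinear, so the real case suffices; the factor `4` below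
  -- collects the two factors `2`.
  have key : ∀ a b : ℂ, star a = b → ∀ a' b' : ℂ, star a' = b' →
      Tendsto ((Elt.lin a b P P.conj).V (Elt.lin a' b' Q Q.conj)) (endF d) (𝓝 0) := by
    rintro a _ rfl a' _ rfl
    refine Elt.tendsto_V_of_real hS hz hnot (hP.lin hP.conj _ _) (hQ.lin hQ.conj _ _) ?_ ?_ ?_ ?_
    all_goals intro x; simp; ring
  have i1 : star Complex.I = -Complex.I := by simp
  have h := (((key 1 1 (by simp) 1 1 (by simp)).sub
    ((key 1 1 (by simp) Complex.I (-Complex.I) i1).const_mul Complex.I)).sub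
    ((key Complex.I (-Complex.I) i1 1 1 (by simp)).const_mul Complex.I)).sub
    (key Complex.I (-Complex.I) i1 Complex.I (-Complex.I) i1)
  have h' := h.div_const 4
  simp only [mul_zero, sub_zero, zero_div] at h'
  refine h'.congr fun x => ?_
  simp only [Elt.V, Elt.lin, Elt.conj]
  ring_nf
  simp only [Complex.I_sq]
  ring

/-- Weyl's alternative. -/
theorem weyl_alternative [Nonempty X] (hS : S.PPos) (d : Bool) :
    (∀ z : ℂ, z ≠ 0 → ∀ s : Sol S z, s.FinAt d) ∨
      ((∀ z : ℂ, z ≠ 0 → ∃ s : Sol S z, ¬ s.FinAt d) ∧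
        ∀ (c : X) (P Q : Elt S), P.FinAt d c → Q.FinAt d c →
          Tendsto (P.V Q) (endF d) (𝓝 0)) := by
  by_cases h : ∃ z₀ : ℂ, z₀ ≠ 0 ∧ ∀ s : Sol S z₀, s.FinAt d
  · obtain ⟨z₀, hz₀, h⟩ := h
    exact Or.inl fun z hz s => s.finAt_of_forall hz₀ hz h
  · push Not at h
    have hI : Complex.I - star Complex.I ≠ 0 := by
      intro h
      have := congrArg Complex.im h
      norm_num at this
    refine Or.inr ⟨h, fun c P Q hP hQ => Elt.tendsto_V hS hI ?_ hP hQ⟩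
    push Not
    exact h _ Complex.I_ne_zero

end MeasureSL

namespace LeftDefinite

open MeasureSL
open scoped NNReal

/-! ### Order and topology of the interval `(a, b)`. -/

section IntervalInstances

variable {a b : EReal}

theorem ordConnected_interval (a b : EReal) :
    OrdConnected {x : ℝ | a < (x : EReal) ∧ (x : EReal) < b} :=
  ⟨fun _ hx _ hy _ hz => ⟨hx.1.trans_le (EReal.coe_le_coe_iff.2 hz.1),
    (EReal.coe_le_coe_iff.2 hz.2).trans_lt hy.2⟩⟩

instance instOrderTopologyInterval : OrderTopology (Interval a b) :=
  @orderTopology_of_ordConnected ℝ _ _ _ _ (ordConnected_interval a b)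

instance instDenselyOrderedInterval : DenselyOrdered (Interval a b) :=
  ⟨fun x y h => by
    obtain ⟨z, h1, h2⟩ := exists_between (show x.1 < y.1 from h)
    exact ⟨⟨z, (ordConnected_interval a b).out x.2 y.2 ⟨h1.le, h2.le⟩⟩, h1, h2⟩⟩

instance instNoMaxOrderInterval : NoMaxOrder (Interval a b) :=
  ⟨fun x => by
    obtain ⟨z, h1, h2⟩ := EReal.lt_iff_exists_real_btwn.1 x.2.2
    exact ⟨⟨z, x.2.1.trans h1, h2⟩, EReal.coe_lt_coe_iff.1 h1⟩⟩

instance instNoMinOrderInterval : NoMinOrder (Interval a b) :=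
  ⟨fun x => by
    obtain ⟨z, h1, h2⟩ := EReal.lt_iff_exists_real_btwn.1 x.2.1
    exact ⟨⟨z, h1, h2.trans x.2.2⟩, EReal.coe_lt_coe_iff.1 h2⟩⟩

instance instCompactIccSpaceInterval : CompactIccSpace (Interval a b) :=
  ⟨fun {x y} => by
    rw [Subtype.isCompact_iff]
    have : (Subtype.val '' Icc x y : Set ℝ) = Icc x.1 y.1 := by
      ext t
      constructor
      · rintro ⟨s, hs, rfl⟩; exact hs
      · intro ht
        exact ⟨⟨t, (ordConnected_interval a b).out x.2 y.2 ht⟩, ht, rfl⟩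
    rw [this]; exact isCompact_Icc⟩

end IntervalInstances

/-! ### Bounded densities relative to a dominating measure. -/

section Density

variable {X : Type*} [MeasurableSpace X]

/-- The Radon–Nikodym derivative is at most `1` only almost everywhere. Truncation at `1` alters it
on a null set and gives the pointwise bound that the Volterra theorem needs. -/
theorem exists_density {μ m : Measure X} [SigmaFinite m] [SigmaFinite μ] (h : μ ≤ m) :
    ∃ p : X → ℝ≥0, Measurable p ∧ (∀ x, p x ≤ 1) ∧ μ = m.withDensity fun x => p x := by
  refine ⟨fun x => min (μ.rnDeriv m x).toNNReal 1,
    (Measure.measurable_rnDeriv μ m).ennreal_toNNReal.min measurable_const,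
    fun x => min_le_right _ _, ?_⟩
  conv_lhs => rw [← Measure.withDensity_rnDeriv_eq μ m (Measure.absolutelyContinuous_of_le h)]
  refine withDensity_congr_ae ?_
  filter_upwards [Measure.rnDeriv_le_one_of_le h] with x hx
  have hx' : μ.rnDeriv m x ≤ 1 := hx
  have hne : μ.rnDeriv m x ≠ ⊤ := (hx'.trans_lt ENNReal.one_lt_top).ne
  rw [min_eq_left, ENNReal.coe_toNNReal hne]
  exact ENNReal.toNNReal_mono ENNReal.one_ne_top hx'

theorem integrableOn_withDensity_iff {m : Measure X} {p : X → ℝ≥0} (hp : Measurable p)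
    {s : Set X} (hs : MeasurableSet s) {f : X → ℂ} :
    IntegrableOn f s (m.withDensity fun x => p x)
      ↔ IntegrableOn (fun x => ((p x : ℝ) : ℂ) * f x) s m := by
  rw [IntegrableOn, restrict_withDensity hs, integrable_withDensity_iff_integrable_smul hp]
  simp only [NNReal.smul_def, Complex.real_smul]
  rfl

theorem setIntegral_withDensity {m : Measure X} {p : X → ℝ≥0} (hp : Measurable p)
    {s : Set X} (hs : MeasurableSet s) (f : X → ℂ) :
    ∫ x in s, f x ∂(m.withDensity fun x => p x) = ∫ x in s, ((p x : ℝ) : ℂ) * f x ∂m := by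
  rw [setIntegral_withDensity_eq_setIntegral_smul hp f hs]
  simp only [NNReal.smul_def, Complex.real_smul]

theorem withDensity_singleton [MeasurableSingletonClass X] {m : Measure X} {p : X → ℝ≥0} (x : X) :
    (m.withDensity fun x => (p x : ENNReal)) {x} = p x * m {x} := by
  rw [withDensity_apply _ (measurableSet_singleton x), lintegral_singleton]

theorem mul_mul_real_singleton [MeasurableSingletonClass X] {m : Measure X} {p q : X → ℝ≥0} {x : X}
    (h : (m.withDensity fun x => (p x : ENNReal)) {x}
      * (m.withDensity fun x => (q x : ENNReal)) {x} = 0) :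
    (p x : ℝ) * q x * m.real {x} = 0 := by
  rw [withDensity_singleton, withDensity_singleton] at h
  rcases mul_eq_zero.1 h with h | h <;> rcases mul_eq_zero.1 h with h | h
  · simp [ENNReal.coe_eq_zero.1 h]
  · simp [measureReal_def, h]
  · simp [ENNReal.coe_eq_zero.1 h]
  · simp [measureReal_def, h]

end Density

/-! ### Oriented integrals and `AC_loc` in terms of primitives. -/

section RNDeriv

variable {a b : EReal} {μ : Measure (Interval a b)} {f h : Interval a b → ℂ}

theorem integrableOn_Ico_of_locallyIntegrable (hh : LocallyIntegrable h μ) (x y : Interval a b) :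
    IntegrableOn h (Ico x y) μ :=
  (hh.integrableOn_isCompact isCompact_Icc).mono_set Ico_subset_Icc_self

theorem locallyIntegrable_of_integrableOn_Ico (hh : ∀ x y, IntegrableOn h (Ico x y) μ) :
    LocallyIntegrable h μ := by
  intro x
  obtain ⟨y, hy⟩ := exists_lt x
  obtain ⟨w, hw⟩ := exists_gt x
  exact ⟨Ico y w, Ico_mem_nhds hy hw, hh y w⟩

theorem orientedInt_of_le {c x : Interval a b} (hx : c ≤ x) :
    orientedInt μ h c x = ∫ s in Ico c x, h s ∂μ := if_pos hx

theorem orientedInt_of_ge {c x : Interval a b} (hx : x ≤ c) :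
    orientedInt μ h c x = -∫ s in Ico x c, h s ∂μ := by
  rcases hx.eq_or_lt with rfl | hx
  · simp [orientedInt]
  · exact if_neg (not_le.2 hx)

theorem prim_orientedInt (hh : ∀ x y, IntegrableOn h (Ico x y) μ) (c : Interval a b) :
    Prim μ (orientedInt μ h c) h := by
  have hadd : ∀ x y w : Interval a b, x ≤ y → y ≤ w →
      ∫ s in Ico x w, h s ∂μ = (∫ s in Ico x y, h s ∂μ) + ∫ s in Ico y w, h s ∂μ := by
    intro x y w hxy hyw
    rw [← Ico_union_Ico_eq_Ico hxy hyw, setIntegral_union (Ico_disjoint_Ico_same) measurableSet_Ico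
      (hh x y) (hh y w)]
  refine ⟨hh, fun x y hxy => ?_⟩
  rcases le_total c x with h1 | h1
  · rw [orientedInt_of_le h1, orientedInt_of_le (h1.trans hxy), hadd c x y h1 hxy]; ring
  · rcases le_total c y with h2 | h2
    · rw [orientedInt_of_ge h1, orientedInt_of_le h2, hadd x c y h1 h2]; ring
    · rw [orientedInt_of_ge h1, orientedInt_of_ge h2, hadd x y c hxy h2]; ring

theorem hasRNDeriv_iff : HasRNDeriv μ f h ↔ Prim μ f h := by
  constructor
  · rintro ⟨hh, hf⟩
    refine ⟨integrableOn_Ico_of_locallyIntegrable hh, fun x y hxy => ?_⟩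
    rw [hf x y, orientedInt_of_le hxy]; ring
  · intro H
    refine ⟨locallyIntegrable_of_integrableOn_Ico H.1, fun c x => ?_⟩
    rcases le_total c x with h1 | h1
    · rw [orientedInt_of_le h1, ← H.2 c x h1]; ring
    · rw [orientedInt_of_ge h1, ← H.2 x c h1]; ring

theorem prim_withDensity_iff {m : Measure (Interval a b)} {p : Interval a b → ℝ≥0}
    (hp : Measurable p) :
    Prim (m.withDensity fun x => p x) f h ↔ Prim m f fun s => ((p s : ℝ) : ℂ) * h s := by
  refine and_congr (forall₂_congr fun x y => integrableOn_withDensity_iff hp measurableSet_Ico)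
    (forall₃_congr fun x y _ => ?_)
  rw [setIntegral_withDensity hp measurableSet_Ico]

end RNDeriv

/-! ### Reduction of the differential expression to the first order system. -/

namespace Coeff

variable {a b : EReal} (D : Coeff a b)

/-- The sum of the coefficient measures. -/
noncomputable def total : Measure (Interval a b) := D.ς + D.χ + (D.ϱ.pos + D.ϱ.neg)

theorem sigmaFinite_of_locallyFinite {μ : Measure (Interval a b)} (h : IsLocallyFiniteMeasure μ) :
    SigmaFinite μ := inferInstance

theorem Ico_lt_top {μ : Measure (Interval a b)} (h : IsLocallyFiniteMeasure μ)
    (x y : Interval a b) : μ (Ico x y) < ⊤ :=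
  (measure_mono Ico_subset_Icc_self).trans_lt isCompact_Icc.measure_lt_top

theorem sigmaFinite_total : SigmaFinite D.total := by
  have := sigmaFinite_of_locallyFinite D.locallyFinite_ς
  have := sigmaFinite_of_locallyFinite D.locallyFinite_χ
  have := sigmaFinite_of_locallyFinite D.ϱ.locallyFinite_pos
  have := sigmaFinite_of_locallyFinite D.ϱ.locallyFinite_neg
  unfold total; infer_instance

theorem total_Ico_lt_top (x y : Interval a b) : D.total (Ico x y) < ⊤ := by
  simp only [total, Measure.add_apply]
  exact ENNReal.add_lt_top.2 ⟨ENNReal.add_lt_top.2 ⟨Ico_lt_top D.locallyFinite_ς x y,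
    Ico_lt_top D.locallyFinite_χ x y⟩, ENNReal.add_lt_top.2
    ⟨Ico_lt_top D.ϱ.locallyFinite_pos x y, Ico_lt_top D.ϱ.locallyFinite_neg x y⟩⟩

theorem exists_density_total {μ : Measure (Interval a b)} (hμ : IsLocallyFiniteMeasure μ)
    (h : μ ≤ D.total) : ∃ p : Interval a b → ℝ≥0, Measurable p ∧ (∀ x, p x ≤ 1) ∧
      μ = D.total.withDensity fun x => p x := by
  have := sigmaFinite_of_locallyFinite hμ
  have := D.sigmaFinite_total
  exact exists_density h

theorem exists_density_ς : ∃ p : Interval a b → ℝ≥0, Measurable p ∧ (∀ x, p x ≤ 1) ∧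
    D.ς = D.total.withDensity fun x => p x :=
  D.exists_density_total D.locallyFinite_ς (by
    rw [total, add_assoc]; exact Measure.le_add_right le_rfl)

theorem exists_density_χ : ∃ p : Interval a b → ℝ≥0, Measurable p ∧ (∀ x, p x ≤ 1) ∧
    D.χ = D.total.withDensity fun x => p x :=
  D.exists_density_total D.locallyFinite_χ
    (Measure.le_add_right (Measure.le_add_left le_rfl))

theorem exists_density_pos : ∃ p : Interval a b → ℝ≥0, Measurable p ∧ (∀ x, p x ≤ 1) ∧
    D.ϱ.pos = D.total.withDensity fun x => p x :=
  D.exists_density_total D.ϱ.locallyFinite_pos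
    (Measure.le_add_left (Measure.le_add_right le_rfl))

theorem exists_density_neg : ∃ p : Interval a b → ℝ≥0, Measurable p ∧ (∀ x, p x ≤ 1) ∧
    D.ϱ.neg = D.total.withDensity fun x => p x :=
  D.exists_density_total D.ϱ.locallyFinite_neg
    (Measure.le_add_left (Measure.le_add_left le_rfl))

/-- The density of `ς`. -/
noncomputable def dς : Interval a b → ℝ≥0 := D.exists_density_ς.choose

/-- The density of `χ`. -/
noncomputable def dχ : Interval a b → ℝ≥0 := D.exists_density_χ.choose

/-- The density of the positive part of `ϱ`. -/
noncomputable def dpos : Interval a b → ℝ≥0 := D.exists_density_pos.choose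

/-- The density of the negative part of `ϱ`. -/
noncomputable def dneg : Interval a b → ℝ≥0 := D.exists_density_neg.choose

theorem ς_eq : D.ς = D.total.withDensity fun x => D.dς x := D.exists_density_ς.choose_spec.2.2
theorem χ_eq : D.χ = D.total.withDensity fun x => D.dχ x := D.exists_density_χ.choose_spec.2.2
theorem pos_eq : D.ϱ.pos = D.total.withDensity fun x => D.dpos x :=
  D.exists_density_pos.choose_spec.2.2
theorem neg_eq : D.ϱ.neg = D.total.withDensity fun x => D.dneg x :=
  D.exists_density_neg.choose_spec.2.2
theorem measurable_dς : Measurable D.dς := D.exists_density_ς.choose_spec.1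
theorem measurable_dχ : Measurable D.dχ := D.exists_density_χ.choose_spec.1
theorem measurable_dpos : Measurable D.dpos := D.exists_density_pos.choose_spec.1
theorem measurable_dneg : Measurable D.dneg := D.exists_density_neg.choose_spec.1

/-- The first order system associated with the coefficients. -/
@[simps] noncomputable def sys : System (Interval a b) where
  m := D.total
  p x := D.dς x
  q x := D.dχ x
  r x := D.dpos x - D.dneg x
  sigmaFinite := D.sigmaFinite_total
  finite_Ico := D.total_Ico_lt_top
  measurable_p := measurable_coe_nnreal_real.comp D.measurable_dς
  measurable_q := measurable_coe_nnreal_real.comp D.measurable_dχ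
  measurable_r := (measurable_coe_nnreal_real.comp D.measurable_dpos).sub
    (measurable_coe_nnreal_real.comp D.measurable_dneg)
  p_nonneg _ := NNReal.coe_nonneg _
  p_le x := D.exists_density_ς.choose_spec.2.1 x
  q_nonneg _ := NNReal.coe_nonneg _
  q_le x := D.exists_density_χ.choose_spec.2.1 x
  r_le x := by
    have h1 : (D.dpos x : ℝ) ≤ 1 := D.exists_density_pos.choose_spec.2.1 x
    have h2 : (D.dneg x : ℝ) ≤ 1 := D.exists_density_neg.choose_spec.2.1 x
    have h3 := (D.dpos x).coe_nonneg
    have h4 := (D.dneg x).coe_nonneg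
    exact abs_le.2 ⟨by linarith, by linarith⟩
  atom_pq x := by
    have h := D.atoms_ς_χ x
    rw [D.ς_eq, D.χ_eq] at h
    exact mul_mul_real_singleton h
  atom_pr x := by
    have h := D.atoms_ς_ϱ x
    rw [RealMeasure.variation, Measure.add_apply, mul_add, add_eq_zero, D.ς_eq, D.pos_eq,
      D.neg_eq] at h
    have h1 := mul_mul_real_singleton h.1
    have h2 := mul_mul_real_singleton h.2
    linear_combination h1 - h2

/-- The full support of `ς` enters here: non-empty open intervals have positive `ς`-measure. -/
theorem pPos_sys : D.sys.PPos := by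
  intro x y hxy h
  have := D.support_ς
  have h1 : D.ς (Ico x y) = 0 := by
    rw [D.ς_eq, withDensity_apply _ measurableSet_Ico]
    refine (lintegral_eq_zero_iff (measurable_coe_nnreal_ennreal.comp D.measurable_dς)).2 ?_
    filter_upwards [h] with t ht
    simpa using ht
  exact (isOpen_Ioo.measure_pos D.ς (nonempty_Ioo.2 hxy)).ne'
    (measure_mono_null Ioo_subset_Ico_self h1)

theorem q_ne_zero : ¬ D.sys.q =ᵐ[D.sys.m] 0 := by
  intro h
  refine D.χ_ne_zero ?_
  rw [D.χ_eq]
  refine (withDensity_eq_zero_iff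
    (measurable_coe_nnreal_ennreal.comp D.measurable_dχ).aemeasurable).2 ?_
  filter_upwards [h] with t ht
  simpa using ht

variable {D} {f f₁ g g₁ h : Interval a b → ℂ}

theorem hasRNDeriv_ς_iff : HasRNDeriv D.ς f f₁ ↔ Prim D.sys.m f fun s => D.sys.p s * f₁ s := by
  rw [hasRNDeriv_iff, D.ς_eq]
  exact prim_withDensity_iff D.measurable_dς

/-- Locally bounded functions are locally integrable with respect to each coefficient. -/
theorem integrableOn_Ico_of_prim {μ : Measure (Interval a b)} (hμ : IsLocallyFiniteMeasure μ)
    (hf : Prim D.sys.m f h) (x y : Interval a b) : IntegrableOn f (Ico x y) μ := by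
  obtain ⟨B, -, hB⟩ := hf.exists_bound x y
  refine Measure.integrableOn_of_bounded (M := B) (Ico_lt_top hμ x y).ne
    hf.stronglyMeasurable.aestronglyMeasurable ?_
  filter_upwards [ae_restrict_mem measurableSet_Ico] with s hs using hB s ⟨hs.1, hs.2.le⟩

theorem prim_orientedInt_χ (hf : Prim D.sys.m f h) (c : Interval a b) :
    Prim D.sys.m (orientedInt D.χ f c) fun s => D.sys.q s * f s := by
  have h1 := prim_orientedInt (integrableOn_Ico_of_prim D.locallyFinite_χ hf) c
  rw [D.χ_eq] at h1
  rw [D.χ_eq]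
  exact (prim_withDensity_iff D.measurable_dχ).1 h1

theorem prim_of_hasRNDerivReal (hf : HasRNDerivReal D.ϱ f h) :
    Prim D.sys.m f fun s => D.sys.r s * h s := by
  obtain ⟨hh, hf⟩ := hf
  have i1 : ∀ x y, IntegrableOn h (Ico x y) D.ϱ.pos := fun x y =>
    (integrableOn_Ico_of_locallyIntegrable hh x y).mono_measure (Measure.le_add_right le_rfl)
  have i2 : ∀ x y, IntegrableOn h (Ico x y) D.ϱ.neg := fun x y =>
    (integrableOn_Ico_of_locallyIntegrable hh x y).mono_measure (Measure.le_add_left le_rfl)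
  simp only [D.pos_eq, D.neg_eq, integrableOn_withDensity_iff D.measurable_dpos measurableSet_Ico,
    integrableOn_withDensity_iff D.measurable_dneg measurableSet_Ico] at i1 i2
  have e : ∀ s, (D.sys.r s : ℂ) * h s
      = ((D.dpos s : ℝ) : ℂ) * h s - ((D.dneg s : ℝ) : ℂ) * h s := by
    intro s; simp only [sys_r]; push_cast; ring
  simp only [e]
  refine ⟨fun x y => (i1 x y).sub (i2 x y), fun x y hxy => ?_⟩
  have h0 := hf x y
  rw [orientedIntReal, orientedInt_of_le hxy, orientedInt_of_le hxy] at h0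
  rw [D.pos_eq, D.neg_eq, setIntegral_withDensity D.measurable_dpos measurableSet_Ico,
    setIntegral_withDensity D.measurable_dneg measurableSet_Ico] at h0
  refine Eq.trans ?_ (integral_sub (i1 x y) (i2 x y)).symm
  rw [h0]; ring

/-- Integrability of `r * h` concerns only the difference of two densities. Requiring `h` to be a
primitive makes it locally bounded, hence locally integrable against both parts of `ϱ`, without an
appeal to their mutual singularity. -/
theorem hasRNDerivReal_of_prim (hf : Prim D.sys.m f fun s => D.sys.r s * h s)
    {h' : Interval a b → ℂ} (hh : Prim D.sys.m h h') : HasRNDerivReal D.ϱ f h := by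
  have i1 := integrableOn_Ico_of_prim D.ϱ.locallyFinite_pos hh
  have i2 := integrableOn_Ico_of_prim D.ϱ.locallyFinite_neg hh
  have hr : ∀ x y, x ≤ y → f y - f x = (∫ s in Ico x y, h s ∂D.ϱ.pos)
      - ∫ s in Ico x y, h s ∂D.ϱ.neg := by
    intro x y hxy
    have j1 := i1 x y
    have j2 := i2 x y
    rw [D.pos_eq, integrableOn_withDensity_iff D.measurable_dpos measurableSet_Ico] at j1
    rw [D.neg_eq, integrableOn_withDensity_iff D.measurable_dneg measurableSet_Ico] at j2
    rw [D.pos_eq, D.neg_eq, setIntegral_withDensity D.measurable_dpos measurableSet_Ico,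
      setIntegral_withDensity D.measurable_dneg measurableSet_Ico, ← integral_sub j1 j2,
      hf.2 x y hxy]
    congr 1; ext s; simp only [sys_r]; push_cast; ring
  refine ⟨locallyIntegrable_of_integrableOn_Ico fun x y => ?_, fun c x => ?_⟩
  · rw [RealMeasure.variation]; exact (i1 x y).add_measure (i2 x y)
  · rcases le_total c x with h1 | h1
    · rw [orientedIntReal, orientedInt_of_le h1, orientedInt_of_le h1]
      linear_combination hr c x h1
    · rw [orientedIntReal, orientedInt_of_ge h1, orientedInt_of_ge h1]
      linear_combination -hr x c h1

theorem IsQuasiDeriv.prim (hf : D.IsQuasiDeriv f f₁) : ∃ k, Prim D.sys.m f₁ k := by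
  rcases isEmpty_or_nonempty (Interval a b) with hX | ⟨⟨c⟩⟩
  · exact ⟨0, fun x => (hX.false x).elim, fun x => (hX.false x).elim⟩
  obtain ⟨h, hh⟩ := hf.2 c
  exact ⟨_, ((prim_orientedInt_χ (hasRNDeriv_ς_iff.1 hf.1) c).sub
    (prim_of_hasRNDerivReal hh)).of_eq (fun x => sub_eq_of_eq_add (by ring) : ∀ x, _ = f₁ x)
    fun _ => rfl⟩

/-- Left-continuity of primitives: as `u n` increases to `y`, the intervals `[u n, y)` shrink to the
empty set. -/
theorem exists_lt_forall_norm_sub_lt {m : Measure (Interval a b)} (hf : Prim m f h)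
    (y : Interval a b) {ε : ℝ} (hε : 0 < ε) : ∃ x < y, ∀ s ∈ Ico x y, ‖f y - f s‖ < ε := by
  obtain ⟨u, hu, huy, hlim⟩ := exists_seq_strictMono_tendsto y
  have hempty : ⋂ n, Ico (u n) y = ∅ := by
    rw [eq_empty_iff_forall_notMem]
    intro s hs
    rw [mem_iInter] at hs
    obtain ⟨n, hn⟩ := (hlim.eventually (lt_mem_nhds (hs 0).2)).exists
    exact absurd (hs n).1 (not_le.2 hn)
  have h1 := tendsto_setIntegral_of_antitone (fun n => measurableSet_Ico)
    (fun i j hij => Ico_subset_Ico_left (hu.monotone hij) : Antitone fun n => Ico (u n) y)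
    ⟨0, (hf.1 (u 0) y).norm⟩
  rw [hempty, setIntegral_empty] at h1
  obtain ⟨n, hn⟩ := (h1.eventually (gt_mem_nhds hε)).exists
  refine ⟨u n, huy n, fun s hs => ?_⟩
  refine (hf.norm_sub_le hs.2.le).trans_lt (lt_of_le_of_lt ?_ hn)
  exact setIntegral_mono_set (hf.1 _ _).norm (Eventually.of_forall fun _ => norm_nonneg _)
    (Ico_subset_Ico_left hs.1).eventuallyLE

/-- Uniqueness of the quasi-derivative. If the two representatives differ at `y`, by left-continuity
they differ on some `[x, y)`; but they agree almost everywhere on `p ≠ 0`, so `p` would vanish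
almost everywhere on that interval. -/
theorem eq_of_prim (hf : Prim D.sys.m f fun s => D.sys.p s * f₁ s)
    (hg : Prim D.sys.m f fun s => D.sys.p s * g₁ s) {k k' : Interval a b → ℂ}
    (hk : Prim D.sys.m f₁ k) (hk' : Prim D.sys.m g₁ k') : f₁ = g₁ := by
  funext y
  by_contra hne
  have hpos : 0 < ‖f₁ y - g₁ y‖ := norm_pos_iff.2 (sub_ne_zero.2 hne)
  obtain ⟨x, hxy, hx⟩ := exists_lt_forall_norm_sub_lt (hk.sub hk') y hpos
  refine D.pPos_sys x y hxy ?_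
  filter_upwards [ae_restrict_of_ae (hf.ae_eq hg), ae_restrict_mem measurableSet_Ico] with s hs hm
  have h1 := hx s hm
  by_contra h0
  have h2 : f₁ s = g₁ s := mul_left_cancel₀ (Complex.ofReal_ne_zero.2 h0) hs
  rw [h2, sub_self, sub_zero] at h1
  exact lt_irrefl _ h1

theorem IsQuasiDeriv.qd_eq (hf : D.IsQuasiDeriv f f₁) : D.qd f = f₁ := by
  have hex : ∃ f₁, D.IsQuasiDeriv f f₁ := ⟨f₁, hf⟩
  rw [qd, dif_pos hex]
  obtain ⟨k, hk⟩ := hex.choose_spec.prim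
  obtain ⟨k', hk'⟩ := hf.prim
  exact eq_of_prim (hasRNDeriv_ς_iff.1 hex.choose_spec.1) (hasRNDeriv_ς_iff.1 hf.1) hk hk'

theorem MemDomain.isQuasiDeriv (hf : D.MemDomain f) : D.IsQuasiDeriv f (D.qd f) := by
  obtain ⟨f₁, h⟩ := hf
  rwa [h.qd_eq]

theorem ACLoc.prim (hf : D.ACLoc f) : Prim D.sys.m f fun s => D.sys.p s * D.qd f s := by
  rw [← hasRNDeriv_ς_iff]
  by_cases h1 : ∃ f₁, D.IsQuasiDeriv f f₁
  · exact (MemDomain.isQuasiDeriv h1).1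
  · have h2 : ∃ f₁, HasRNDeriv D.ς f f₁ := hf
    rw [qd, dif_neg h1, dif_pos h2]
    exact h2.choose_spec

theorem acLoc_of_prim (hf : Prim D.sys.m f fun s => D.sys.p s * f₁ s) : D.ACLoc f :=
  ⟨f₁, hasRNDeriv_ς_iff.2 hf⟩

/-- The element of the abstract maximal relation given by a pair in `T_loc`. -/
@[simps] noncomputable def eltOf {f t t₁ : Interval a b → ℂ} (h : (f, t) ∈ D.TLoc)
    (ht : Prim D.sys.m t fun s => D.sys.p s * t₁ s) : Elt D.sys where
  f := f
  f₁ := D.qd f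
  t := t
  t₁ := t₁
  prim := h.1.prim
  prim₁ := by
    rcases isEmpty_or_nonempty (Interval a b) with hX | ⟨⟨c⟩⟩
    · exact ⟨fun x => (hX.false x).elim, fun x => (hX.false x).elim⟩
    · exact ((prim_orientedInt_χ h.1.prim c).sub (prim_of_hasRNDerivReal (h.2.2.2 c))).of_eq
        (fun x => by ring) fun _ => rfl
  primt := ht

theorem isQuasiDeriv_elt (P : Elt D.sys) : D.IsQuasiDeriv P.f P.f₁ ∧
    ∀ c, HasRNDerivReal D.ϱ (fun x => -P.f₁ x + orientedInt D.χ P.f c x) P.t := by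
  have h : ∀ c, HasRNDerivReal D.ϱ (fun x => -P.f₁ x + orientedInt D.χ P.f c x) P.t := fun c =>
    hasRNDerivReal_of_prim (((prim_orientedInt_χ P.prim c).sub P.prim₁).of_eq
      (fun x => by ring) fun x => by ring) P.primt
  exact ⟨⟨hasRNDeriv_ς_iff.2 P.prim, fun c => ⟨_, h c⟩⟩, h⟩

theorem qd_elt (P : Elt D.sys) : D.qd P.f = P.f₁ := (isQuasiDeriv_elt P).1.qd_eq

theorem elt_mem_TLoc (P : Elt D.sys) : (P.f, P.t) ∈ D.TLoc := by
  refine ⟨acLoc_of_prim P.prim, acLoc_of_prim P.primt, ⟨_, (isQuasiDeriv_elt P).1⟩, ?_⟩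
  rw [qd_elt P]
  exact (isQuasiDeriv_elt P).2

/-- The abstract solution given by a solution of `(τ - z) u = 0`. -/
@[simps] noncomputable def IsSolution.sol {z : ℂ} {u : Interval a b → ℂ} (h : D.IsSolution z u) :
    Sol D.sys z where
  u := u
  u₁ := D.qd u
  prim := h.1.prim
  prim₁ := (eltOf h (ACLoc.prim h.2.1)).prim₁.of_eq (fun _ => rfl) fun x => by
    simp only [eltOf, Pi.smul_apply, smul_eq_mul]; ring

theorem isSolution_sol {z : ℂ} (s : Sol D.sys z) : D.IsSolution z s.u := elt_mem_TLoc s.elt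

theorem qd_sol {z : ℂ} (s : Sol D.sys z) : D.qd s.u = s.u₁ := qd_elt s.elt

/-! ### `H¹(a,b)` and its inner product in terms of the energy density. -/

section Energy

theorem memLp_iff {s : Set (Interval a b)} (hs : MeasurableSet s)
    (hf : Prim D.sys.m f fun s => D.sys.p s * f₁ s) :
    (MemLp f 2 (D.χ.restrict s) ∧ MemLp f₁ 2 (D.ς.restrict s))
      ↔ IntegrableOn (D.sys.en f f₁) s D.sys.m := by
  have m1 : AEStronglyMeasurable f D.χ := hf.stronglyMeasurable.aestronglyMeasurable
  have m2 : AEStronglyMeasurable f₁ D.ς :=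
    (hasRNDeriv_ς_iff.2 hf).1.aestronglyMeasurable
  have key : ∀ {p : Interval a b → ℝ≥0} (hp : Measurable p) (g : Interval a b → ℂ),
      Integrable (fun x => ‖g x‖ ^ 2) ((D.total.withDensity fun x => p x).restrict s)
        ↔ IntegrableOn (fun x => (p x : ℝ) * ‖g x‖ ^ 2) s D.total := by
    intro p hp g
    rw [restrict_withDensity hs, integrable_withDensity_iff_integrable_smul hp]
    simp only [NNReal.smul_def, smul_eq_mul]
    rfl
  rw [memLp_two_iff_integrable_sq_norm m1.restrict, memLp_two_iff_integrable_sq_norm m2.restrict,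
    D.χ_eq, D.ς_eq, key D.measurable_dχ, key D.measurable_dς]
  constructor
  · rintro ⟨h1, h2⟩; exact h1.add h2
  · intro h
    have h1 : IntegrableOn (fun x => (D.dχ x : ℝ) * ‖f x‖ ^ 2) s D.total := by
      refine Integrable.mono' h ?_ (Eventually.of_forall fun x => ?_)
      · exact ((measurable_coe_nnreal_real.comp D.measurable_dχ).mul
          (hf.stronglyMeasurable.measurable.norm.pow_const 2)).aestronglyMeasurable
      · rw [Real.norm_of_nonneg (by positivity)]
        exact le_add_of_nonneg_right (mul_nonneg (NNReal.coe_nonneg _) (sq_nonneg _))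
    refine ⟨h1, (h.sub h1).congr (Eventually.of_forall fun x => ?_)⟩
    simp [System.en]

/-- Up to a null set, two representatives of `df/dς` differ only where `p = 0`, where the energy
density ignores them. Any representative may therefore be used to test membership in `H¹`. -/
theorem en_ae_eq (hf : Prim D.sys.m f fun s => D.sys.p s * f₁ s)
    (hg : Prim D.sys.m f fun s => D.sys.p s * g₁ s) :
    D.sys.en f f₁ =ᵐ[D.sys.m] D.sys.en f g₁ := by
  filter_upwards [hf.ae_eq hg] with x hx
  by_cases h0 : D.sys.p x = 0
  · simp only [System.en, h0, zero_mul]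
  · rw [System.en, System.en, mul_left_cancel₀ (Complex.ofReal_ne_zero.2 h0) hx]

theorem mem_H1_iff (hf : Prim D.sys.m f fun s => D.sys.p s * f₁ s) :
    f ∈ D.H1 ↔ Integrable (D.sys.en f f₁) D.sys.m := by
  have hac := acLoc_of_prim hf
  rw [← integrable_congr (en_ae_eq hac.prim hf), ← integrableOn_univ,
    ← memLp_iff MeasurableSet.univ hac.prim, Measure.restrict_univ, Measure.restrict_univ]
  exact ⟨fun h => h.2, fun h => ⟨hac, h⟩⟩

theorem integrable_en_of_mem_H1 (hf : f ∈ D.H1) : Integrable (D.sys.en f (D.qd f)) D.sys.m :=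
  (mem_H1_iff hf.1.prim).1 hf

theorem memH1Near_iff [Nonempty (Interval a b)] {d : Bool} (hf : D.ACLoc f) :
    D.MemH1Near (endF d) f ↔ ∃ c, IntegrableOn (D.sys.en f (D.qd f)) (tail d c) D.sys.m := by
  constructor
  · rintro ⟨-, s, hs, h1, h2⟩
    obtain ⟨c, hc⟩ := exists_tail_subset hs
    exact ⟨c, (memLp_iff (measurableSet_tail d c) hf.prim).1
      ⟨h1.mono_measure (Measure.restrict_mono hc le_rfl),
        h2.mono_measure (Measure.restrict_mono hc le_rfl)⟩⟩
  · rintro ⟨c, hc⟩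
    exact ⟨hf, tail d c, tail_mem_endF d c, (memLp_iff (measurableSet_tail d c) hf.prim).2 hc⟩

theorem memH1Near_sol_iff [Nonempty (Interval a b)] {d : Bool} {z : ℂ} (s : Sol D.sys z) :
    D.MemH1Near (endF d) s.u ↔ s.FinAt d := by
  rw [memH1Near_iff (acLoc_of_prim s.prim), qd_sol]
  exact ⟨fun ⟨c, hc⟩ => s.finAt_of_integrableOn hc, fun h => ⟨_, h (Classical.arbitrary _)⟩⟩

theorem innerH1_eq (hf : f ∈ D.H1) (hg : g ∈ D.H1) :
    D.innerH1 f g = ∫ x, D.sys.bil f (D.qd f) (fun x => star (g x)) (fun x => star (D.qd g x)) x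
      ∂D.sys.m := by
  have i1 : Integrable (fun x => f x * star (g x)) D.χ := hf.2.1.integrable_mul hg.2.1.star
  have i2 : Integrable (fun x => D.qd f x * star (D.qd g x)) D.ς :=
    hf.2.2.integrable_mul hg.2.2.star
  have e1 := setIntegral_withDensity (m := D.total) D.measurable_dχ MeasurableSet.univ
    (fun x => f x * star (g x))
  have e2 := setIntegral_withDensity (m := D.total) D.measurable_dς MeasurableSet.univ
    (fun x => D.qd f x * star (D.qd g x))
  rw [← integrableOn_univ, D.χ_eq, integrableOn_withDensity_iff D.measurable_dχ
    MeasurableSet.univ, integrableOn_univ] at i1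
  rw [← integrableOn_univ, D.ς_eq, integrableOn_withDensity_iff D.measurable_dς
    MeasurableSet.univ, integrableOn_univ] at i2
  simp only [Measure.restrict_univ] at e1 e2
  rw [innerH1, D.χ_eq, D.ς_eq, e1, e2, ← integral_add i1 i2]
  rfl

end Energy

end Coeff

end LeftDefinite

namespace MeasureSL

/-! ### Kernels built from a left and a right solution. -/

section Kernel

variable {X : Type*} [LinearOrder X] [TopologicalSpace X] [OrderTopology X]
  [SecondCountableTopology X] [MeasurableSpace X] [BorelSpace X]

/-- The density switches at `s < x` but the primitive at `y ≤ x`: integrals run over `[x, y)`, so an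
atom at `x` affects only values to the right of `x` and belongs to the right-hand piece. -/
theorem Prim.glue {m : Measure X} {F f G g : X → ℂ} (hF : Prim m F f) (hG : Prim m G g) {x : X}
    (hx : F x = G x) :
    Prim m (fun y => if y ≤ x then F y else G y) fun s => if s < x then f s else g s := by
  have hi : ∀ y w, IntegrableOn (fun s => if s < x then f s else g s) (Ico y w) m := by
    intro y w
    exact Integrable.piecewise (s := Iio x) measurableSet_Iio (hF.1 y w).integrable.integrableOn
      (hG.1 y w).integrable.integrableOn
  have hl : ∀ y w, w ≤ x → ∫ s in Ico y w, (if s < x then f s else g s) ∂m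
      = ∫ s in Ico y w, f s ∂m := fun y w hw =>
    setIntegral_congr_fun measurableSet_Ico fun s hs => if_pos (hs.2.trans_le hw)
  have hr : ∀ y w, x ≤ y → ∫ s in Ico y w, (if s < x then f s else g s) ∂m
      = ∫ s in Ico y w, g s ∂m := fun y w hy =>
    setIntegral_congr_fun measurableSet_Ico fun s hs => if_neg (not_lt.2 (hy.trans hs.1))
  have hge : ∀ y, x ≤ y → (if y ≤ x then F y else G y) = G y := by
    intro y hy
    rcases hy.eq_or_lt with rfl | h
    · rw [if_pos le_rfl, hx]
    · rw [if_neg (not_le.2 h)]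
  refine ⟨hi, fun y w hyw => ?_⟩
  beta_reduce
  rcases le_total w x with h1 | h1
  · rw [hl y w h1, if_pos h1, if_pos (hyw.trans h1), hF.2 y w hyw]
  · rcases le_total x y with h2 | h2
    · rw [hr y w h2, hge w h1, hge y h2, hG.2 y w hyw]
    · rw [← Ico_union_Ico_eq_Ico h2 h1, setIntegral_union Ico_disjoint_Ico_same measurableSet_Ico
        (hi _ _) (hi _ _), hl y x le_rfl, hr x w le_rfl, hge w h1, if_pos h2, ← hF.2 y x h2,
        ← hG.2 x w h1, hx]
      ring

variable {S : System X} {z : ℂ}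

/-- The kernel built from two solutions. -/
noncomputable def ker (s t : Sol S z) (x y : X) : ℂ :=
  if y ≤ x then s.u y * t.u x else s.u x * t.u y

/-- The derivative of the kernel built from two solutions. -/
noncomputable def ker₁ (s t : Sol S z) (x y : X) : ℂ :=
  if y < x then s.u₁ y * t.u x else s.u x * t.u₁ y

theorem prim_ker (s t : Sol S z) (x : X) :
    Prim S.m (ker s t x) fun y => S.p y * ker₁ s t x y := by
  refine ((s.prim.const_mul (t.u x)).glue (t.prim.const_mul (s.u x)) (x := x)
    (mul_comm _ _)).of_eq (fun y => ?_) fun y => ?_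
  · unfold ker; split_ifs <;> ring
  · unfold ker₁; split_ifs <;> ring

theorem ker_of_mem_Iio (s t : Sol S z) {x y : X} (h : y ∈ Iio x) :
    ker s t x y = t.u x * s.u y ∧ ker₁ s t x y = t.u x * s.u₁ y := by
  rw [ker, ker₁, if_pos (le_of_lt (mem_Iio.1 h)), if_pos (mem_Iio.1 h)]; exact ⟨mul_comm _ _, mul_comm _ _⟩

theorem ker_of_mem_Ici (s t : Sol S z) {x y : X} (h : y ∈ Ici x) :
    ker s t x y = s.u x * t.u y ∧ ker₁ s t x y = s.u x * t.u₁ y := by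
  refine ⟨?_, if_neg (not_lt.2 h)⟩
  rcases (mem_Ici.1 h).eq_or_lt with rfl | h
  · exact if_pos le_rfl
  · exact if_neg (not_le.2 h)

variable [NoMaxOrder X]

theorem integrable_en_ker {s t : Sol S z} (hs : s.FinAt false) (ht : t.FinAt true) (x : X) :
    Integrable (S.en (ker s t x) (ker₁ s t x)) S.m := by
  rw [← integrableOn_univ, ← Iio_union_Ici (a := x)]
  refine IntegrableOn.union ?_ ?_
  · refine IntegrableOn.congr_fun (((hs x).const_mul (‖t.u x‖ ^ 2) :
      IntegrableOn _ (Iio x) S.m)) (fun y hy => ?_) measurableSet_Iio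
    rw [← S.en_const_mul]
    simp only [System.en, ker_of_mem_Iio s t hy]
  · refine IntegrableOn.congr_fun (((ht x).const_mul (‖s.u x‖ ^ 2) :
      IntegrableOn _ (Ici x) S.m)) (fun y hy => ?_) measurableSet_Ici
    rw [← S.en_const_mul]
    simp only [System.en, ker_of_mem_Ici s t hy]

theorem integral_bil_ker {s t : Sol S z} (hs : s.FinAt false) (ht : t.FinAt true)
    {g g₁ : X → ℂ} (hg : Prim S.m g fun s => S.p s * g₁ s) (hgi : Integrable (S.en g g₁) S.m)
    (x : X) : ∫ y, S.bil g g₁ (ker s t x) (ker₁ s t x) y ∂S.m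
      = t.u x * (∫ y in tail false x, S.bil g g₁ s.u s.u₁ y ∂S.m)
        + s.u x * ∫ y in tail true x, S.bil g g₁ t.u t.u₁ y ∂S.m := by
  have hi := System.integrableOn_bil hg (prim_ker s t x) hgi.integrableOn
    (integrable_en_ker hs ht x).integrableOn (J := univ)
  rw [← setIntegral_univ, ← Iio_union_Ici (a := x), setIntegral_union (by
      rw [Set.disjoint_left]; exact fun _ h h' => not_lt.2 (mem_Ici.1 h') (mem_Iio.1 h)) measurableSet_Ici
      (hi.mono_set (subset_univ _)) (hi.mono_set (subset_univ _)),
    ← integral_const_mul, ← integral_const_mul]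
  congr 1
  · refine setIntegral_congr_fun measurableSet_Iio fun y hy => ?_
    simp only [System.bil, ker_of_mem_Iio s t hy]; ring
  · refine setIntegral_congr_fun measurableSet_Ici fun y hy => ?_
    simp only [System.bil, ker_of_mem_Ici s t hy]; ring

/-- The data of `a` and `b` at `c` are linearly dependent, and those of `a` are not zero because `a`
is not trivial; uniqueness extends the proportionality to all points. -/
theorem Sol.exists_eq_mul {a b : Sol S z} {c : X} (ha : ∃ x, a.u x ≠ 0)
    (hW : a.u c * b.u₁ c - a.u₁ c * b.u c = 0) :
    ∃ k : ℂ, ∀ x, b.u x = k * a.u x ∧ b.u₁ x = k * a.u₁ x := by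
  have key : ∀ k : ℂ, b.u c = k * a.u c → b.u₁ c = k * a.u₁ c →
      ∀ x, b.u x = k * a.u x ∧ b.u₁ x = k * a.u₁ x := by
    intro k h h₁ x
    have := Sol.ext_of_eq b (Sol.lin k 0 a a) (c := c) (by simp [h]) (by simp [h₁]) x
    simpa using this
  by_cases h : a.u c = 0
  · have h₁ : a.u₁ c ≠ 0 := by
      intro h₁
      obtain ⟨x, hx⟩ := ha
      exact hx (a.eq_zero h h₁ x).1
    have hb : b.u c = 0 := by
      rw [h, zero_mul, zero_sub, neg_eq_zero] at hW
      exact (mul_eq_zero.1 hW).resolve_left h₁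
    exact ⟨b.u₁ c / a.u₁ c, key _ (by rw [h, hb, mul_zero]) (by field_simp)⟩
  · refine ⟨b.u c / a.u c, key _ (by field_simp) ?_⟩
    field_simp
    linear_combination hW

theorem Sol.prim_mul (s : Sol S 0) {g g₁ : X → ℂ} (hg : Prim S.m g fun s => S.p s * g₁ s) :
    Prim S.m (fun x => g x * s.u₁ x) (S.bil g g₁ s.u s.u₁) := by
  refine (hg.mul s.prim₁ fun x => Sol.atom 0 x _ _).of_eq (fun _ => rfl) fun x => ?_
  simp only [System.bil]; ring

end Kernel

end MeasureSL

namespace LeftDefinite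

open MeasureSL

namespace Coeff

variable {a b : EReal} {D : Coeff a b}

/-! ### Limit-circle and limit-point cases, boundary conditions and the principal solutions. -/

section Endpoint

variable [Nonempty (Interval a b)] {d : Bool}

/-- Weyl's alternative for the limit-circle and limit-point cases. -/
theorem limitCircle_or_limitPoint (D : Coeff a b) (d : Bool) :
    (D.LimitCircle (endF d) ∧ ∀ z : ℂ, z ≠ 0 → ∀ s : Sol D.sys z, s.FinAt d) ∨
      (D.LimitPoint (endF d) ∧ ∀ (c : Interval a b) (P Q : Elt D.sys), P.FinAt d c →
        Q.FinAt d c → Tendsto (P.V Q) (endF d) (𝓝 0)) := by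
  rcases weyl_alternative D.pPos_sys d with h | ⟨h, h'⟩
  · exact Or.inl ⟨fun z hz u hu => (memH1Near_sol_iff hu.sol).2 (h z hz hu.sol), h⟩
  · refine Or.inr ⟨fun z hz => ?_, h'⟩
    obtain ⟨s, hs⟩ := h z hz
    exact ⟨s.u, isSolution_sol s, fun hm => hs ((memH1Near_sol_iff s).1 hm)⟩

/-- The element of the abstract maximal relation given by a pair in `T_max`. -/
noncomputable def eltMax {v : (Interval a b → ℂ) × (Interval a b → ℂ)} (hv : v ∈ D.TMax) :
    Elt D.sys := eltOf (f := v.1) (t := v.2) hv.1 (ACLoc.prim hv.1.2.1)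

theorem finAt_eltMax {v : (Interval a b → ℂ) × (Interval a b → ℂ)} (hv : v ∈ D.TMax) (d : Bool)
    (c : Interval a b) : (eltMax hv).FinAt d c :=
  ⟨(integrable_en_of_mem_H1 hv.2.1).integrableOn, (integrable_en_of_mem_H1 hv.2.2).integrableOn⟩

theorem V_star_eq (P : Elt D.sys) {v : (Interval a b → ℂ) × (Interval a b → ℂ)}
    (hv : v ∈ D.TMax) : D.V (P.f, P.t) (star v) = P.V (eltMax hv).conj := by
  have h1 : D.qd (star v).1 = (eltMax hv).conj.f₁ := qd_elt (eltMax hv).conj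
  funext x
  rw [Coeff.V, h1, qd_elt P]
  rfl

/-- Two pairs of finite energy that satisfy the boundary condition in the limit-circle case have
trivial modified Wronskian at the endpoint. -/
theorem tendsto_V_zero {v : (Interval a b → ℂ) × (Interval a b → ℂ)} (hv : v ∈ D.TMax)
    (hv' : D.LimitCircle (endF d) → D.IsBoundaryPair (endF d) v) {c : Interval a b}
    {P Q : Elt D.sys} (hP : P.FinAt d c) (hQ : Q.FinAt d c)
    (hPv : D.LimitCircle (endF d) → D.SatisfiesBC (endF d) v (P.f, P.t))
    (hQv : D.LimitCircle (endF d) → D.SatisfiesBC (endF d) v (Q.f, Q.t)) :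
    Tendsto (P.V Q) (endF d) (𝓝 0) := by
  rcases limitCircle_or_limitPoint D d with ⟨h, -⟩ | ⟨-, h⟩
  · obtain ⟨-, f, hf, l, hl, hfl⟩ := hv' h
    have h1 := hPv h
    have h2 := hQv h
    rw [SatisfiesBC, V_star_eq _ hv] at h1 h2
    rw [show f = ((eltMax hf).f, (eltMax hf).t) from rfl, V_star_eq _ hv] at hfl
    exact Elt.tendsto_V_of_tendsto hP hQ (finAt_eltMax hf d c) h1 h2 hl hfl
  · exact h c P Q hP hQ

/-- In the limit-point case every boundary condition is satisfied. -/
theorem satisfiesBC_of_finAt {v : (Interval a b → ℂ) × (Interval a b → ℂ)} (hv : v ∈ D.TMax)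
    {c : Interval a b} {P : Elt D.sys} (hP : P.FinAt d c)
    (hPv : D.LimitCircle (endF d) → D.SatisfiesBC (endF d) v (P.f, P.t)) :
    D.SatisfiesBC (endF d) v (P.f, P.t) := by
  rcases limitCircle_or_limitPoint D d with ⟨h, -⟩ | ⟨-, h⟩
  · exact hPv h
  · rw [SatisfiesBC, V_star_eq _ hv]
    exact h c P _ hP (finAt_eltMax hv d c).conj

theorem exists_isPrincipal (D : Coeff a b) (d : Bool) : ∃ w, D.IsPrincipal (endF d) w := by
  obtain ⟨w, ⟨x, hx⟩, him, hfin, hlim⟩ := Sol.exists_principal D.pPos_sys d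
  refine ⟨w.u, isSolution_sol w, fun h => hx (congrFun h x), him, (memH1Near_sol_iff w).2 hfin,
    fun g hg => ?_⟩
  rw [qd_sol]
  exact hlim g (D.qd g) hg.1.prim (integrable_en_of_mem_H1 hg)

theorem isPrincipal_principal (D : Coeff a b) (d : Bool) :
    D.IsPrincipal (endF d) (D.principal (endF d)) := by
  have h := exists_isPrincipal D d
  rw [principal, dif_pos h]
  exact h.choose_spec

/-- The principal solution at an endpoint as a solution of the system. -/
noncomputable def solPrincipal (D : Coeff a b) (d : Bool) : Sol D.sys 0 :=
  (isPrincipal_principal D d).1.sol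

theorem solPrincipal_finAt (D : Coeff a b) (d : Bool) : (D.solPrincipal d).FinAt d :=
  (memH1Near_sol_iff (D.solPrincipal d)).1 (isPrincipal_principal D d).2.2.2.1

theorem solPrincipal_ne_zero (D : Coeff a b) (d : Bool) : ∃ x, (D.solPrincipal d).u x ≠ 0 := by
  by_contra! h
  exact (isPrincipal_principal D d).2.1 (funext h)

theorem solPrincipal_tendsto (D : Coeff a b) (d : Bool) {g : Interval a b → ℂ} (hg : g ∈ D.H1) :
    Tendsto (fun x => g x * (D.solPrincipal d).u₁ x) (endF d) (𝓝 0) :=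
  (isPrincipal_principal D d).2.2.2.2 g hg

/-- Because `τ w = 0`, the `H¹` density of `g` and `w` is the derivative of `g w^[1]`, and the
boundary term at the endpoint vanishes since `w` is principal. -/
theorem integral_bil_principal (D : Coeff a b) (d : Bool) {g g₁ : Interval a b → ℂ}
    (hg : Prim D.sys.m g fun s => D.sys.p s * g₁ s) (hgi : Integrable (D.sys.en g g₁) D.sys.m)
    (x : Interval a b) :
    sg d * ∫ y in tail d x, D.sys.bil g g₁ (D.solPrincipal d).u (D.solPrincipal d).u₁ y ∂D.sys.m
      = -(g x * (D.solPrincipal d).u₁ x) := by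
  have h := ((D.solPrincipal d).prim_mul hg).eq_of_tendsto (System.integrableOn_bil hg
    (D.solPrincipal d).prim hgi.integrableOn (D.solPrincipal_finAt d x))
    (D.solPrincipal_tendsto d ((mem_H1_iff hg).2 hgi))
  rw [h]; ring

end Endpoint

theorem integrable_of_finAt {z : ℂ} {s : Sol D.sys z} (h : s.FinAt false) (h' : s.FinAt true)
    (x : Interval a b) : Integrable (D.sys.en s.u s.u₁) D.sys.m := by
  rw [← integrableOn_univ, ← Iio_union_Ici (a := x)]
  exact (h x).union (h' x)

theorem FinAt_of_eq_mul {z : ℂ} {s t : Sol D.sys z} {d : Bool} {k : ℂ}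
    (h : ∀ x, t.u x = k * s.u x ∧ t.u₁ x = k * s.u₁ x) (hs : s.FinAt d) : t.FinAt d :=
  Sol.FinAt.of_eq (hs.lin hs k 0) fun x => by simp [(h x).1, (h x).2]

/-- If `w_a` and `w_b` were proportional, `w_a` would lie in `H¹(a,b)` and be principal at both
endpoints. Testing with its conjugate, the boundary terms at `x` cancel and the total energy is
zero; then `w_a` is a non-zero constant with `q = 0` almost everywhere, contradicting `χ ≠ 0`. -/
theorem principal_wronskian_ne_zero [Nonempty (Interval a b)] (D : Coeff a b) (x : Interval a b) :
    (D.solPrincipal true).u x * (D.solPrincipal false).u₁ x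
      - (D.solPrincipal true).u₁ x * (D.solPrincipal false).u x ≠ 0 := by
  intro hW
  set wa := D.solPrincipal false with hwa
  set wb := D.solPrincipal true with hwb
  obtain ⟨k, hk⟩ : ∃ k, ∀ x, wa.u x = k * wb.u x ∧ wa.u₁ x = k * wb.u₁ x :=
    Sol.exists_eq_mul (D.solPrincipal_ne_zero true) hW
  have ha : wa.FinAt true := FinAt_of_eq_mul hk (D.solPrincipal_finAt true)
  have hk0 : k ≠ 0 := by
    rintro rfl
    obtain ⟨y, hy⟩ := D.solPrincipal_ne_zero false
    exact hy (by rw [← hwa, (hk y).1, zero_mul])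
  have hint := integrable_of_finAt (D.solPrincipal_finAt false) ha x
  have hcint : Integrable (D.sys.en (fun y => star (wa.u y)) fun y => star (wa.u₁ y)) D.sys.m := by
    rwa [System.en_star]
  have hen : ∀ y, D.sys.bil (fun y => star (wa.u y)) (fun y => star (wa.u₁ y)) wa.u wa.u₁ y
      = (D.sys.en wa.u wa.u₁ y : ℂ) := by
    intro y
    have h : ∀ a : ℂ, (‖a‖ : ℂ) ^ 2 = a * star a := fun a => (Complex.mul_conj' a).symm
    simp only [System.bil, System.en]
    push_cast
    rw [h, h]; ring
  have h1 := D.integral_bil_principal false wa.conj.prim hcint x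
  have h2 := D.integral_bil_principal true wa.conj.prim hcint x
  have e2 : ∫ y in tail true x, D.sys.bil wa.conj.u wa.conj.u₁ wb.u wb.u₁ y ∂D.sys.m
      = k⁻¹ * ∫ y in tail true x, D.sys.bil wa.conj.u wa.conj.u₁ wa.u wa.u₁ y ∂D.sys.m := by
    rw [← integral_const_mul]
    congr 1; ext y
    simp only [System.bil, (hk y).1, (hk y).2]; field_simp
  have e3 : wb.u₁ x = k⁻¹ * wa.u₁ x := by rw [(hk x).2]; field_simp
  rw [← hwb, e2, e3] at h2
  have h2' : sg true * ∫ y in tail true x, D.sys.bil wa.conj.u wa.conj.u₁ wa.u wa.u₁ y ∂D.sys.m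
      = -(wa.conj.u x * wa.u₁ x) := by
    have := congrArg (k * ·) h2
    field_simp at this
    exact this
  rw [← hwa] at h1
  simp only [Sol.conj, hen, integral_complex_ofReal, sg] at h1 h2'
  have hsum : (∫ y in tail false x, D.sys.en wa.u wa.u₁ y ∂D.sys.m)
      + ∫ y in tail true x, D.sys.en wa.u wa.u₁ y ∂D.sys.m = 0 := by
    have : ((∫ y in tail false x, D.sys.en wa.u wa.u₁ y ∂D.sys.m : ℝ) : ℂ)
      + (∫ y in tail true x, D.sys.en wa.u wa.u₁ y ∂D.sys.m : ℝ) = 0 := by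
      simp only [Bool.false_eq_true, if_false, if_true] at h1 h2'
      linear_combination h2' - h1
    exact_mod_cast this
  have htot : ∫ y, D.sys.en wa.u wa.u₁ y ∂D.sys.m = 0 := by
    rw [← setIntegral_univ, ← Iio_union_Ici (a := x), setIntegral_union (by
      rw [Set.disjoint_left]; exact fun _ h h' => not_lt.2 (mem_Ici.1 h') (mem_Iio.1 h)) measurableSet_Ici
      hint.integrableOn hint.integrableOn]
    exact hsum
  have hae := (integral_eq_zero_iff_of_nonneg (D.sys.en_nonneg wa.u wa.u₁) hint).1 htot
  have hp : ∀ᵐ t ∂D.sys.m, (D.sys.p t : ℂ) * wa.u₁ t = 0 ∧ D.sys.q t * ‖wa.u t‖ ^ 2 = 0 := by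
    filter_upwards [hae] with t ht
    have h1 := mul_nonneg (D.sys.q_nonneg t) (sq_nonneg ‖wa.u t‖)
    have h2 := mul_nonneg (D.sys.p_nonneg t) (sq_nonneg ‖wa.u₁ t‖)
    simp only [System.en, Pi.zero_apply] at ht
    refine ⟨?_, by linarith⟩
    have h3 : D.sys.p t * ‖wa.u₁ t‖ ^ 2 = 0 := by linarith
    rcases mul_eq_zero.1 h3 with h | h
    · simp only [h, Complex.ofReal_zero, zero_mul]
    · rw [norm_eq_zero.1 (pow_eq_zero_iff two_ne_zero |>.1 h), mul_zero]
  have hconst : ∀ y, wa.u y = wa.u x := by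
    intro y
    have hz : ∀ s t, ∫ r in Ico s t, (D.sys.p r : ℂ) * wa.u₁ r ∂D.sys.m = 0 := fun s t =>
      integral_eq_zero_of_ae (ae_restrict_of_ae (hp.mono fun r hr => hr.1))
    rcases le_total x y with h | h
    · have := wa.prim.2 x y h
      rw [hz] at this; exact sub_eq_zero.1 this
    · have := wa.prim.2 y x h
      rw [hz] at this; exact (sub_eq_zero.1 this).symm
  obtain ⟨y, hy⟩ := D.solPrincipal_ne_zero false
  refine D.q_ne_zero ?_
  filter_upwards [hp] with t ht
  have hne : wa.u t ≠ 0 := by rw [hconst t, ← hconst y]; exact hy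
  simpa [hne] using ht.2

end Coeff

end LeftDefinite

namespace LeftDefinite

open MeasureSL

/-! ### Reproducing kernel and resolvent equation. -/

namespace Coeff

variable {a b : EReal} {D : Coeff a b}

/-- The function `δ_x` represents the point evaluation at `x`. -/
theorem integral_bil_principal_ker [Nonempty (Interval a b)] (D : Coeff a b)
    {g g₁ : Interval a b → ℂ} (hg : Prim D.sys.m g fun s => D.sys.p s * g₁ s)
    (hgi : Integrable (D.sys.en g g₁) D.sys.m) (x : Interval a b) :
    ∫ y, D.sys.bil g g₁ (ker (D.solPrincipal false) (D.solPrincipal true) x)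
      (ker₁ (D.solPrincipal false) (D.solPrincipal true) x) y ∂D.sys.m
      = g x * D.wronskian (D.principal atTop) (D.principal atBot) x := by
  have h1 := D.integral_bil_principal false hg hgi x
  have h2 := D.integral_bil_principal true hg hgi x
  simp only [sg, Bool.false_eq_true, if_false, if_true] at h1 h2
  rw [integral_bil_ker (D.solPrincipal_finAt false) (D.solPrincipal_finAt true) hg hgi]
  change _ = g x * ((D.solPrincipal true).u x * (D.solPrincipal false).u₁ x
    - (D.solPrincipal true).u₁ x * (D.solPrincipal false).u x)
  linear_combination (-(D.solPrincipal true).u x) * h1 + (D.solPrincipal false).u x * h2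

theorem delta_eq [Nonempty (Interval a b)] (D : Coeff a b) (x y : Interval a b) :
    D.delta x y = ker (D.solPrincipal false) (D.solPrincipal true) x y /
      D.wronskian (D.principal atTop) (D.principal atBot) x := rfl

theorem star_mem_H1 {f f₁ : Interval a b → ℂ} (hf : Prim D.sys.m f fun s => D.sys.p s * f₁ s)
    (hfi : Integrable (D.sys.en f f₁) D.sys.m) : star f ∈ D.H1 := by
  have hp : Prim D.sys.m (star f) fun s => D.sys.p s * star (f₁ s) :=
    hf.conj.of_eq (fun _ => rfl) fun _ => by simp
  rw [mem_H1_iff hp]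
  exact (System.en_star D.sys f f₁).symm ▸ hfi

/-- The conjugate in the second slot cancels against that of the inner product. The chosen
derivative `D.qd (star f)` need only agree with `star f₁` after multiplication by `p`, almost
everywhere. -/
theorem innerH1_star {g f f₁ : Interval a b → ℂ} (hg : g ∈ D.H1)
    (hf : Prim D.sys.m f fun s => D.sys.p s * f₁ s) (hfi : Integrable (D.sys.en f f₁) D.sys.m) :
    D.innerH1 g (star f) = ∫ x, D.sys.bil g (D.qd g) f f₁ x ∂D.sys.m := by
  have hs := star_mem_H1 hf hfi
  have hp : Prim D.sys.m (star f) fun s => D.sys.p s * star (f₁ s) :=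
    hf.conj.of_eq (fun _ => rfl) fun _ => by simp
  rw [innerH1_eq hg hs]
  refine integral_congr_ae ?_
  filter_upwards [hs.1.prim.ae_eq hp] with x hx
  have h1 : (D.sys.p x : ℂ) * star (D.qd (star f) x) = D.sys.p x * f₁ x := by
    have := congrArg star hx
    simpa [mul_comm] using this
  simp only [System.bil, Pi.star_apply, star_star]
  linear_combination D.qd g x * h1

/-- A solution of finite energy at both endpoints that satisfies the boundary conditions gives
rise to an element of the self-adjoint restriction. -/
theorem sol_mem_sepRestriction [Nonempty (Interval a b)]
    {va vb : (Interval a b → ℂ) × (Interval a b → ℂ)} (hva : va ∈ D.TMax) (hvb : vb ∈ D.TMax)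
    {z : ℂ} (s : Sol D.sys z) (ha : s.FinAt false) (hb : s.FinAt true)
    (hsa : D.LimitCircle atBot → D.SatisfiesBC atBot va (s.u, z • s.u))
    (hsb : D.LimitCircle atTop → D.SatisfiesBC atTop vb (s.u, z • s.u)) :
    s.u ∈ D.H1 ∧ (s.u, z • s.u) ∈ D.sepRestriction va vb := by
  obtain ⟨c⟩ := ‹Nonempty (Interval a b)›
  have : Nonempty (Interval a b) := ⟨c⟩
  have h1 : s.u ∈ D.H1 := (mem_H1_iff s.prim).2 (integrable_of_finAt ha hb c)
  have h2 : z • s.u ∈ D.H1 := by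
    refine (mem_H1_iff s.elt.primt).2 ?_
    rw [← integrableOn_univ, ← Iio_union_Ici (a := c)]
    exact (ha.elt c).t.union (hb.elt c).t
  exact ⟨h1, ⟨isSolution_sol s, h1, h2⟩,
    satisfiesBC_of_finAt (d := false) hva (P := s.elt) (ha.elt c) hsa,
    satisfiesBC_of_finAt (d := true) hvb (P := s.elt) (hb.elt c) hsb⟩

/-- In the limit-circle case finite energy is automatic, in the limit-point case it is assumed, and
Weyl's alternative leaves no other case. -/
theorem finAt_of_cases [Nonempty (Interval a b)] {d : Bool} {z : ℂ} (hz : z ≠ 0)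
    (s : Sol D.sys z) (h : D.LimitPoint (endF d) → D.MemH1Near (endF d) s.u) : s.FinAt d := by
  rcases limitCircle_or_limitPoint D d with ⟨-, h'⟩ | ⟨h', -⟩
  · exact h' z hz s
  · exact (memH1Near_sol_iff s).1 (h h')

/-- The Wronskian of the solutions satisfying the boundary conditions does not vanish. -/
theorem V_ne_zero [Nonempty (Interval a b)]
    {va vb : (Interval a b → ℂ) × (Interval a b → ℂ)} (hva : va ∈ D.TMax) (hvb : vb ∈ D.TMax)
    {z : ℂ} (hz : z ∈ D.resolventSet (D.sepRestriction va vb)) (hz0 : z ≠ 0)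
    {s t : Sol D.sys z} (hs0 : s.u ≠ 0) (ht0 : t.u ≠ 0) (hs : s.FinAt false) (ht : t.FinAt true)
    (hsa : D.LimitCircle atBot → D.SatisfiesBC atBot va (s.u, z • s.u))
    (htb : D.LimitCircle atTop → D.SatisfiesBC atTop vb (t.u, z • t.u)) (x : Interval a b) :
    t.elt.V s.elt x ≠ 0 := by
  intro hV
  have hW : t.u x * s.u₁ x - t.u₁ x * s.u x = 0 := by
    have : z * (t.u x * s.u₁ x - t.u₁ x * s.u x) = 0 := by
      rw [← hV]; simp only [Elt.V, Sol.elt]; ring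
    exact (mul_eq_zero.1 this).resolve_left hz0
  -- Being a multiple of `t`, the solution `s` inherits finite energy and the boundary condition at
  -- `b`; it is thus an eigenfunction of `S`.
  obtain ⟨k, hk⟩ := Sol.exists_eq_mul (Function.ne_iff.1 ht0) hW
  have hst : s.FinAt true := FinAt_of_eq_mul hk ht
  have hsb : D.LimitCircle atTop → D.SatisfiesBC atTop vb (s.u, z • s.u) := by
    intro h
    have h1 := htb h
    change Tendsto (D.V (t.elt.f, t.elt.t) (star vb)) atTop (𝓝 0) at h1
    change Tendsto (D.V (s.elt.f, s.elt.t) (star vb)) atTop (𝓝 0)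
    rw [V_star_eq _ hvb] at h1 ⊢
    have h2 := h1.const_mul k
    rw [mul_zero] at h2
    refine h2.congr fun y => ?_
    simp only [Elt.V, Sol.elt_t, Sol.elt_f₁, (hk y).1, (hk y).2]; ring
  -- The zero function, as a solution. Both it and `s` solve the resolvent equation with right-hand
  -- side `0`, against uniqueness at points of the resolvent set.
  obtain ⟨o, ho, ho₁⟩ := exists_sol D.sys z x 0 0
  have hoz : ∀ y, o.u y = 0 ∧ o.u₁ y = 0 := o.eq_zero ho ho₁
  have hok : ∀ y, o.u y = 0 * s.u y ∧ o.u₁ y = 0 * s.u₁ y := fun y => by simp [hoz y]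
  have hoV : ∀ P : Elt D.sys, o.elt.V P = 0 := fun P => by
    funext y; simp [Elt.V, hoz y]
  have hobc : ∀ {v : (Interval a b → ℂ) × (Interval a b → ℂ)} (d : Bool), v ∈ D.TMax →
      D.SatisfiesBC (endF d) v (o.u, z • o.u) := by
    intro v d hv
    change Tendsto (D.V (o.elt.f, o.elt.t) (star v)) (endF d) (𝓝 0)
    rw [V_star_eq _ hv, hoV]
    exact tendsto_const_nhds
  have m1 := sol_mem_sepRestriction hva hvb s hs hst hsa hsb
  have m2 := sol_mem_sepRestriction hva hvb o (FinAt_of_eq_mul hok hs) (FinAt_of_eq_mul hok hst)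
    (fun _ => hobc false hva) (fun _ => hobc true hvb)
  have h0 : (0 : Interval a b → ℂ) ∈ D.H1 := by
    have := m2.1
    rwa [show o.u = 0 from funext fun y => (hoz y).1] at this
  have := (hz.1 0 h0).unique (y₁ := s.u) (y₂ := o.u) (by simpa using m1) (by simpa using m2)
  exact hs0 (this.trans (funext fun y => (hoz y).1))

theorem resolvent_spec {A : Set ((Interval a b → ℂ) × (Interval a b → ℂ))} {z : ℂ}
    (hz : z ∈ D.resolventSet A) {g : Interval a b → ℂ} (hg : g ∈ D.H1) :
    D.resolvent A z g ∈ D.H1 ∧ (D.resolvent A z g, g + z • D.resolvent A z g) ∈ A := by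
  have h := (hz.1 g hg).exists
  rw [resolvent, dif_pos h]
  exact h.choose_spec

/-- The resolvent equation solved by means of the solutions `s` and `t`. -/
theorem resolvent_eq [Nonempty (Interval a b)]
    {va vb : (Interval a b → ℂ) × (Interval a b → ℂ)} (hva : va ∈ D.TMax) (hvb : vb ∈ D.TMax)
    (hva' : D.LimitCircle atBot → D.IsBoundaryPair atBot va)
    (hvb' : D.LimitCircle atTop → D.IsBoundaryPair atTop vb) {z : ℂ}
    {s t : Sol D.sys z} (hs : s.FinAt false) (ht : t.FinAt true)
    (hsa : D.LimitCircle atBot → D.SatisfiesBC atBot va (s.u, z • s.u))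
    (htb : D.LimitCircle atTop → D.SatisfiesBC atTop vb (t.u, z • t.u))
    {f g : Interval a b → ℂ} (hf : f ∈ D.H1) (hg : g ∈ D.H1)
    (hfg : (f, g + z • f) ∈ D.sepRestriction va vb) (x : Interval a b) :
    (g x + z * f x) * t.elt.V s.elt x
      = z * ∫ y, D.sys.bil g (D.qd g) (ker s t x) (ker₁ s t x) y ∂D.sys.m := by
  have hgp := hg.1.prim
  have hgi := integrable_en_of_mem_H1 hg
  have hfi := integrable_en_of_mem_H1 hf
  have hlin : Prim D.sys.m (g + z • f) fun s => D.sys.p s * (1 * D.qd g s + z * D.qd f s) :=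
    (hgp.add (hf.1.prim.const_mul z)).of_eq (fun _ => rfl) fun _ => by ring
  let P : Elt D.sys := eltOf hfg.1.1 hlin
  have hPt : ∀ y, P.t y = g y + z * f y := fun _ => rfl
  have hP : ∀ d, P.FinAt d x := by
    intro d
    refine ⟨hfi.integrableOn, ?_⟩
    have h := System.integrableOn_en_lin hgp hf.1.prim (hgi.integrableOn (s := tail d x))
      hfi.integrableOn 1 z
    simp only [one_mul] at h
    simp only [P, eltOf, one_mul]
    exact h
  -- The second component of `P` is `g + z f`, and the contribution of `z f` cancels against `f`
  -- paired with `z w`.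
  have hL : ∀ w : Sol D.sys z, P.L w.elt = D.sys.bil g (D.qd g) w.u w.u₁ := by
    intro w; ext y
    simp only [Elt.L, System.bil, Sol.elt, P, eltOf, Pi.add_apply, Pi.smul_apply, smul_eq_mul]
    ring
  have h1 : P.V s.elt x = ∫ y in tail false x, D.sys.bil g (D.qd g) s.u s.u₁ y ∂D.sys.m := by
    have h := (P.prim_V s.elt).eq_of_tendsto ((hP false).integrableOn_L (hs.elt x))
      (tendsto_V_zero (d := false) hva hva' (hP false) (hs.elt x) (fun _ => hfg.2.1) hsa)
    rw [h, hL]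
    simp [sg]
  have h2 : P.V t.elt x = -∫ y in tail true x, D.sys.bil g (D.qd g) t.u t.u₁ y ∂D.sys.m := by
    have h := (P.prim_V t.elt).eq_of_tendsto ((hP true).integrableOn_L (ht.elt x))
      (tendsto_V_zero (d := true) hvb hvb' (hP true) (ht.elt x) (fun _ => hfg.2.2) htb)
    rw [h, hL]
    simp [sg]
  -- What remains is that in `t(x) V(P, s) - s(x) V(P, t)` the quasi-derivative of `f` cancels,
  -- leaving `P.t` times the Wronskian of `t` and `s`.
  rw [integral_bil_ker hs ht hgp hgi, ← h1, ← neg_eq_iff_eq_neg.2 h2, ← hPt]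
  simp only [Elt.V, Sol.elt]
  ring

end Coeff

end LeftDefinite

theorem mainTheorem11 {a b : EReal} (D : LeftDefinite.Coeff a b)
    (va vb : (LeftDefinite.Interval a b → ℂ) × (LeftDefinite.Interval a b → ℂ))
    (hva : va ∈ D.TMax) (hvb : vb ∈ D.TMax)
    (hva' : D.LimitCircle atBot → D.IsBoundaryPair atBot va)
    (hvb' : D.LimitCircle atTop → D.IsBoundaryPair atTop vb)
    (z : ℂ) (hz : z ∈ D.resolventSet (D.sepRestriction va vb)) (hz0 : z ≠ 0)
    (ua ub : LeftDefinite.Interval a b → ℂ)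
    (hua : D.IsSolution z ua) (hua0 : ua ≠ 0)
    (hub : D.IsSolution z ub) (hub0 : ub ≠ 0)
    (hua_lc : D.LimitCircle atBot → D.SatisfiesBC atBot va (ua, z • ua))
    (hua_lp : D.LimitPoint atBot → D.MemH1Near atBot ua)
    (hub_lc : D.LimitCircle atTop → D.SatisfiesBC atTop vb (ub, z • ub))
    (hub_lp : D.LimitPoint atTop → D.MemH1Near atTop ub) :
    ∃ v : ℂ, v ≠ 0 ∧ (∀ x, D.V (ub, z • ub) (ua, z • ua) x = v) ∧
      ∃ G : LeftDefinite.Interval a b → LeftDefinite.Interval a b → ℂ,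
        (∀ x y, G x y + D.delta x y / z =
          1 / v * (if y ≤ x then ua y * ub x else ua x * ub y)) ∧
        (∀ x, star (G x) ∈ D.H1) ∧
        ∀ g ∈ D.H1, ∀ x,
          D.resolvent (D.sepRestriction va vb) z g x = D.innerH1 g (star (G x)) := by
  obtain ⟨c, -⟩ := Function.ne_iff.1 hua0
  have : Nonempty (LeftDefinite.Interval a b) := ⟨c⟩
  let s := hua.sol
  let t := hub.sol
  have hs : s.FinAt false := LeftDefinite.Coeff.finAt_of_cases hz0 s hua_lp
  have ht : t.FinAt true := LeftDefinite.Coeff.finAt_of_cases hz0 t hub_lp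
  have hVx : ∀ x, t.elt.V s.elt x = t.elt.V s.elt c := by
    intro x
    have e : ∀ y, t.elt.V s.elt y = z * (t.u y * s.u₁ y - t.u₁ y * s.u y) := by
      intro y; simp only [MeasureSL.Elt.V, MeasureSL.Sol.elt]; ring
    rw [e, e, t.wronskian_const s x c]
  have hV0 := LeftDefinite.Coeff.V_ne_zero hva hvb hz hz0 (s := s) (t := t) hua0 hub0 hs ht
    hua_lc hub_lc c
  set v := t.elt.V s.elt c with hv
  let wa := D.solPrincipal false
  let wb := D.solPrincipal true
  have hwa : wa.FinAt false := D.solPrincipal_finAt false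
  have hwb : wb.FinAt true := D.solPrincipal_finAt true
  let W := D.wronskian (D.principal atTop) (D.principal atBot)
  have hW : ∀ x, W x ≠ 0 := D.principal_wronskian_ne_zero
  -- The second term is `-δ_x / z`. As `δ_x` is normalized by the Wronskian at `x` itself, `W` is
  -- kept as a function of `x` and its constancy is not needed.
  let G : LeftDefinite.Interval a b → LeftDefinite.Interval a b → ℂ := fun x y =>
    1 / v * MeasureSL.ker s t x y + -(1 / (z * W x)) * MeasureSL.ker wa wb x y
  let G₁ : LeftDefinite.Interval a b → LeftDefinite.Interval a b → ℂ := fun x y =>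
    1 / v * MeasureSL.ker₁ s t x y + -(1 / (z * W x)) * MeasureSL.ker₁ wa wb x y
  have hGp : ∀ x, MeasureSL.Prim D.sys.m (G x) fun y => D.sys.p y * G₁ x y := fun x =>
    (((MeasureSL.prim_ker s t x).const_mul (1 / v)).add
      ((MeasureSL.prim_ker wa wb x).const_mul (-(1 / (z * W x))))).of_eq (fun _ => rfl)
      fun _ => by simp only [G₁]; ring
  have hGi : ∀ x, Integrable (D.sys.en (G x) (G₁ x)) D.sys.m := fun x => by
    have h := MeasureSL.System.integrableOn_en_lin (MeasureSL.prim_ker s t x)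
      (MeasureSL.prim_ker wa wb x) (MeasureSL.integrable_en_ker hs ht x).integrableOn
      (MeasureSL.integrable_en_ker hwa hwb x).integrableOn (1 / v) (-(1 / (z * W x))) (J := univ)
    rwa [integrableOn_univ] at h
  refine ⟨v, hV0, fun x => hVx x, G, fun x y => ?_,
    fun x => LeftDefinite.Coeff.star_mem_H1 (hGp x) (hGi x), fun g hg x => ?_⟩
  · rw [D.delta_eq]
    change 1 / v * MeasureSL.ker s t x y + -(1 / (z * W x)) * MeasureSL.ker wa wb x y
      + MeasureSL.ker wa wb x y / W x / z = 1 / v * MeasureSL.ker s t x y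
    have := hW x
    field_simp
    ring
  · obtain ⟨hf, hfg⟩ := LeftDefinite.Coeff.resolvent_spec hz hg
    have hgp := hg.1.prim
    have hgi := LeftDefinite.Coeff.integrable_en_of_mem_H1 hg
    have e1 := LeftDefinite.Coeff.resolvent_eq hva hvb hva' hvb' hs ht hua_lc hub_lc hf hg hfg x
    have e2 := D.integral_bil_principal_ker hgp hgi x
    have i1 := MeasureSL.System.integrableOn_bil hgp (MeasureSL.prim_ker s t x)
      hgi.integrableOn (MeasureSL.integrable_en_ker hs ht x).integrableOn (J := univ)
    have i2 := MeasureSL.System.integrableOn_bil hgp (MeasureSL.prim_ker wa wb x)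
      hgi.integrableOn (MeasureSL.integrable_en_ker hwa hwb x).integrableOn (J := univ)
    rw [integrableOn_univ] at i1 i2
    have e3 : ∫ y, D.sys.bil g (D.qd g) (G x) (G₁ x) y ∂D.sys.m
        = 1 / v * (∫ y, D.sys.bil g (D.qd g) (MeasureSL.ker s t x) (MeasureSL.ker₁ s t x) y
            ∂D.sys.m)
          + -(1 / (z * W x)) * ∫ y, D.sys.bil g (D.qd g) (MeasureSL.ker wa wb x)
            (MeasureSL.ker₁ wa wb x) y ∂D.sys.m := by
      rw [← integral_const_mul, ← integral_const_mul,
        ← integral_add (i1.const_mul _) (i2.const_mul _)]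
      congr 1; ext y
      simp only [MeasureSL.System.bil, G, G₁]; ring
    rw [LeftDefinite.Coeff.innerH1_star hg (hGp x) (hGi x), e3, e2]
    rw [hVx] at e1
    have hWx := hW x
    -- By the reproducing property the correction term contributes exactly `-g(x) / z`, which
    -- matches `g + z f` on the left of the resolvent equation `e1`.
    change _ = _ + -(1 / (z * W x)) * (g x * W x)
    field_simp
    linear_combination e1
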